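/- Let $d\ge 2$, let $j\in\mathbb R\setminus\{0\}$ and $V_0(x)=j\,x_1$ on $\mathbb R^d$. Let $K\subset\mathbb R^d$ be a compact set with smooth boundary and non-empty interior $\dot K$, and let $\Omega=\mathbb R^d\setminus K$. For an open set $U\subset\mathbb R^d$, the Neumann realization $\mathcal A^N_{U,V_0}$ of $-\Delta+iV_0$ in $L^2(U)$ is the operator associated with the sesquilinear form $$a_U(u,v)=\int_U\nabla u\cdot\overline{\nabla v}\,dx+i\int_U V_0\,u\,\overline v\,dx$$ on the form domain $\mathcal V(U)=\{u\in H^1(U):\ |V_0|^{1/2}u\in L^2(U)\}$: a function $u$ lies in its domain, with $\mathcal A^N_{U,V_0}u=f\in L^2(U)$, if and only if $u\in\mathcal V(U)$ and $a_U(u,v)=\int_U f\,\overline v\,dx$ for all $v\in\mathcal V(U)$. For $U=\mathbb R^d$ (no boundary) this operator is $-\Delta+iV_0$ on $\mathbb R^d$. For a bounded operator $T$ on a Hilbert space, let $\sigma_{ess}(T)$ be the set of those $\lambda\in\sigma(T)$ that fail at least one of the following conditions: (1) $\ker(T-\lambda)$ has finite dimension; (2) the range $R(T-\lambda)$ is closed;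 (3) $R(T-\lambda)$ has finite codimension; (4) $\lambda$ is an isolated point of $\sigma(T)$. Then the inverses $A=(-\Delta+iV_0+1)^{-1}$ on $L^2(\mathbb R^d)$ and $(\mathcal A^N_{\Omega,V_0}+1)^{-1}$ on $L^2(\Omega)$ exist as bounded, everywhere defined operators. Moreover, if $$B=0\oplus(\mathcal A^N_{\Omega,V_0}+1)^{-1}\qquad\text{on } L^2(\mathbb R^d)=L^2(\dot K)\oplus L^2(\Omega),$$ then $A-B$ is a compact operator on $L^2(\mathbb R^d)$, and $\sigma_{ess}(A)=\sigma_{ess}(B)$. -/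

import Mathlib

open MeasureTheory Filter Topology TopologicalSpace
open scoped ContDiff ComplexConjugate

noncomputable section

namespace ExteriorSchrodinger

/-- The Euclidean space `ℝ^d`. -/
abbrev Rd (d : ℕ) : Type := EuclideanSpace ℝ (Fin d)

/-- The complex Hilbert space `L²(Ω)` of an open set `Ω ⊆ ℝ^d` with Lebesgue measure.
The space `L²(ℝ^d)` is `L2 ⊤`. -/
abbrev L2 {d : ℕ} (Ω : Opens (Rd d)) : Type :=
  Lp ℂ 2 ((volume : Measure (Rd d)).restrict (Ω : Set (Rd d)))

/-- A real test function on `Ω`: an element of `C_c^∞(Ω)`. -/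
def IsTestFunction {d : ℕ} (Ω : Opens (Rd d)) (φ : Rd d → ℝ) : Prop :=
  ContDiff ℝ ∞ φ ∧ HasCompactSupport φ ∧ tsupport φ ⊆ (Ω : Set (Rd d))

/-- The partial derivative `∂_i φ`. -/
def partialDeriv {d : ℕ} (i : Fin d) (φ : Rd d → ℝ) (x : Rd d) : ℝ :=
  fderiv ℝ φ x (EuclideanSpace.single i (1 : ℝ))

/-- `G = (G_1, …, G_d) ∈ L²(Ω)^d` is the weak gradient of `u ∈ L²(Ω)`. Thus `u ∈ H¹(Ω)` if and
only if `∃ G, HasWeakGradient Ω u G`. -/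
def HasWeakGradient {d : ℕ} (Ω : Opens (Rd d)) (u : L2 Ω) (G : Fin d → L2 Ω) : Prop :=
  ∀ (i : Fin d) (φ : Rd d → ℝ), IsTestFunction Ω φ →
    ∫ x in (Ω : Set (Rd d)), partialDeriv i φ x • u x
      = - ∫ x in (Ω : Set (Rd d)), φ x • G i x

/-- The condition `|V|^{1/2} u ∈ L²(Ω)`. -/
def HasFinitePotential {d : ℕ} (Ω : Opens (Rd d)) (V : C(Rd d, ℝ)) (u : L2 Ω) : Prop :=
  MemLp (fun x => √|V x| • u x) 2 ((volume : Measure (Rd d)).restrict (Ω : Set (Rd d)))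

/-- `u` lies in the domain of the Neumann realization of `-Δ + i V` in `L²(Ω)`, and `f` is its
image: `u` belongs to the form domain `{u ∈ H¹(Ω) : |V|^{1/2} u ∈ L²(Ω)}` and
`∫_Ω ∇u · conj ∇v + i ∫_Ω V u conj v = ∫_Ω f conj v` for all `v` in the form domain. -/
def IsNeumannImage {d : ℕ} (Ω : Opens (Rd d)) (V : C(Rd d, ℝ)) (u f : L2 Ω) : Prop :=
  HasFinitePotential Ω V u ∧ ∃ G : Fin d → L2 Ω, HasWeakGradient Ω u G ∧
    ∀ (v : L2 Ω) (H : Fin d → L2 Ω), HasWeakGradient Ω v H → HasFinitePotential Ω V v →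
      (∑ i, ∫ x in (Ω : Set (Rd d)), G i x * conj (H i x))
          + Complex.I * (∫ x in (Ω : Set (Rd d)), (V x : ℂ) * u x * conj (v x))
        = ∫ x in (Ω : Set (Rd d)), f x * conj (v x)

section Helpers

variable {d : ℕ} {Ω : Opens (Rd d)} {V : C(Rd d, ℝ)}

lemma integral_mul_conj (f v : L2 Ω) :
    ∫ x in (Ω : Set (Rd d)), f x * conj (v x) = inner ℂ v f := by
  rw [L2.inner_def]
  rfl

lemma IsTestFunction.partialDeriv_continuous {φ : Rd d → ℝ} (hφ : IsTestFunction Ω φ)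
    (i : Fin d) : Continuous (partialDeriv i φ) :=
  (hφ.1.continuous_fderiv (by simp)).clm_apply continuous_const

lemma IsTestFunction.partialDeriv_compact {φ : Rd d → ℝ} (hφ : IsTestFunction Ω φ)
    (i : Fin d) : HasCompactSupport (partialDeriv i φ) :=
  hφ.2.1.fderiv_apply (𝕜 := ℝ) _

lemma integrable_smul_Lp {φ : Rd d → ℝ} (hc : Continuous φ) (hs : HasCompactSupport φ)
    (u : L2 Ω) :
    Integrable (fun x => φ x • u x) (volume.restrict (Ω : Set (Rd d))) := by
  have h1 : MemLp φ 2 ((volume : Measure (Rd d)).restrict (Ω : Set (Rd d))) :=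
    (hc.memLp_of_hasCompactSupport hs).restrict _
  have h2 := (Lp.memLp u).smul (r := 1) h1
  exact memLp_one_iff_integrable.1 h2

lemma HasWeakGradient.add {u v : L2 Ω} {G H : Fin d → L2 Ω} (hu : HasWeakGradient Ω u G)
    (hv : HasWeakGradient Ω v H) : HasWeakGradient Ω (u + v) (G + H) := by
  intro i φ hφ
  have e1 : ∫ x in (Ω : Set (Rd d)), partialDeriv i φ x • (u + v : L2 Ω) x
      = ∫ x in (Ω : Set (Rd d)), (partialDeriv i φ x • u x + partialDeriv i φ x • v x) := by
    refine integral_congr_ae ?_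
    filter_upwards [Lp.coeFn_add u v] with x hx
    rw [hx, Pi.add_apply, smul_add]
  have e2 : ∫ x in (Ω : Set (Rd d)), φ x • ((G + H) i : L2 Ω) x
      = ∫ x in (Ω : Set (Rd d)), (φ x • G i x + φ x • H i x) := by
    refine integral_congr_ae ?_
    filter_upwards [Lp.coeFn_add (G i) (H i)] with x hx
    rw [Pi.add_apply, hx, Pi.add_apply, smul_add]
  have c1 := hφ.partialDeriv_continuous i
  have c2 := hφ.partialDeriv_compact i
  rw [e1, e2, integral_add (integrable_smul_Lp c1 c2 u) (integrable_smul_Lp c1 c2 v),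
    integral_add (integrable_smul_Lp hφ.1.continuous hφ.2.1 _)
      (integrable_smul_Lp hφ.1.continuous hφ.2.1 _), hu i φ hφ, hv i φ hφ]
  ring

lemma HasWeakGradient.smul {u : L2 Ω} {G : Fin d → L2 Ω} (c : ℂ)
    (hu : HasWeakGradient Ω u G) : HasWeakGradient Ω (c • u) (c • G) := by
  intro i φ hφ
  have e1 : ∫ x in (Ω : Set (Rd d)), partialDeriv i φ x • (c • u : L2 Ω) x
      = ∫ x in (Ω : Set (Rd d)), c • (partialDeriv i φ x • u x) := by
    refine integral_congr_ae ?_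
    filter_upwards [Lp.coeFn_smul c u] with x hx
    rw [hx, Pi.smul_apply, smul_comm]
  have e2 : ∫ x in (Ω : Set (Rd d)), φ x • ((c • G) i : L2 Ω) x
      = ∫ x in (Ω : Set (Rd d)), c • (φ x • G i x) := by
    refine integral_congr_ae ?_
    filter_upwards [Lp.coeFn_smul c (G i)] with x hx
    rw [Pi.smul_apply, hx, Pi.smul_apply, smul_comm]
  rw [e1, e2, integral_smul, integral_smul, hu i φ hφ, smul_neg]

lemma HasFinitePotential.add {u v : L2 Ω} (hu : HasFinitePotential Ω V u)
    (hv : HasFinitePotential Ω V v) : HasFinitePotential Ω V (u + v) := by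
  refine (MemLp.add hu hv).ae_eq ?_
  filter_upwards [Lp.coeFn_add u v] with x hx
  rw [hx, Pi.add_apply, Pi.add_apply, smul_add]

lemma HasFinitePotential.smul {u : L2 Ω} (c : ℂ) (hu : HasFinitePotential Ω V u) :
    HasFinitePotential Ω V (c • u) := by
  refine (MemLp.const_smul hu c).ae_eq ?_
  filter_upwards [Lp.coeFn_smul c u] with x hx
  rw [hx, Pi.smul_apply, Pi.smul_apply, smul_comm]

lemma integrable_potential {u v : L2 Ω} (hu : HasFinitePotential Ω V u)
    (hv : HasFinitePotential Ω V v) :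
    Integrable (fun x => (V x : ℂ) * u x * conj (v x))
      (volume.restrict (Ω : Set (Rd d))) := by
  have h := hu.norm.integrable_mul hv.norm
  refine h.mono' ?_ (Eventually.of_forall fun x => ?_)
  · exact ((Complex.continuous_ofReal.comp V.continuous).aestronglyMeasurable.mul
      (Lp.aestronglyMeasurable u)).mul
      (Complex.continuous_conj.comp_aestronglyMeasurable (Lp.aestronglyMeasurable v))
  · have hs : √|V x| * √|V x| = |V x| := Real.mul_self_sqrt (abs_nonneg _)
    simp only [norm_mul, Complex.norm_real, Real.norm_eq_abs, RCLike.norm_conj, norm_smul,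
      abs_of_nonneg (Real.sqrt_nonneg _), Pi.mul_apply]
    apply le_of_eq
    linear_combination (-(‖u x‖ * ‖v x‖)) * hs

lemma hasWeakGradient_testFunction {φ : Rd d → ℝ} (hφ : IsTestFunction Ω φ) :
    ∃ (v : L2 Ω) (H : Fin d → L2 Ω), HasWeakGradient Ω v H ∧ HasFinitePotential Ω V v ∧
      v =ᵐ[volume.restrict (Ω : Set (Rd d))] fun x => (φ x : ℂ) := by
  have mem : ∀ ψ : Rd d → ℝ, Continuous ψ → HasCompactSupport ψ →
      MemLp (fun x => (ψ x : ℂ)) 2 ((volume : Measure (Rd d)).restrict (Ω : Set (Rd d))) := by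
    intro ψ h1 h2
    exact ((Complex.continuous_ofReal.comp h1).memLp_of_hasCompactSupport
      (h2.comp_left (g := fun t : ℝ => (t : ℂ)) (by simp))).restrict _
  have hd := fun i => mem (partialDeriv i φ) (hφ.partialDeriv_continuous i)
    (hφ.partialDeriv_compact i)
  refine ⟨(mem φ hφ.1.continuous hφ.2.1).toLp _, fun i => (hd i).toLp _, ?_, ?_,
    MemLp.coeFn_toLp _⟩
  · intro i ψ hψ
    have e1 : ∫ x in (Ω : Set (Rd d)), partialDeriv i ψ x •
        ((mem φ hφ.1.continuous hφ.2.1).toLp _ : L2 Ω) x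
        = ∫ x in (Ω : Set (Rd d)), ((partialDeriv i ψ x * φ x : ℝ) : ℂ) := by
      refine integral_congr_ae ?_
      filter_upwards [MemLp.coeFn_toLp (mem φ hφ.1.continuous hφ.2.1)] with x hx
      rw [hx]
      simp
    have e2 : ∫ x in (Ω : Set (Rd d)), ψ x • ((hd i).toLp _ : L2 Ω) x
        = ∫ x in (Ω : Set (Rd d)), ((ψ x * partialDeriv i φ x : ℝ) : ℂ) := by
      refine integral_congr_ae ?_
      filter_upwards [MemLp.coeFn_toLp (hd i)] with x hx
      rw [hx]
      simp
    have i1 : Integrable (fun x => partialDeriv i ψ x * φ x) (volume : Measure (Rd d)) :=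
      ((hψ.partialDeriv_continuous i).mul hφ.1.continuous).integrable_of_hasCompactSupport
        (hφ.2.1.mul_left)
    have i2 : Integrable (fun x => ψ x * partialDeriv i φ x) (volume : Measure (Rd d)) :=
      (hψ.1.continuous.mul (hφ.partialDeriv_continuous i)).integrable_of_hasCompactSupport
        (hψ.2.1.mul_right)
    have i3 : Integrable (fun x => ψ x * φ x) (volume : Measure (Rd d)) :=
      (hψ.1.continuous.mul hφ.1.continuous).integrable_of_hasCompactSupport
        (hψ.2.1.mul_right)
    have key := integral_mul_fderiv_eq_neg_fderiv_mul_of_integrable (𝕜 := ℝ)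
      (v := EuclideanSpace.single i (1 : ℝ)) i1 i2 i3
      (fun x _ => (hψ.1.differentiable (by simp)) x)
      (fun x _ => (hφ.1.differentiable (by simp)) x)
    rw [e1, e2, integral_complex_ofReal, integral_complex_ofReal,
      setIntegral_eq_integral_of_forall_compl_eq_zero,
      setIntegral_eq_integral_of_forall_compl_eq_zero]
    · have key' : ∫ x, ψ x * partialDeriv i φ x = - ∫ x, partialDeriv i ψ x * φ x := key
      rw [key']
      simp
    · intro x hx
      rw [image_eq_zero_of_notMem_tsupport (fun h => hx (hψ.2.2 h)), zero_mul]
    · intro x hx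
      rw [image_eq_zero_of_notMem_tsupport (fun h => hx (hφ.2.2 h)), mul_zero]
  · have h : MemLp (fun x => ((√|V x| * φ x : ℝ) : ℂ)) 2
        ((volume : Measure (Rd d)).restrict (Ω : Set (Rd d))) :=
      mem (fun x => √|V x| * φ x)
        ((V.continuous.abs.sqrt).mul hφ.1.continuous) hφ.2.1.mul_left
    refine h.ae_eq ?_
    filter_upwards [MemLp.coeFn_toLp (mem φ hφ.1.continuous hφ.2.1)] with x hx
    rw [hx]
    simp

/-- The image under the Neumann realization is unique. -/
lemma IsNeumannImage.unique {u f g : L2 Ω} (hf : IsNeumannImage Ω V u f)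
    (hg : IsNeumannImage Ω V u g) : f = g := by
  obtain ⟨-, G, hG, hf⟩ := hf
  obtain ⟨-, G', hG', hg⟩ := hg
  have gradEq : ∀ a b : L2 Ω, (∀ φ : Rd d → ℝ, IsTestFunction Ω φ →
      ∫ x in (Ω : Set (Rd d)), φ x • a x = ∫ x in (Ω : Set (Rd d)), φ x • b x) → a = b := by
    intro a b hab
    have hloc : LocallyIntegrableOn (fun x => a x - b x) (Ω : Set (Rd d)) volume := by
      have h := ((Lp.memLp a).sub (Lp.memLp b)).locallyIntegrable (by norm_num)
      exact locallyIntegrableOn_of_locallyIntegrable_restrict h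
    have h0 := Ω.isOpen.ae_eq_zero_of_integral_contDiff_smul_eq_zero hloc (by
      intro φ h1 h2 h3
      have hφ : IsTestFunction Ω φ := ⟨h1, h2, h3⟩
      rw [← setIntegral_eq_integral_of_forall_compl_eq_zero (s := (Ω : Set (Rd d)))]
      · simp only [smul_sub]
        rw [integral_sub (integrable_smul_Lp h1.continuous h2 a)
          (integrable_smul_Lp h1.continuous h2 b), hab φ hφ, sub_self]
      · intro x hx
        rw [image_eq_zero_of_notMem_tsupport (fun h => hx (h3 h)), zero_smul])
    apply Lp.ext
    filter_upwards [(ae_restrict_iff' Ω.isOpen.measurableSet).2 h0] with x hx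
    exact sub_eq_zero.1 hx
  have hGG : G = G' := by
    funext i
    refine gradEq _ _ fun φ hφ => ?_
    have h1 := hG i φ hφ
    rw [hG' i φ hφ] at h1
    exact (neg_injective h1).symm
  subst hGG
  refine gradEq f g fun φ hφ => ?_
  obtain ⟨v, H, hv1, hv2, hv⟩ := hasWeakGradient_testFunction (V := V) hφ
  have e : ∀ a : L2 Ω, ∫ x in (Ω : Set (Rd d)), φ x • a x
      = ∫ x in (Ω : Set (Rd d)), a x * conj (v x) := by
    intro a
    refine integral_congr_ae ?_
    filter_upwards [hv] with x hx
    rw [hx, Complex.conj_ofReal, Complex.real_smul, mul_comm]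
  rw [e, e, ← hf v H hv1 hv2, ← hg v H hv1 hv2]

lemma IsNeumannImage.add {u v f g : L2 Ω} (hu : IsNeumannImage Ω V u f)
    (hv : IsNeumannImage Ω V v g) : IsNeumannImage Ω V (u + v) (f + g) := by
  obtain ⟨hu0, G, hG, hu⟩ := hu
  obtain ⟨hv0, H, hH, hv⟩ := hv
  refine ⟨hu0.add hv0, G + H, hG.add hH, fun w K hK hw => ?_⟩
  have e : ∫ x in (Ω : Set (Rd d)), (V x : ℂ) * (u + v : L2 Ω) x * conj (w x)
      = (∫ x in (Ω : Set (Rd d)), (V x : ℂ) * u x * conj (w x))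
        + (∫ x in (Ω : Set (Rd d)), (V x : ℂ) * v x * conj (w x)) := by
    rw [← integral_add (integrable_potential hu0 hw) (integrable_potential hv0 hw)]
    refine integral_congr_ae ?_
    filter_upwards [Lp.coeFn_add u v] with x hx
    rw [hx, Pi.add_apply]
    ring
  have h1 := hu w K hK hw
  have h2 := hv w K hK hw
  rw [e]
  simp only [integral_mul_conj, Pi.add_apply, inner_add_right, Finset.sum_add_distrib] at *
  rw [← h1, ← h2]
  ring

lemma IsNeumannImage.smul {u f : L2 Ω} (c : ℂ) (hu : IsNeumannImage Ω V u f) :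
    IsNeumannImage Ω V (c • u) (c • f) := by
  obtain ⟨hu0, G, hG, hu⟩ := hu
  refine ⟨hu0.smul c, c • G, hG.smul c, fun w K hK hw => ?_⟩
  have e : ∫ x in (Ω : Set (Rd d)), (V x : ℂ) * (c • u : L2 Ω) x * conj (w x)
      = c * ∫ x in (Ω : Set (Rd d)), (V x : ℂ) * u x * conj (w x) := by
    rw [← integral_const_mul]
    refine integral_congr_ae ?_
    filter_upwards [Lp.coeFn_smul c u] with x hx
    rw [hx, Pi.smul_apply, smul_eq_mul]
    ring
  have h1 := hu w K hK hw
  rw [e]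
  simp only [integral_mul_conj, Pi.smul_apply, inner_smul_right, ← Finset.mul_sum] at *
  rw [← h1]
  ring

lemma IsNeumannImage.zero : IsNeumannImage Ω V 0 0 := by
  have hz : HasFinitePotential Ω V (0 : L2 Ω) := by
    refine (MemLp.zero (ε := ℂ)).ae_eq ?_
    filter_upwards [Lp.coeFn_zero ℂ 2 (volume.restrict (Ω : Set (Rd d)))] with x hx
    rw [hx]
    simp
  have hg : HasWeakGradient Ω (0 : L2 Ω) 0 := by
    intro i φ _
    have hx := Lp.coeFn_zero ℂ 2 ((volume : Measure (Rd d)).restrict (Ω : Set (Rd d)))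
    rw [integral_eq_zero_of_ae, integral_eq_zero_of_ae, neg_zero]
    · filter_upwards [hx] with x hx
      simp only [Pi.zero_apply, hx, smul_zero]
    · filter_upwards [hx] with x hx
      simp only [Pi.zero_apply, hx, smul_zero]
  refine ⟨hz, 0, hg, fun w K _ _ => ?_⟩
  have e : ∫ x in (Ω : Set (Rd d)), (V x : ℂ) * (0 : L2 Ω) x * conj (w x) = 0 := by
    refine integral_eq_zero_of_ae ?_
    filter_upwards [Lp.coeFn_zero ℂ 2 (volume.restrict (Ω : Set (Rd d)))] with x hx
    rw [hx]
    simp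
  rw [e]
  simp only [integral_mul_conj, Pi.zero_apply, inner_zero_right, Finset.sum_const_zero, mul_zero,
    add_zero]

end Helpers

/-- The Neumann realization `𝒜^N_{Ω,V}` of `-Δ + i V` in `L²(Ω)`, as an unbounded operator: the
operator associated with the form `∫_Ω ∇u · conj ∇v + i ∫_Ω V u conj v` on the form domain
`{u ∈ H¹(Ω) : |V|^{1/2} u ∈ L²(Ω)}`. For `Ω = ℝ^d` there is no boundary, and this is the
operator `-Δ + i V` in `L²(ℝ^d)`. -/
def neumannRealization {d : ℕ} (Ω : Opens (Rd d)) (V : C(Rd d, ℝ)) : L2 Ω →ₗ.[ℂ] L2 Ω where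
  domain :=
    { carrier := {u | ∃ f, IsNeumannImage Ω V u f}
      add_mem' := fun ⟨f, hf⟩ ⟨g, hg⟩ => ⟨f + g, hf.add hg⟩
      zero_mem' := ⟨0, IsNeumannImage.zero⟩
      smul_mem' := fun c _ ⟨f, hf⟩ => ⟨c • f, hf.smul c⟩ }
  toFun :=
    { toFun := fun u => u.2.choose
      map_add' := fun u v =>
        (u + v).2.choose_spec.unique (u.2.choose_spec.add v.2.choose_spec)
      map_smul' := fun c u => (c • u).2.choose_spec.unique (u.2.choose_spec.smul c) }

/-- `T + 1` for an unbounded operator `T`, with the same domain. -/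
def addOne {E : Type*} [AddCommGroup E] [Module ℂ E] (T : E →ₗ.[ℂ] E) : E →ₗ.[ℂ] E where
  domain := T.domain
  toFun := T.toFun + T.domain.subtype

/-- The bounded operator `S` is the inverse `T⁻¹` of the unbounded operator `T`, which thus maps
its domain bijectively onto the whole space. -/
def IsBoundedInverse {E : Type*} [NormedAddCommGroup E] [NormedSpace ℂ E]
    (T : E →ₗ.[ℂ] E) (S : E →L[ℂ] E) : Prop :=
  (∀ u : T.domain, S (T u) = u) ∧ ∀ f : E, ∃ u : T.domain, (u : E) = S f ∧ T u = f

lemma memLp_restrict {d : ℕ} (Ω : Opens (Rd d)) (f : L2 (⊤ : Opens (Rd d))) :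
    MemLp f 2 ((volume : Measure (Rd d)).restrict (Ω : Set (Rd d))) :=
  (Lp.memLp f).mono_measure (Measure.restrict_mono (Set.subset_univ _) le_rfl)

/-- The restriction `L²(ℝ^d) → L²(Ω)`. -/
def restrictL2 {d : ℕ} (Ω : Opens (Rd d)) : L2 (⊤ : Opens (Rd d)) →L[ℂ] L2 Ω :=
  LinearMap.mkContinuous
    { toFun := fun f => (memLp_restrict Ω f).toLp f
      map_add' := fun f g => by
        rw [← MemLp.toLp_add]
        exact MemLp.toLp_congr _ _ (ae_mono (Measure.restrict_mono (Set.subset_univ _) le_rfl)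
          (Lp.coeFn_add f g))
      map_smul' := fun c f => by
        rw [RingHom.id_apply, ← MemLp.toLp_const_smul]
        exact MemLp.toLp_congr _ _ (ae_mono (Measure.restrict_mono (Set.subset_univ _) le_rfl)
          (Lp.coeFn_smul c f)) }
    1 (fun f => by
      rw [one_mul, Lp.norm_def]
      refine ENNReal.toReal_mono (Lp.eLpNorm_ne_top f) ?_
      refine (eLpNorm_congr_ae (MemLp.coeFn_toLp (memLp_restrict Ω f))).trans_le ?_
      exact eLpNorm_mono_measure _ (Measure.restrict_mono (Set.subset_univ _) le_rfl))

lemma memLp_extendByZero {d : ℕ} {Ω : Opens (Rd d)} (f : L2 Ω) :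
    MemLp ((Ω : Set (Rd d)).indicator f) 2
      ((volume : Measure (Rd d)).restrict ((⊤ : Opens (Rd d)) : Set (Rd d))) := by
  rw [Opens.coe_top, Measure.restrict_univ,
    memLp_indicator_iff_restrict Ω.isOpen.measurableSet]
  exact Lp.memLp f

/-- The extension by zero `L²(Ω) → L²(ℝ^d)`. -/
def extendByZero {d : ℕ} (Ω : Opens (Rd d)) : L2 Ω →L[ℂ] L2 (⊤ : Opens (Rd d)) :=
  LinearMap.mkContinuous
    { toFun := fun f => (memLp_extendByZero f).toLp _
      map_add' := fun f g => by
        rw [← MemLp.toLp_add]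
        refine MemLp.toLp_congr _ _ ?_
        rw [Opens.coe_top, Measure.restrict_univ]
        have h := (ae_restrict_iff' Ω.isOpen.measurableSet).1 (Lp.coeFn_add f g)
        filter_upwards [h] with x hx
        by_cases hxΩ : x ∈ (Ω : Set (Rd d))
        · simp only [Set.indicator_of_mem hxΩ, Pi.add_apply, hx hxΩ]
        · simp only [Set.indicator_of_notMem hxΩ, Pi.add_apply, add_zero]
      map_smul' := fun c f => by
        rw [RingHom.id_apply, ← MemLp.toLp_const_smul]
        refine MemLp.toLp_congr _ _ ?_
        rw [Opens.coe_top, Measure.restrict_univ]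
        have h := (ae_restrict_iff' Ω.isOpen.measurableSet).1 (Lp.coeFn_smul c f)
        filter_upwards [h] with x hx
        by_cases hxΩ : x ∈ (Ω : Set (Rd d))
        · simp only [Set.indicator_of_mem hxΩ, Pi.smul_apply, hx hxΩ]
        · simp only [Set.indicator_of_notMem hxΩ, Pi.smul_apply, smul_zero] }
    1 (fun f => by
      rw [one_mul, Lp.norm_def]
      refine ENNReal.toReal_mono (Lp.eLpNorm_ne_top f) ?_
      refine (eLpNorm_congr_ae (MemLp.coeFn_toLp (memLp_extendByZero f))).trans_le ?_
      rw [Opens.coe_top, Measure.restrict_univ,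
        eLpNorm_indicator_eq_eLpNorm_restrict Ω.isOpen.measurableSet])

/-- The operator `0 ⊕ R` in `L²(ℝ^d) = L²(ℝ^d \ Ω) ⊕ L²(Ω)`. -/
def zeroDirectSum {d : ℕ} (Ω : Opens (Rd d)) (R : L2 Ω →L[ℂ] L2 Ω) :
    L2 (⊤ : Opens (Rd d)) →L[ℂ] L2 (⊤ : Opens (Rd d)) :=
  extendByZero Ω ∘L R ∘L restrictL2 Ω

/-- The essential spectrum of a bounded operator `T`: the points `μ` of the spectrum which fail
one of the conditions: `ker (T - μ)` has finite dimension, the range of `T - μ` is closed, the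
range of `T - μ` has finite codimension, `μ` is an isolated point of the spectrum. -/
def essentialSpectrum {E : Type*} [NormedAddCommGroup E] [NormedSpace ℂ E]
    (T : E →L[ℂ] E) : Set ℂ :=
  {μ | μ ∈ spectrum ℂ T ∧
    ¬ (FiniteDimensional ℂ (T - μ • ContinuousLinearMap.id ℂ E).ker ∧
        IsClosed ((T - μ • ContinuousLinearMap.id ℂ E).range : Set E) ∧
        FiniteDimensional ℂ (E ⧸ (T - μ • ContinuousLinearMap.id ℂ E).range) ∧
        ∀ᶠ z in 𝓝[≠] μ, z ∉ spectrum ℂ T)}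

/-- `K` has smooth boundary: near each of its boundary points, `K` is a sublevel set `{ρ ≤ 0}` of
a smooth function `ρ` with nonvanishing differential at that point. -/
def HasSmoothBoundary {d : ℕ} (K : Set (Rd d)) : Prop :=
  ∀ x ∈ frontier K, ∃ U : Set (Rd d), IsOpen U ∧ x ∈ U ∧
    ∃ ρ : Rd d → ℝ, ContDiffOn ℝ ∞ ρ U ∧ fderiv ℝ ρ x ≠ 0 ∧ K ∩ U = {y ∈ U | ρ y ≤ 0}

/-- The linear potential `V_0(x) = j x_1` on `ℝ^d`, `d ≥ 2`. -/
def linearPotential {d : ℕ} (hd : 2 ≤ d) (j : ℝ) : C(Rd d, ℝ) where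
  toFun x := j * x ⟨0, by omega⟩
  continuous_toFun := by fun_prop

/-- The complement of a compact set, as an open set. -/
def exteriorDomain {d : ℕ} (K : Compacts (Rd d)) : Opens (Rd d) :=
  ⟨(K : Set (Rd d))ᶜ, K.isCompact.isClosed.isOpen_compl⟩

end ExteriorSchrodinger

end

/-! Both essential spectra equal `{0}`. The argument has four ingredients.

Resolvents. The potential changes sign, so `∫|∇u|² + ∫|u|² + i∫V|u|²` does not control `∫|V||u|²` by
itself. Pairing with `γu + iΦu`, where `Φ = V / √(1 + V²)`, recovers this term, because `ΦV ≥ |V| -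
1` and `Φ` has bounded gradient. The operator representing the form therefore has a left inverse.
Its adjoint belongs to the potential `-V` and has one too, so the operator is invertible
(`exists_resolvent`). This works in every open set.

Compactness. For `u = A f` and `w = R (f|Ω)`, the difference `y = u|Ω - w` solves the homogeneous
equation away from `K`. Testing with `ζ² y`, where `ζ` vanishes near `K` and is `1` far out, gives
`‖ζ y‖² ≤ ∑ ‖(∂ᵢζ) y‖²`: the potential only enters the imaginary part. So `A f - B f` is controlled
by `u` and `w` on a compact set (`IsNeumannImage.norm_sub_extendByZero_le`). There a local Rellich
theorem up to the boundary makes weakly null data converge to zero in norm. Smoothness of the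
boundary is used to push `Ω` locally into itself by small shifts, which replaces an extension
operator.

Quasinilpotence of `A`. Translation along `x₁` shifts `A⁻¹` by an imaginary constant. For a suitable
multiple `X` of the difference of two opposite translations, `exp X * A⁻¹ * exp (-X) = A⁻¹ + D` with
`D = (b / 2) (U + U⁻¹)`. Short translations are close to the identity, with an error absorbed by the
gradient, so the real part of `A⁻¹ + D` is at least `1 + b`. Thus the spectrum of `A` lies in balls
of radius `1 / (1 + b)` for all `b > 0` (`IsResolvent.spectrum_subset`).

Essential spectra. For `z ≠ 0`, `B - z` is the invertible `A - z` times a compact perturbation of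
`1`, hence Fredholm. Comparing powers of `A` and `B` on orthonormalized eigenvectors shows that the
spectrum of `B` is discrete away from `0`. The point `0` is essential for `A`, whose range is dense
but not closed, and for `B`, whose kernel contains the functions living on `K`. -/

namespace ExteriorSchrodinger

/-! ### Weak convergence and compact operators in Hilbert spaces -/

section WeakConvergence

variable {H F : Type*} [NormedAddCommGroup H] [InnerProductSpace ℂ H]
  [NormedAddCommGroup F] [InnerProductSpace ℂ F]

/-- The sequence `x` converges weakly to zero. -/
def IsWeaklyNull (x : ℕ → H) : Prop :=
  ∀ y, Tendsto (fun n => inner ℂ y (x n)) atTop (𝓝 0)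

lemma IsWeaklyNull.map [CompleteSpace H] [CompleteSpace F] {x : ℕ → H} (hx : IsWeaklyNull x)
    (T : H →L[ℂ] F) : IsWeaklyNull fun n => T (x n) := by
  intro y
  simpa [ContinuousLinearMap.adjoint_inner_left] using hx (ContinuousLinearMap.adjoint T y)

/-- Bounded sequences in a separable Hilbert space have weakly convergent subsequences. -/
lemma exists_weakly_convergent_subseq [CompleteSpace H] [SeparableSpace H] {x : ℕ → H} {C : ℝ}
    (hx : ∀ n, ‖x n‖ ≤ C) :
    ∃ (a : H) (φ : ℕ → ℕ), ‖a‖ ≤ C ∧ StrictMono φ ∧ IsWeaklyNull fun n => x (φ n) - a := by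
  -- The Riesz isometry moves the sequence into a ball of the weak dual, which is sequentially
  -- compact because `H` is separable. The isometry is conjugate-linear, whence the conjugation in
  -- `h3`.
  let e := InnerProductSpace.toDual ℂ H
  have hmem : ∀ n, StrongDual.toWeakDual (e (x n)) ∈
      WeakDual.toStrongDual ⁻¹' Metric.closedBall (0 : StrongDual ℂ H) C := by
    intro n
    simpa [e] using hx n
  obtain ⟨b, hb, φ, hφ, hlim⟩ := WeakDual.isSeqCompact_closedBall ℂ H 0 C hmem
  refine ⟨e.symm (WeakDual.toStrongDual b), φ, by simpa using hb, hφ, fun y => ?_⟩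
  have h1 : Tendsto (fun n => inner ℂ (x (φ n)) y) atTop (𝓝 (b y)) := by
    have := (WeakDual.eval_continuous (𝕜 := ℂ) y).tendsto b |>.comp hlim
    exact this
  have h2 : inner ℂ (e.symm (WeakDual.toStrongDual b)) y = b y := by
    rw [InnerProductSpace.toDual_symm_apply]
    rfl
  have h3 := (Complex.continuous_conj.tendsto _).comp (h1.sub_const (b y))
  simp only [sub_self, map_zero] at h3
  refine h3.congr fun n => ?_
  simp [← h2, inner_conj_symm]

/-- Compact operators map weakly null bounded sequences to null sequences. -/
lemma IsCompactOperator.tendsto_zero [CompleteSpace H] [CompleteSpace F] {T : H →L[ℂ] F}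
    (hT : IsCompactOperator T) {x : ℕ → H} {C : ℝ} (hC : ∀ n, ‖x n‖ ≤ C) (hx : IsWeaklyNull x) :
    Tendsto (fun n => T (x n)) atTop (𝓝 0) := by
  refine tendsto_of_subseq_tendsto fun ns hns => ?_
  obtain ⟨K, hK, hK'⟩ := IsCompactOperator.image_closedBall_subset_compact
    (f := T.toLinearMap) hT C
  obtain ⟨y, -, ψ, hψ, hψy⟩ := hK.tendsto_subseq (x := fun n => T (x (ns n)))
    (fun n => hK' ⟨x (ns n), by simpa using hC _, rfl⟩)
  refine ⟨ψ, ?_⟩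
  have h1 : Tendsto (fun n => inner ℂ y (T (x (ns (ψ n))))) atTop (𝓝 (inner ℂ y y)) :=
    (tendsto_const_nhds.inner hψy)
  -- The norm limit `y` is also the weak limit, which is zero, so `⟪y, y⟫ = 0`.
  have h2 := tendsto_nhds_unique h1 ((hx.map T y).comp (hns.comp hψ.tendsto_atTop))
  rw [inner_self_eq_zero] at h2
  rwa [h2] at hψy

/-- An operator that maps weakly null bounded sequences to null sequences is compact. -/
lemma isCompactOperator_of_tendsto_zero [CompleteSpace H] [SeparableSpace H] {T : H →L[ℂ] F}
    (hT : ∀ (x : ℕ → H) (C : ℝ), (∀ n, ‖x n‖ ≤ C) → IsWeaklyNull x →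
      Tendsto (fun n => T (x n)) atTop (𝓝 0)) : IsCompactOperator T := by
  rw [isCompactOperator_iff_exists_mem_nhds_image_subset_compact]
  refine ⟨Metric.closedBall 0 1, Metric.closedBall_mem_nhds _ one_pos,
    T '' Metric.closedBall 0 1, ?_, subset_rfl⟩
  rw [isCompact_iff_isSeqCompact]
  intro y hy
  choose x hx hxy using hy
  obtain ⟨a, φ, ha, hφ, hw⟩ := exists_weakly_convergent_subseq (C := 1)
    (fun n => by simpa using hx n)
  refine ⟨T a, ⟨a, by simpa using ha, rfl⟩, φ, hφ, ?_⟩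
  have h := hT _ 2 (fun n => ?_) hw
  · refine (tendsto_sub_nhds_zero_iff.1 ?_)
    refine h.congr fun n => ?_
    simp [← hxy]
  · have h1 : ‖x (φ n)‖ ≤ 1 := by simpa using hx (φ n)
    exact (norm_sub_le _ _).trans (by linarith)

/-- The adjoint of a compact operator is compact. -/
lemma IsCompactOperator.adjoint [CompleteSpace H] [CompleteSpace F] [SeparableSpace F]
    {T : H →L[ℂ] F} (hT : IsCompactOperator T) :
    IsCompactOperator (ContinuousLinearMap.adjoint T) := by
  refine isCompactOperator_of_tendsto_zero fun x C hC hx => ?_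
  have h0 : 0 ≤ C := (norm_nonneg _).trans (hC 0)
  have h1 := IsCompactOperator.tendsto_zero hT (x := fun n => ContinuousLinearMap.adjoint T (x n))
    (C := ‖ContinuousLinearMap.adjoint T‖ * C)
    (fun n => (ContinuousLinearMap.le_opNorm _ _).trans (by gcongr; exact hC n)) (hx.map _)
  have h2 : Tendsto (fun n => ‖ContinuousLinearMap.adjoint T (x n)‖ ^ 2) atTop (𝓝 0) := by
    refine squeeze_zero (fun n => by positivity) (fun n => ?_)
      (by simpa using (h1.norm.const_mul C))
    -- `‖T* x‖² = ⟪x, T T* x⟫`, and `T T* x` tends to zero in norm because `T* x` is bounded and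
    -- weakly null.
    have h3 : ‖ContinuousLinearMap.adjoint T (x n)‖ ^ 2
        = ‖inner ℂ (x n) (T (ContinuousLinearMap.adjoint T (x n)))‖ := by
      rw [← ContinuousLinearMap.adjoint_inner_left, inner_self_eq_norm_sq_to_K]
      simp
    rw [h3]
    exact (norm_inner_le_norm _ _).trans (by gcongr; exact hC n)
  have h4 := h2.sqrt
  simp only [Real.sqrt_zero, Real.sqrt_sq (norm_nonneg _)] at h4
  exact tendsto_zero_iff_norm_tendsto_zero.2 h4

/-- An orthonormal sequence converges weakly to zero. -/
lemma isWeaklyNull_of_orthonormal {x : ℕ → H} (hx : Orthonormal ℂ x) : IsWeaklyNull x := by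
  intro y
  -- Bessel's inequality: the squared coefficients of `y` are summable.
  have h := (hx.inner_products_summable y).tendsto_atTop_zero.sqrt
  simp only [Real.sqrt_zero, Real.sqrt_sq (norm_nonneg _)] at h
  rw [tendsto_zero_iff_norm_tendsto_zero]
  refine h.congr fun n => ?_
  rw [norm_inner_symm]

end WeakConvergence

/-! ### Riesz theory for compact perturbations of the identity -/

section Fredholm

variable {H : Type*} [NormedAddCommGroup H] [InnerProductSpace ℂ H]

/-- The kernel of a compact perturbation of the identity is finite-dimensional. -/
lemma finiteDimensional_ker_one_sub {C : H →L[ℂ] H} (hC : IsCompactOperator C) :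
    FiniteDimensional ℂ (1 - C).ker := by
  have hm : ∀ x ∈ (1 - C).ker, C x = x := by
    intro x hx
    have : x - C x = 0 := by simpa using hx
    exact (sub_eq_zero.1 this).symm
  have h : IsCompactOperator (id : (1 - C).ker → (1 - C).ker) := by
    have h1 := IsCompactOperator.restrict (f := C.toLinearMap) hC (V := (1 - C).ker)
      (fun x hx => by
        change C x ∈ _
        rw [hm x hx]
        exact hx) (ContinuousLinearMap.isClosed_ker _)
    convert h1 using 1
    ext x
    exact (hm _ x.2).symm
  exact FiniteDimensional.of_isCompactOperator_id h

variable [CompleteSpace H]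

/-- The range of a compact perturbation of the identity is closed. -/
lemma isClosed_range_one_sub {C : H →L[ℂ] H} (hC : IsCompactOperator C) :
    IsClosed ((1 - C).range : Set H) := by
  set N := (1 - C).ker with hN
  have : CompleteSpace N := (ContinuousLinearMap.isClosed_ker (1 - C)).completeSpace_coe
  -- Otherwise there are unit vectors in `Nᗮ` with `x - C x → 0`. Compactness of `C` makes a
  -- subsequence converge, and its limit is a unit vector in `N ∩ Nᗮ`.
  have key : ∃ c > 0, ∀ x ∈ Nᗮ, c * ‖x‖ ≤ ‖x - C x‖ := by
    by_contra! hcon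
    have h1 : ∀ n : ℕ, ∃ x ∈ Nᗮ, ‖x‖ = 1 ∧ ‖x - C x‖ < 1 / ((n : ℝ) + 1) := by
      intro n
      obtain ⟨x, hx, hlt⟩ := hcon (1 / ((n : ℝ) + 1)) (by positivity)
      have hx0 : x ≠ 0 := by
        rintro rfl
        simp at hlt
      have hxn : 0 < ‖x‖ := norm_pos_iff.2 hx0
      refine ⟨((‖x‖⁻¹ : ℝ) : ℂ) • x, Nᗮ.smul_mem _ hx, ?_, ?_⟩
      · rw [norm_smul]
        simp [hxn.ne']
      · rw [map_smul, ← smul_sub, norm_smul, Complex.norm_real, norm_inv, norm_norm,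
          inv_mul_lt_iff₀ hxn, mul_comm]
        exact hlt
    choose x hxN hx1 hx2 using h1
    obtain ⟨K, hK, hK'⟩ := IsCompactOperator.image_closedBall_subset_compact
      (f := C.toLinearMap) hC 1
    obtain ⟨y, -, ψ, hψ, hψy⟩ := hK.tendsto_subseq (x := fun n => C (x n))
      (fun n => hK' ⟨x n, by simpa using (hx1 n).le, rfl⟩)
    have h0 : Tendsto (fun n => x n - C (x n)) atTop (𝓝 0) :=
      squeeze_zero_norm (fun n => (hx2 n).le) tendsto_one_div_add_atTop_nhds_zero_nat
    have h2 : Tendsto (fun n => x (ψ n)) atTop (𝓝 y) := by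
      simpa using (h0.comp hψ.tendsto_atTop).add hψy
    have hy1 : ‖y‖ = 1 := tendsto_nhds_unique h2.norm (by simp [hx1])
    have hyN : y ∈ Nᗮ := N.isClosed_orthogonal.mem_of_tendsto h2
      (Eventually.of_forall fun n => hxN _)
    have hCy : C y = y := tendsto_nhds_unique ((C.continuous.tendsto y).comp h2) hψy
    have hyK : y ∈ N := by simp [hN, hCy]
    have := Submodule.inner_right_of_mem_orthogonal hyK hyN
    rw [inner_self_eq_zero] at this
    simp [this] at hy1
  obtain ⟨c, hc, key⟩ := key
  let T : Nᗮ →L[ℂ] H := (1 - C) ∘L Nᗮ.subtypeL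
  have hT : AntilipschitzWith (Real.toNNReal c)⁻¹ T := by
    refine ContinuousLinearMap.antilipschitz_of_bound _ fun x => ?_
    have := key x x.2
    rw [NNReal.coe_inv, Real.coe_toNNReal _ hc.le, ← div_eq_inv_mul, le_div_iff₀ hc, mul_comm]
    exact this
  have hr : ((1 - C).range : Set H) = Set.range T := by
    ext y
    constructor
    · rintro ⟨x, rfl⟩
      obtain ⟨a, ha, b, hb, rfl⟩ := N.exists_add_mem_mem_orthogonal x
      refine ⟨⟨b, hb⟩, ?_⟩
      have ha' : (1 - C) a = 0 := ha
      change (1 - C) b = (1 - C) (a + b)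
      rw [map_add, ha', zero_add]
    · rintro ⟨x, rfl⟩
      exact ⟨x, rfl⟩
  rw [hr]
  exact hT.isClosed_range T.uniformContinuous

/-- The range of a compact perturbation of the identity has finite codimension. -/
lemma finiteDimensional_quotient_range_one_sub [SeparableSpace H] {C : H →L[ℂ] H}
    (hC : IsCompactOperator C) : FiniteDimensional ℂ (H ⧸ (1 - C).range) := by
  set R := (1 - C).range
  have : CompleteSpace R := (isClosed_range_one_sub hC).completeSpace_coe
  have h1 : FiniteDimensional ℂ (1 - ContinuousLinearMap.adjoint C).ker :=
    finiteDimensional_ker_one_sub (IsCompactOperator.adjoint hC)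
  -- Since `R` is closed, `Rᗮ` is a complement of it, and this identity makes it the kernel of
  -- another compact perturbation of `1`.
  have h2 : Rᗮ = (1 - ContinuousLinearMap.adjoint C).ker := by
    have := ContinuousLinearMap.orthogonal_range (1 - C)
    rwa [map_sub, ContinuousLinearMap.one_def, ContinuousLinearMap.adjoint_id,
      ← ContinuousLinearMap.one_def] at this
  rw [← h2] at h1
  exact (R.quotientEquivOfIsCompl Rᗮ R.isCompl_orthogonal).symm.finiteDimensional

end Fredholm

end ExteriorSchrodinger

namespace ExteriorSchrodinger

/-! ### Compact perturbations of quasinilpotent operators -/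

section EssentialSpectrum

variable {H : Type*} [NormedAddCommGroup H] [InnerProductSpace ℂ H]

lemma isUnit_sub_smul_id {A : H →L[ℂ] H} (hA : spectrum ℂ A ⊆ {0}) {z : ℂ} (hz : z ≠ 0) :
    IsUnit (A - z • ContinuousLinearMap.id ℂ H) := by
  have h : z ∉ spectrum ℂ A := fun h => hz (hA h)
  rw [spectrum.notMem_iff, ← IsUnit.neg_iff, neg_sub] at h
  exact h

lemma isCompactOperator_pow_sub_pow {A B : H →L[ℂ] H} (hAB : IsCompactOperator (A - B)) (k : ℕ) :
    IsCompactOperator (A ^ k - B ^ k) := by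
  induction k with
  | zero =>
    simp only [pow_zero, sub_self]
    exact isCompactOperator_zero
  | succ k ih =>
    have h : A ^ (k + 1) - B ^ (k + 1) = (A ^ k - B ^ k) * A + B ^ k * (A - B) := by
      rw [pow_succ, pow_succ]
      noncomm_ring
    rw [h]
    exact (IsCompactOperator.comp_clm (f := (A ^ k - B ^ k)) ih A).add
      (IsCompactOperator.clm_comp (f := (A - B).toLinearMap) hAB (B ^ k))

/-- Factorization of a compact perturbation of a quasinilpotent operator. -/
lemma exists_sub_smul_eq_mul_one_sub {A B : H →L[ℂ] H} (hA : spectrum ℂ A ⊆ {0})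
    (hAB : IsCompactOperator (A - B)) {z : ℂ} (hz : z ≠ 0) :
    ∃ (L : (H →L[ℂ] H)ˣ) (C : H →L[ℂ] H), IsCompactOperator C ∧
      B - z • ContinuousLinearMap.id ℂ H = L * (1 - C) := by
  obtain ⟨L, hL⟩ := isUnit_sub_smul_id hA hz
  refine ⟨L, (↑L⁻¹ : H →L[ℂ] H) * (A - B), ?_, ?_⟩
  · exact IsCompactOperator.clm_comp (f := (A - B).toLinearMap) hAB (↑L⁻¹ : H →L[ℂ] H)
  · rw [mul_sub, mul_one, Units.mul_inv_cancel_left, hL]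
    abel

variable [CompleteSpace H]

/-- Powers of a quasinilpotent operator decay faster than any geometric sequence. -/
lemma exists_norm_pow_lt {A : H →L[ℂ] H} (hA : spectrum ℂ A ⊆ {0}) {r : ℝ} (hr : 0 < r) :
    ∃ k, ‖A ^ k‖ < r ^ k := by
  have h0 : spectralRadius ℂ A = 0 := by
    rw [spectralRadius, ← bot_eq_zero, iSup₂_eq_bot]
    intro z hz
    rw [Set.mem_singleton_iff.1 (hA hz)]
    simp
  -- Gelfand's formula, with spectral radius zero.
  have h1 := spectrum.pow_nnnorm_pow_one_div_tendsto_nhds_spectralRadius A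
  rw [h0] at h1
  have h2 := h1.eventually (gt_mem_nhds (ENNReal.ofReal_pos.2 hr))
  obtain ⟨k, hk, hk0⟩ := (h2.and (eventually_gt_atTop 0)).exists
  refine ⟨k, ?_⟩
  have h3 := ENNReal.rpow_lt_rpow hk (z := k) (by positivity)
  rw [← ENNReal.rpow_mul, one_div, inv_mul_cancel₀ (by positivity), ENNReal.rpow_one,
    ENNReal.rpow_natCast, ← ENNReal.ofReal_pow hr.le, ← enorm_eq_nnnorm, ← ofReal_norm]
    at h3
  exact (ENNReal.ofReal_lt_ofReal_iff (by positivity)).1 h3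

/-- Fredholm alternative for the factor `1 - C`: a fixed vector of `C` is an eigenvector of `B`, and
if there is none, `1 - C` and hence `B - z` are invertible. -/
lemma exists_hasEigenvector {A B : H →L[ℂ] H} (hA : spectrum ℂ A ⊆ {0})
    (hAB : IsCompactOperator (A - B)) {z : ℂ} (hz : z ≠ 0) (hzB : z ∈ spectrum ℂ B) :
    ∃ v, Module.End.HasEigenvector (B : Module.End ℂ H) z v := by
  obtain ⟨L, C, hC, hL⟩ := exists_sub_smul_eq_mul_one_sub hA hAB hz
  rcases IsCompactOperator.hasEigenvalue_or_mem_resolventSet hC (one_ne_zero (α := ℂ)) with h | h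
  · obtain ⟨v, hv⟩ := h.exists_hasEigenvector
    refine ⟨v, Module.End.mem_eigenspace_iff.2 ?_, hv.2⟩
    have h1 : C v = v := by simpa using hv.apply_eq_smul
    have h2 : (B - z • ContinuousLinearMap.id ℂ H) v = 0 := by
      rw [hL]
      simp [h1]
    simpa [sub_eq_zero] using h2
  · exfalso
    apply hzB
    rw [spectrum.mem_resolventSet_iff, map_one] at h
    have h2 : IsUnit (B - z • ContinuousLinearMap.id ℂ H) := hL ▸ L.isUnit.mul h
    rw [spectrum.mem_resolventSet_iff, ← IsUnit.neg_iff, neg_sub]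
    exact h2

/-- The spectrum of a compact perturbation of a quasinilpotent operator is discrete away from
zero. -/
lemma eventually_notMem_spectrum {A B : H →L[ℂ] H} (hA : spectrum ℂ A ⊆ {0})
    (hAB : IsCompactOperator (A - B)) {μ : ℂ} (hμ : μ ≠ 0) :
    ∀ᶠ z in 𝓝[≠] μ, z ∉ spectrum ℂ B := by
  -- It suffices that only finitely many spectral points satisfy `r ≤ ‖z‖`, since this region is a
  -- neighbourhood of `μ`.
  set r := ‖μ‖ / 2 with hrdef
  have hr : 0 < r := by positivity
  by_cases hfin : (spectrum ℂ B ∩ {z | r ≤ ‖z‖}).Finite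
  · have h1 : ((spectrum ℂ B ∩ {z | r ≤ ‖z‖}) \ {μ})ᶜ ∈ 𝓝 μ :=
      (hfin.subset Set.sdiff_subset).isClosed.isOpen_compl.mem_nhds (by simp)
    have h2 : ∀ᶠ z in 𝓝 μ, r < ‖z‖ :=
      continuous_norm.continuousAt.eventually (lt_mem_nhds (by
        rw [hrdef]; linarith [norm_pos_iff.2 hμ]))
    filter_upwards [mem_nhdsWithin_of_mem_nhds h1, h2.filter_mono nhdsWithin_le_nhds,
      self_mem_nhdsWithin] with z hz1 hz2 hz3 hz
    exact hz1 ⟨⟨hz, hz2.le⟩, hz3⟩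
  exfalso
  let z : ℕ → ℂ := fun n => Set.Infinite.natEmbedding _ hfin n
  have hzinj : Function.Injective z := fun m n h =>
    (Set.Infinite.natEmbedding _ hfin).injective (Subtype.ext h)
  have hz : ∀ n, z n ∈ spectrum ℂ B ∧ r ≤ ‖z n‖ := fun n =>
    (Set.Infinite.natEmbedding _ hfin n).2
  have hz0 : ∀ n, z n ≠ 0 := fun n h => by
    have := (hz n).2
    rw [h, norm_zero] at this
    linarith
  choose v hv using fun n => exists_hasEigenvector hA hAB (hz0 n) (hz n).1
  have hli : LinearIndependent ℂ v :=
    Module.End.eigenvectors_linearIndependent' (B : Module.End ℂ H) z hzinj v hv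
  let y := InnerProductSpace.gramSchmidtNormed ℂ v
  have hy : Orthonormal ℂ y := InnerProductSpace.gramSchmidtNormed_orthonormal hli
  -- Passing to powers makes `A ^ k` smaller than `r ^ k`, while the moduli of the corresponding
  -- eigenvalues of `B ^ k` stay at least `r ^ k`.
  obtain ⟨k, hk⟩ := exists_norm_pow_lt hA hr
  have hBv : ∀ i, (B ^ k) (v i) = z i ^ k • v i := by
    intro i
    have h := (hv i).pow_apply k
    rwa [← ContinuousLinearMap.toLinearMap_pow] at h
  -- In the Gram–Schmidt basis of the eigenvectors, `B ^ k` is upper triangular with the eigenvalues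
  -- on the diagonal: `B ^ k - z n ^ k` maps the span of the first eigenvectors up to `n` into the
  -- span of those before `n`, which is orthogonal to `y n`.
  have hdiag : ∀ n, inner ℂ (y n) ((B ^ k) (y n)) = z n ^ k := by
    intro n
    have h1 : ∀ w ∈ Submodule.span ℂ (v '' Set.Iic n),
        (B ^ k) w - z n ^ k • w ∈ Submodule.span ℂ (v '' Set.Iio n) := by
      intro w hw
      induction hw using Submodule.span_induction with
      | mem x hx =>
        obtain ⟨i, hi, rfl⟩ := hx
        rw [hBv, ← sub_smul]
        rcases (Set.mem_Iic.1 hi).lt_or_eq with h | h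
        · exact Submodule.smul_mem _ _ (Submodule.subset_span ⟨i, h, rfl⟩)
        · simp [h]
      | zero => simp
      | add a b _ _ ha hb =>
        convert add_mem ha hb using 1
        rw [map_add, smul_add]
        abel
      | smul c a _ ha =>
        convert Submodule.smul_mem _ c ha using 1
        rw [map_smul, smul_sub, smul_comm]
    have h2 : y n ∈ Submodule.span ℂ (v '' Set.Iic n) := by
      rw [← InnerProductSpace.span_gramSchmidt_Iic ℂ v, ← InnerProductSpace.span_gramSchmidtNormed]
      exact Submodule.subset_span ⟨n, Set.mem_Iic.2 le_rfl, rfl⟩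
    have h3 : ∀ w ∈ Submodule.span ℂ (v '' Set.Iio n), inner ℂ (y n) w = 0 := by
      rw [← InnerProductSpace.span_gramSchmidt_Iio ℂ v, ← InnerProductSpace.span_gramSchmidtNormed]
      intro w hw
      induction hw using Submodule.span_induction with
      | mem x hx =>
        obtain ⟨i, hi, rfl⟩ := hx
        exact hy.2 (ne_of_gt hi)
      | zero => simp
      | add a b _ _ ha hb => rw [inner_add_right, ha, hb, add_zero]
      | smul c a _ ha => rw [inner_smul_right, ha, mul_zero]
    have h4 := h3 _ (h1 _ h2)
    rw [inner_sub_right, inner_smul_right, inner_self_eq_norm_sq_to_K, hy.1 n, sub_eq_zero] at h4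
    simpa using h4
  -- Along the weakly null sequence `y`, `A ^ k` and `B ^ k` become indistinguishable, so `r ^ k ≤
  -- ‖A ^ k‖` in the limit.
  have hlim := IsCompactOperator.tendsto_zero (isCompactOperator_pow_sub_pow hAB k)
    (x := y) (C := 1) (fun n => (hy.1 n).le) (isWeaklyNull_of_orthonormal hy)
  have hle : ∀ n, r ^ k ≤ ‖A ^ k‖ + ‖(A ^ k - B ^ k) (y n)‖ := by
    intro n
    calc r ^ k ≤ ‖z n ^ k‖ := by
          rw [norm_pow]
          exact pow_le_pow_left₀ hr.le (hz n).2 k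
      _ = ‖inner ℂ (y n) ((B ^ k) (y n))‖ := by rw [hdiag]
      _ ≤ ‖(B ^ k) (y n)‖ := by simpa [hy.1 n] using norm_inner_le_norm (𝕜 := ℂ) (y n) ((B ^ k) (y n))
      _ = ‖(A ^ k) (y n) - (A ^ k - B ^ k) (y n)‖ := by simp
      _ ≤ _ := (norm_sub_le _ _).trans (by
          gcongr
          simpa [hy.1 n] using (A ^ k).le_opNorm (y n))
  have h5 : r ^ k ≤ ‖A ^ k‖ + 0 :=
    ge_of_tendsto (by simpa using (hlim.norm.const_add ‖A ^ k‖)) (Eventually.of_forall hle)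
  linarith

/-- The essential spectrum of a compact perturbation of a quasinilpotent operator is contained
in `{0}`. -/
lemma essentialSpectrum_subset_singleton [SeparableSpace H] {A B : H →L[ℂ] H}
    (hA : spectrum ℂ A ⊆ {0}) (hAB : IsCompactOperator (A - B)) : essentialSpectrum B ⊆ {0} := by
  rintro μ ⟨-, hμ⟩
  by_contra h0
  refine hμ ?_
  obtain ⟨L, C, hC, hL⟩ := exists_sub_smul_eq_mul_one_sub hA hAB h0
  -- The invertible factor acts as a linear homeomorphism, so kernel, closedness of the range and
  -- codimension are those of `1 - C`.
  let e := ContinuousLinearEquiv.unitsEquiv ℂ H L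
  have he : ∀ x, (B - μ • ContinuousLinearMap.id ℂ H) x = e ((1 - C) x) := fun x => by
    rw [hL]
    rfl
  have hker : (B - μ • ContinuousLinearMap.id ℂ H).ker = (1 - C).ker := by
    ext x
    simp only [LinearMap.mem_ker, ContinuousLinearMap.coe_coe, he]
    exact e.map_eq_zero_iff
  have hrange : (B - μ • ContinuousLinearMap.id ℂ H).range
      = (1 - C).range.map e.toLinearEquiv.toLinearMap := by
    ext y
    constructor
    · rintro ⟨x, rfl⟩
      exact ⟨(1 - C) x, ⟨x, rfl⟩, (he x).symm⟩
    · rintro ⟨-, ⟨x, rfl⟩, rfl⟩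
      exact ⟨x, he x⟩
  refine ⟨?_, ?_, ?_, eventually_notMem_spectrum hA hAB h0⟩
  · rw [hker]
    exact finiteDimensional_ker_one_sub hC
  · rw [hrange, Submodule.map_coe]
    exact e.toHomeomorph.isClosedMap _ (isClosed_range_one_sub hC)
  · have := finiteDimensional_quotient_range_one_sub hC
    rw [hrange]
    exact (Submodule.Quotient.equiv (1 - C).range _ e.toLinearEquiv rfl).finiteDimensional

/-- The spectrum is nonempty, so it contains `0`. If the range were closed, density would make `A`
bijective, hence invertible. So it is the closed-range condition that fails. -/
lemma zero_mem_essentialSpectrum [Nontrivial H] {A : H →L[ℂ] H} (hA : spectrum ℂ A ⊆ {0})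
    (hinj : Function.Injective A) (hdense : DenseRange A) : 0 ∈ essentialSpectrum A := by
  have h0 : (0 : ℂ) ∈ spectrum ℂ A := by
    obtain ⟨z, hz⟩ := spectrum.nonempty A
    rwa [Set.mem_singleton_iff.1 (hA hz)] at hz
  refine ⟨h0, fun h => ?_⟩
  have hcl : IsClosed (Set.range A) := by
    have h1 := h.2.1
    rwa [zero_smul, sub_zero] at h1
  have hsurj : Function.Surjective A := by
    rw [← Set.range_eq_univ, ← hcl.closure_eq, hdense.closure_range]
  rw [spectrum.zero_mem_iff] at h0
  exact h0 (ContinuousLinearMap.isUnit_iff_bijective.2 ⟨hinj, hsurj⟩)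

lemma zero_mem_essentialSpectrum_of_ker {B : H →L[ℂ] H} (hB : ¬ FiniteDimensional ℂ B.ker) :
    0 ∈ essentialSpectrum B := by
  refine ⟨?_, fun h => hB ?_⟩
  swap
  · have h1 := h.1
    rwa [zero_smul, sub_zero] at h1
  rw [spectrum.zero_mem_iff]
  intro h
  refine hB ?_
  have : B.ker = ⊥ := LinearMap.ker_eq_bot.2 (ContinuousLinearMap.isUnit_iff_bijective.1 h).1
  rw [this]
  infer_instance

end EssentialSpectrum

end ExteriorSchrodinger

namespace ExteriorSchrodinger

/-! ### Conjugation by exponentials and shifts of the inverse -/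

section Commutator

/-- If `X A - A X = - A D A` and `X` commutes with `D`, then `B = exp X * A * exp (-X)` satisfies
`B (1 + D A) = A = (1 + A D) B`. -/
lemma exp_mul_mul_exp_neg_eq {R : Type*} [NormedRing R] [NormedAlgebra ℝ R] [CompleteSpace R]
    {A D X : R} (hXA : X * A - A * X = -(A * D * A)) (hXD : Commute X D) :
    NormedSpace.exp X * A * NormedSpace.exp (-X) * (1 + D * A) = A ∧
      (1 + A * D) * (NormedSpace.exp X * A * NormedSpace.exp (-X)) = A := by
  let +nondep : NormedAlgebra ℚ R := NormedAlgebra.restrictScalars ℚ ℝ R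
  -- Formally `[X, A⁻¹] = D`, so `B t = (A⁻¹ + t D)⁻¹`. The rigorous version is the Riccati equation
  -- `B' = -B D B`, which needs no inverse of `A`.
  let B : ℝ → R := fun t => NormedSpace.exp (t • X) * A * NormedSpace.exp (t • (-X))
  have hinv : ∀ t : ℝ, NormedSpace.exp (t • (-X)) * NormedSpace.exp (t • X) = 1 := fun t => by
    rw [smul_neg, ← NormedSpace.exp_add_of_commute (Commute.refl _).neg_left, neg_add_cancel,
      NormedSpace.exp_zero]
  have hcomm : ∀ t : ℝ, Commute (NormedSpace.exp (t • X)) D := fun t =>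
    (hXD.smul_left t).exp_left
  have hB : ∀ t, HasDerivAt B (-(B t * D * B t)) t := by
    intro t
    have h := ((hasDerivAt_exp_smul_const X t).mul_const A).mul
      (hasDerivAt_exp_smul_const' (-X) t)
    convert! h using 1
    have e1 : B t * D * B t = NormedSpace.exp (t • X) * (A * D * A)
        * NormedSpace.exp (t • (-X)) := by
      have h1 : NormedSpace.exp (t • (-X)) * D * NormedSpace.exp (t • X) = D := by
        rw [mul_assoc, ← (hcomm t).eq, ← mul_assoc, hinv, one_mul]
      calc B t * D * B t = NormedSpace.exp (t • X) * A *
            (NormedSpace.exp (t • (-X)) * D * NormedSpace.exp (t • X)) * A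
              * NormedSpace.exp (t • (-X)) := by
              simp only [B, mul_assoc]
        _ = _ := by
              rw [h1]
              simp only [mul_assoc]
    rw [e1, ← neg_mul, ← mul_neg, ← hXA]
    noncomm_ring
  have hBc : Continuous B := continuous_iff_continuousAt.2 fun t => (hB t).continuousAt
  obtain ⟨K, hK⟩ := (isCompact_Icc (a := (0 : ℝ)) (b := 1)).exists_bound_of_continuousOn
    hBc.continuousOn
  have hB0 : B 0 = A := by simp [B]
  have hB1 : B 1 = NormedSpace.exp X * A * NormedSpace.exp (-X) := by simp [B]
  constructor
  -- The defect `F` solves the linear equation `F' = -B D F` with `F 0 = 0`, so it vanishes by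
  -- Grönwall.
  · let F : ℝ → R := fun t => B t * (1 + t • (D * A)) - A
    have hF : ∀ t, HasDerivAt F (-(B t * D * F t)) t := by
      intro t
      have h1 : HasDerivAt (fun t : ℝ => 1 + t • (D * A)) ((1 : ℝ) • (D * A)) t :=
        ((hasDerivAt_id t).smul_const (D * A)).const_add 1
      convert! ((hB t).mul h1).sub_const A using 1
      simp only [F, one_smul]
      generalize t • (D * A) = E
      noncomm_ring
    have h := eq_zero_of_abs_deriv_le_mul_abs_self_of_eq_zero_right (f := F) (K := K * ‖D‖)
      (a := 0) (b := 1) (fun t _ => (hF t).continuousAt.continuousWithinAt)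
      (fun t _ => (hF t).hasDerivWithinAt) (by simp [F, hB0]) (fun t ht => by
        rw [norm_neg]
        refine (norm_mul_le _ _).trans ?_
        gcongr
        refine (norm_mul_le _ _).trans ?_
        gcongr
        exact hK t ⟨ht.1, ht.2.le⟩) 1 ⟨zero_le_one, le_rfl⟩
    rw [← hB1]
    simpa [F, sub_eq_zero] using h
  · let F : ℝ → R := fun t => (1 + t • (A * D)) * B t - A
    have hF : ∀ t, HasDerivAt F (-(F t * D * B t)) t := by
      intro t
      have h1 : HasDerivAt (fun t : ℝ => 1 + t • (A * D)) ((1 : ℝ) • (A * D)) t :=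
        ((hasDerivAt_id t).smul_const (A * D)).const_add 1
      convert! (h1.mul (hB t)).sub_const A using 1
      simp only [F, one_smul]
      noncomm_ring
    have h := eq_zero_of_abs_deriv_le_mul_abs_self_of_eq_zero_right (f := F) (K := ‖D‖ * K)
      (a := 0) (b := 1) (fun t _ => (hF t).continuousAt.continuousWithinAt)
      (fun t _ => (hF t).hasDerivWithinAt) (by simp [F, hB0]) (fun t ht => by
        rw [norm_neg, mul_assoc, mul_comm _ ‖F t‖]
        refine (norm_mul_le _ _).trans ?_
        gcongr
        refine (norm_mul_le _ _).trans ?_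
        gcongr
        exact hK t ⟨ht.1, ht.2.le⟩) 1 ⟨zero_le_one, le_rfl⟩
    rw [← hB1]
    simpa [F, sub_eq_zero] using h

variable {H : Type*} [NormedAddCommGroup H] [InnerProductSpace ℂ H] [CompleteSpace H]

/-- A bound for the spectrum of an operator `A` such that conjugation by `U` shifts `A⁻¹` by the
constant `a`, where `A⁻¹ + (b / 2) (U + U⁻¹)` is bounded below by `1 + b`. -/
lemma spectrum_subset_closedBall_of_shift {A U V : H →L[ℂ] H} {a : ℂ} {b : ℝ} (ha : a ≠ 0)
    (hb : 0 < b) (hUV : U * V = 1) (hVU : V * U = 1) (hU : U * A - A * U = -(a • (A * U * A)))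
    (hV : V * A - A * V = a • (A * V * A))
    (hpos : ∀ f, (1 + b) * ‖A f‖ ^ 2
      ≤ (inner ℂ (A f) (f + ((b / 2 : ℝ) : ℂ) • (U (A f) + V (A f)))).re) :
    spectrum ℂ A ⊆ Metric.closedBall 0 (1 / (1 + b)) := by
  set D : H →L[ℂ] H := ((b / 2 : ℝ) : ℂ) • (U + V) with hD
  set c : ℂ := (b / 2 : ℝ) / a with hc
  set X : H →L[ℂ] H := c • (U - V) with hX
  have hca : c * a = (b / 2 : ℝ) := by rw [hc, div_mul_cancel₀ _ ha]
  have hXA : X * A - A * X = -(A * D * A) := by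
    calc X * A - A * X = c • ((U * A - A * U) - (V * A - A * V)) := by
          simp only [hX, smul_mul_assoc, mul_smul_comm, ← smul_sub, sub_mul, mul_sub]
          congr 1
          abel
      _ = -((c * a) • (A * U * A + A * V * A)) := by
          rw [hU, hV, mul_smul]
          simp only [smul_add, smul_sub, smul_neg]
          abel
      _ = _ := by
          rw [hca, hD, mul_smul_comm, smul_mul_assoc, mul_add, add_mul]
  have hXD : Commute X D := by
    have hUVc : Commute U V := by rw [Commute, SemiconjBy, hUV, hVU]
    have h1 : Commute (U - V) (U + V) :=
      ((Commute.refl U).add_right hUVc).sub_left (hUVc.symm.add_right (Commute.refl V))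
    exact (h1.smul_left c).smul_right _
  obtain ⟨h1, h2⟩ := exp_mul_mul_exp_neg_eq hXA hXD
  set B := NormedSpace.exp X * A * NormedSpace.exp (-X) with hB
  let +nondep : NormedAlgebra ℚ (H →L[ℂ] H) := NormedAlgebra.restrictScalars ℚ ℂ _
  have hinv1 : NormedSpace.exp X * NormedSpace.exp (-X) = 1 := by
    rw [← NormedSpace.exp_add_of_commute (Commute.refl _).neg_right, add_neg_cancel,
      NormedSpace.exp_zero]
  have hinv2 : NormedSpace.exp (-X) * NormedSpace.exp X = 1 := by
    rw [← NormedSpace.exp_add_of_commute (Commute.refl _).neg_left, neg_add_cancel,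
      NormedSpace.exp_zero]
  let M : (H →L[ℂ] H)ˣ := ⟨NormedSpace.exp X, NormedSpace.exp (-X), hinv1, hinv2⟩
  have hspec : spectrum ℂ A = spectrum ℂ B := (spectrum.units_conjugate (a := A) (u := M)).symm
  have hnorm : ‖B‖ ≤ 1 / (1 + b) := by
    refine ContinuousLinearMap.opNorm_le_bound _ (by positivity) fun g => ?_
    -- Formally `f = A⁻¹ B g`. Then `B g = A f` and `f + D A f = g`, so `hpos` at `f` is the lower
    -- bound for `A⁻¹ + D` at the vector `B g`.
    set f := (1 - D * B) g with hf
    have hg : (1 + D * A) f = g := by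
      have h3 : (1 + D * A) * (1 - D * B) = 1 := by
        calc (1 + D * A) * (1 - D * B) = 1 + D * (A - (1 + A * D) * B) := by noncomm_ring
          _ = 1 := by rw [h2, sub_self, mul_zero, add_zero]
      calc (1 + D * A) f = ((1 + D * A) * (1 - D * B)) g := rfl
        _ = g := by rw [h3]; rfl
    have hBg : B g = A f := by
      calc B g = (B * (1 + D * A)) f := by rw [← hg]; rfl
        _ = A f := by rw [h1]
    have h4 := hpos f
    have h5 : f + ((b / 2 : ℝ) : ℂ) • (U (A f) + V (A f)) = g := by
      rw [← hg]
      simp [hD]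
    rw [h5, ← hBg] at h4
    have h6 : (1 + b) * ‖B g‖ ^ 2 ≤ ‖B g‖ * ‖g‖ :=
      h4.trans ((Complex.re_le_norm _).trans (norm_inner_le_norm _ _))
    rw [one_div, ← div_eq_inv_mul, le_div_iff₀ (by positivity)]
    by_cases h0 : ‖B g‖ = 0
    · rw [h0, zero_mul]
      positivity
    · have h7 : 0 < ‖B g‖ := lt_of_le_of_ne (norm_nonneg _) (Ne.symm h0)
      nlinarith
  rw [hspec]
  intro z hz
  -- Bounding the spectrum by the norm requires `‖1‖ = 1`. On the zero space the spectrum is empty.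
  have : Nontrivial (H →L[ℂ] H) := by
    by_contra hn
    rw [not_nontrivial_iff_subsingleton] at hn
    rw [spectrum.of_subsingleton] at hz
    exact hz
  have : NormOneClass (H →L[ℂ] H) := by
    have : Nontrivial H := by
      by_contra hn
      rw [not_nontrivial_iff_subsingleton] at hn
      exact not_subsingleton (H →L[ℂ] H) inferInstance
    infer_instance
  exact Metric.closedBall_subset_closedBall hnorm (spectrum.subset_closedBall_norm B hz)

end Commutator

end ExteriorSchrodinger

namespace ExteriorSchrodinger

/-! ### Multiplication operators in `L²` -/

noncomputable section Multiplication

variable {d : ℕ} {Ω : Opens (Rd d)}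

lemma memLp_mul {m : Rd d → ℂ} (hm : Measurable m) {C : ℝ} (hC : ∀ x, ‖m x‖ ≤ C) (u : L2 Ω) :
    MemLp (fun x => m x * u x) 2 (volume.restrict (Ω : Set (Rd d))) :=
  (Lp.memLp u).of_le_mul (c := C) (hm.aestronglyMeasurable.mul (Lp.aestronglyMeasurable u))
    (Eventually.of_forall fun x => by
      rw [norm_mul]
      gcongr
      exact hC x)

/-- Multiplication by a bounded measurable function in `L²(Ω)`. -/
def mulL2 {m : Rd d → ℂ} (hm : Measurable m) {C : ℝ} (hC : ∀ x, ‖m x‖ ≤ C) : L2 Ω →L[ℂ] L2 Ω :=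
  LinearMap.mkContinuous
    { toFun := fun u => (memLp_mul hm hC u).toLp _
      map_add' := fun u v => by
        rw [← MemLp.toLp_add]
        refine MemLp.toLp_congr _ _ ?_
        filter_upwards [Lp.coeFn_add u v] with x hx
        rw [hx, Pi.add_apply, Pi.add_apply, mul_add]
      map_smul' := fun c u => by
        rw [RingHom.id_apply, ← MemLp.toLp_const_smul]
        refine MemLp.toLp_congr _ _ ?_
        filter_upwards [Lp.coeFn_smul c u] with x hx
        rw [hx, Pi.smul_apply, Pi.smul_apply, smul_eq_mul, smul_eq_mul, mul_left_comm] }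
    C (fun u => by
      refine Lp.norm_le_mul_norm_of_ae_le_mul ?_
      filter_upwards [MemLp.coeFn_toLp (memLp_mul hm hC u)] with x hx
      simp only [LinearMap.coe_mk, AddHom.coe_mk]
      rw [hx, norm_mul]
      gcongr
      exact hC x)

lemma coeFn_mulL2 {m : Rd d → ℂ} (hm : Measurable m) {C : ℝ} (hC : ∀ x, ‖m x‖ ≤ C) (u : L2 Ω) :
    mulL2 hm hC u =ᵐ[volume.restrict (Ω : Set (Rd d))] fun x => m x * u x :=
  MemLp.coeFn_toLp (memLp_mul hm hC u)

lemma norm_mulL2_le {m : Rd d → ℂ} (hm : Measurable m) {C : ℝ} (hC : ∀ x, ‖m x‖ ≤ C)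
    (u : L2 Ω) : ‖mulL2 hm hC u‖ ≤ C * ‖u‖ := by
  refine Lp.norm_le_mul_norm_of_ae_le_mul ?_
  filter_upwards [coeFn_mulL2 hm hC u] with x hx
  rw [hx, norm_mul]
  gcongr
  exact hC x

lemma inner_L2 (u v : L2 Ω) :
    inner ℂ v u = ∫ x in (Ω : Set (Rd d)), u x * conj (v x) := (integral_mul_conj u v).symm

lemma norm_sq_L2 (u : L2 Ω) : ‖u‖ ^ 2 = ∫ x in (Ω : Set (Rd d)), ‖u x‖ ^ 2 := by
  have h := congrArg Complex.re (inner_L2 u u)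
  rw [← RCLike.re_eq_complex_re, inner_self_eq_norm_sq] at h
  rw [h]
  have : ∀ x, u x * conj (u x) = ((‖u x‖ ^ 2 : ℝ) : ℂ) := fun x => by
    rw [Complex.mul_conj, Complex.normSq_eq_norm_sq]
  simp only [this, integral_complex_ofReal]
  rfl

lemma integrable_norm_sq_L2 (u : L2 Ω) :
    Integrable (fun x => ‖u x‖ ^ 2) (volume.restrict (Ω : Set (Rd d))) :=
  (Lp.memLp u).integrable_norm_pow (by norm_num)

lemma integrable_mul_conj_L2 (u v : L2 Ω) :
    Integrable (fun x => u x * conj (v x)) (volume.restrict (Ω : Set (Rd d))) := by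
  have h := L2.integrable_inner (𝕜 := ℂ) v u
  exact h

/-- Real multiplication operators are symmetric. -/
lemma inner_mulL2_left {m : Rd d → ℝ} (hm : Measurable fun x => (m x : ℂ)) {C : ℝ}
    (hC : ∀ x, ‖(m x : ℂ)‖ ≤ C) (u v : L2 Ω) :
    inner ℂ (mulL2 hm hC v) u = inner ℂ v (mulL2 hm hC u) := by
  rw [inner_L2, inner_L2]
  refine integral_congr_ae ?_
  filter_upwards [coeFn_mulL2 hm hC u, coeFn_mulL2 hm hC v] with x h1 h2
  rw [h1, h2, map_mul, Complex.conj_ofReal]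
  ring

/-- Turns each weak-gradient identity into an equality of continuous functionals on `L²`, hence into
a closed condition. -/
lemma exists_integral_smul_eq_inner {φ : Rd d → ℝ} (hc : Continuous φ) (hs : HasCompactSupport φ) :
    ∃ p : L2 Ω, ∀ u : L2 Ω, ∫ x in (Ω : Set (Rd d)), φ x • u x = inner ℂ p u := by
  have h : MemLp (fun x => (φ x : ℂ)) 2 ((volume : Measure (Rd d)).restrict (Ω : Set (Rd d))) :=
    ((Complex.continuous_ofReal.comp hc).memLp_of_hasCompactSupport
      (hs.comp_left (g := fun t : ℝ => (t : ℂ)) (by simp))).restrict _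
  refine ⟨h.toLp _, fun u => ?_⟩
  rw [inner_L2]
  refine integral_congr_ae ?_
  filter_upwards [h.coeFn_toLp] with x hx
  rw [hx, Complex.conj_ofReal, Complex.real_smul, mul_comm]

end Multiplication

/-! ### Weak gradients: product rule, restriction, extension by zero -/

noncomputable section WeakGradient

variable {d : ℕ} {Ω : Opens (Rd d)}

lemma continuous_partialDeriv {ζ : Rd d → ℝ} (hζ : ContDiff ℝ ∞ ζ) (i : Fin d) :
    Continuous (partialDeriv i ζ) :=
  (hζ.continuous_fderiv (by simp)).clm_apply continuous_const

lemma partialDeriv_mul {ζ φ : Rd d → ℝ} (hζ : ContDiff ℝ ∞ ζ) (hφ : ContDiff ℝ ∞ φ) (i : Fin d)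
    (x : Rd d) : partialDeriv i (fun x => ζ x * φ x) x
      = ζ x * partialDeriv i φ x + φ x * partialDeriv i ζ x := by
  have h := fderiv_fun_mul (hζ.differentiable (by simp) x) (hφ.differentiable (by simp) x)
  simp [partialDeriv, h]

/-- The product rule, tested with a function `φ` such that `ζ φ` is a test function. -/
lemma HasWeakGradient.integral_mul {u : L2 Ω} {G : Fin d → L2 Ω} (hu : HasWeakGradient Ω u G)
    {ζ φ : Rd d → ℝ} (hζ : ContDiff ℝ ∞ ζ) (hφ : ContDiff ℝ ∞ φ) (hφs : HasCompactSupport φ)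
    (hζφ : tsupport (fun x => ζ x * φ x) ⊆ (Ω : Set (Rd d))) (i : Fin d) :
    ∫ x in (Ω : Set (Rd d)), partialDeriv i φ x • ((ζ x : ℂ) * u x)
      = - ∫ x in (Ω : Set (Rd d)), φ x • ((ζ x : ℂ) * G i x + (partialDeriv i ζ x : ℂ) * u x) := by
  have hφ' : IsTestFunction (⊤ : Opens (Rd d)) φ := ⟨hφ, hφs, fun _ _ => trivial⟩
  have i1 := integrable_smul_Lp (φ := fun x => ζ x * partialDeriv i φ x)
    (hζ.continuous.mul (hφ'.partialDeriv_continuous i)) (hφ'.partialDeriv_compact i).mul_left u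
  have i2 := integrable_smul_Lp (φ := fun x => φ x * partialDeriv i ζ x)
    (hφ.continuous.mul (continuous_partialDeriv hζ i)) hφs.mul_right u
  have i3 := integrable_smul_Lp (φ := fun x => ζ x * φ x)
    (hζ.continuous.mul hφ.continuous) hφs.mul_left (G i)
  -- Only the product needs its support in `Ω`. This serves both test functions in `Ω` and, when `ζ`
  -- is supported in `Ω`, test functions on the whole space.
  have h := hu i (fun x => ζ x * φ x) ⟨hζ.mul hφ, hφs.mul_left, hζφ⟩
  simp only [partialDeriv_mul hζ hφ, add_smul] at h
  rw [integral_add i1 i2] at h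
  have e1 : ∫ x in (Ω : Set (Rd d)), partialDeriv i φ x • ((ζ x : ℂ) * u x)
      = ∫ x in (Ω : Set (Rd d)), (ζ x * partialDeriv i φ x) • u x := by
    refine integral_congr_ae (Eventually.of_forall fun x => ?_)
    simp only [Complex.real_smul, Complex.ofReal_mul]
    ring
  have e2 : ∫ x in (Ω : Set (Rd d)), φ x • ((ζ x : ℂ) * G i x + (partialDeriv i ζ x : ℂ) * u x)
      = (∫ x in (Ω : Set (Rd d)), (ζ x * φ x) • G i x)
        + ∫ x in (Ω : Set (Rd d)), (φ x * partialDeriv i ζ x) • u x := by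
    rw [← integral_add i3 i2]
    refine integral_congr_ae (Eventually.of_forall fun x => ?_)
    simp only [Complex.real_smul, Complex.ofReal_mul]
    ring
  rw [e1, e2]
  linear_combination h

/-- A smooth function which is bounded together with its partial derivatives. -/
structure IsMultiplier (ζ : Rd d → ℝ) (C : ℝ) : Prop where
  contDiff : ContDiff ℝ ∞ ζ
  norm_le : ∀ x, ‖(ζ x : ℂ)‖ ≤ C
  norm_partialDeriv_le : ∀ i x, ‖(partialDeriv i ζ x : ℂ)‖ ≤ C

lemma IsMultiplier.measurable {ζ : Rd d → ℝ} {C : ℝ} (h : IsMultiplier ζ C) :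
    Measurable fun x => (ζ x : ℂ) :=
  (Complex.continuous_ofReal.comp h.contDiff.continuous).measurable

lemma IsMultiplier.measurable_partialDeriv {ζ : Rd d → ℝ} {C : ℝ} (h : IsMultiplier ζ C)
    (i : Fin d) : Measurable fun x => (partialDeriv i ζ x : ℂ) :=
  (Complex.continuous_ofReal.comp (continuous_partialDeriv h.contDiff i)).measurable

/-- Multiplication by a multiplier. -/
def IsMultiplier.mul {ζ : Rd d → ℝ} {C : ℝ} (h : IsMultiplier ζ C) : L2 Ω →L[ℂ] L2 Ω :=
  mulL2 h.measurable h.norm_le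

/-- Multiplication by a partial derivative of a multiplier. -/
def IsMultiplier.mulDeriv {ζ : Rd d → ℝ} {C : ℝ} (h : IsMultiplier ζ C) (i : Fin d) :
    L2 Ω →L[ℂ] L2 Ω :=
  mulL2 (h.measurable_partialDeriv i) (h.norm_partialDeriv_le i)

/-- The product rule. -/
lemma HasWeakGradient.mul {u : L2 Ω} {G : Fin d → L2 Ω} (hu : HasWeakGradient Ω u G)
    {ζ : Rd d → ℝ} {C : ℝ} (h : IsMultiplier ζ C) :
    HasWeakGradient Ω (h.mul u) fun i => h.mul (G i) + h.mulDeriv i u := by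
  intro i φ hφ
  have key := hu.integral_mul h.contDiff hφ.1 hφ.2.1
    ((closure_mono (Function.support_mul_subset_right _ _)).trans hφ.2.2) i
  refine Eq.trans (integral_congr_ae ?_) (key.trans (congrArg Neg.neg (integral_congr_ae ?_)))
  · filter_upwards [coeFn_mulL2 h.measurable h.norm_le u] with x hx
    rw [IsMultiplier.mul, hx]
  · filter_upwards [coeFn_mulL2 h.measurable h.norm_le (G i),
      coeFn_mulL2 (h.measurable_partialDeriv i) (h.norm_partialDeriv_le i) u,
      Lp.coeFn_add (h.mul (G i)) (h.mulDeriv i u)] with x h1 h2 h3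
    rw [h3, Pi.add_apply, IsMultiplier.mul, IsMultiplier.mulDeriv, h1, h2]

lemma ae_restrict_top {p : Rd d → Prop} :
    (∀ᵐ x ∂(volume.restrict ((⊤ : Opens (Rd d)) : Set (Rd d))), p x) ↔ ∀ᵐ x, p x := by
  rw [Opens.coe_top, Measure.restrict_univ]

lemma setIntegral_top {E : Type*} [NormedAddCommGroup E] [NormedSpace ℝ E] (f : Rd d → E) :
    ∫ x in ((⊤ : Opens (Rd d)) : Set (Rd d)), f x = ∫ x, f x := by
  rw [Opens.coe_top, Measure.restrict_univ]

lemma coeFn_restrictL2 (f : L2 (⊤ : Opens (Rd d))) :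
    restrictL2 Ω f =ᵐ[volume.restrict (Ω : Set (Rd d))] f :=
  MemLp.coeFn_toLp (memLp_restrict Ω f)

lemma coeFn_extendByZero (f : L2 Ω) :
    extendByZero Ω f =ᵐ[volume] (Ω : Set (Rd d)).indicator f :=
  ae_restrict_top.1 (MemLp.coeFn_toLp (memLp_extendByZero f))

lemma HasWeakGradient.restrict {u : L2 (⊤ : Opens (Rd d))} {G : Fin d → L2 (⊤ : Opens (Rd d))}
    (hu : HasWeakGradient ⊤ u G) :
    HasWeakGradient Ω (restrictL2 Ω u) fun i => restrictL2 Ω (G i) := by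
  intro i φ hφ
  have h := hu i φ ⟨hφ.1, hφ.2.1, fun _ _ => trivial⟩
  rw [setIntegral_top, setIntegral_top] at h
  have e : ∀ (ψ : Rd d → ℝ) (v : L2 (⊤ : Opens (Rd d))), tsupport ψ ⊆ (Ω : Set (Rd d)) →
      ∫ x in (Ω : Set (Rd d)), ψ x • restrictL2 Ω v x = ∫ x, ψ x • v x := by
    intro ψ v hψ
    have h0 : ∀ x, x ∉ (Ω : Set (Rd d)) → ψ x • v x = 0 := fun x hx => by
      rw [image_eq_zero_of_notMem_tsupport (fun h => hx (hψ h)), zero_smul]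
    rw [← setIntegral_eq_integral_of_forall_compl_eq_zero h0]
    refine integral_congr_ae ?_
    filter_upwards [coeFn_restrictL2 (Ω := Ω) v] with x hx
    rw [hx]
  rw [e _ _ hφ.2.2, e (partialDeriv i φ) _ ((tsupport_fderiv_apply_subset ℝ _).trans hφ.2.2)]
  exact h

/-- The product of a function in `H¹(Ω)` with a multiplier that vanishes near the complement of
`Ω` extends by zero to the whole space. -/
lemma HasWeakGradient.extendByZero_mul {u : L2 Ω} {G : Fin d → L2 Ω} (hu : HasWeakGradient Ω u G)
    {ζ : Rd d → ℝ} {C : ℝ} (h : IsMultiplier ζ C) (hs : tsupport ζ ⊆ (Ω : Set (Rd d))) :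
    HasWeakGradient ⊤ (extendByZero Ω (h.mul u))
      fun i => extendByZero Ω (h.mul (G i) + h.mulDeriv i u) := by
  intro i φ hφ
  have key := hu.integral_mul h.contDiff hφ.1 hφ.2.1
    ((closure_mono (Function.support_mul_subset_left _ _)).trans hs) i
  have e : ∀ (ψ : Rd d → ℝ) (v : L2 Ω),
      ∫ x in ((⊤ : Opens (Rd d)) : Set (Rd d)), ψ x • extendByZero Ω v x
        = ∫ x in (Ω : Set (Rd d)), ψ x • v x := by
    intro ψ v
    rw [setIntegral_top, ← integral_indicator Ω.isOpen.measurableSet]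
    refine integral_congr_ae ?_
    filter_upwards [coeFn_extendByZero v] with x hx
    rw [hx]
    by_cases hxΩ : x ∈ (Ω : Set (Rd d)) <;> simp [hxΩ]
  rw [e, e]
  refine Eq.trans (integral_congr_ae ?_) (key.trans (congrArg Neg.neg (integral_congr_ae ?_)))
  · filter_upwards [coeFn_mulL2 h.measurable h.norm_le u] with x hx
    rw [IsMultiplier.mul, hx]
  · filter_upwards [coeFn_mulL2 h.measurable h.norm_le (G i),
      coeFn_mulL2 (h.measurable_partialDeriv i) (h.norm_partialDeriv_le i) u,
      Lp.coeFn_add (h.mul (G i)) (h.mulDeriv i u)] with x h1 h2 h3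
    rw [h3, Pi.add_apply, IsMultiplier.mul, IsMultiplier.mulDeriv, h1, h2]

end WeakGradient

end ExteriorSchrodinger

namespace ExteriorSchrodinger

/-! ### Form domain, weak coercivity and existence of the resolvent -/

noncomputable section FormSpace

variable {d : ℕ} {Ω : Opens (Rd d)}

/-- The Hilbert space of triples `(u, w, G)`, in which the form domain is embedded by
`w = |V|^{1/2} u`, `G = ∇u`. -/
abbrev FormAmbient (Ω : Opens (Rd d)) : Type :=
  PiLp 2 fun _ : Option (Option (Fin d)) => L2 Ω

/-- The operator with given components. -/
def ofComponents {X : Type*} [NormedAddCommGroup X] [NormedSpace ℂ X]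
    (T : Option (Option (Fin d)) → X →L[ℂ] L2 Ω) : X →L[ℂ] FormAmbient Ω :=
  (PiLp.continuousLinearEquiv 2 ℂ fun _ : Option (Option (Fin d)) => L2 Ω).symm.toContinuousLinearMap
    ∘L ContinuousLinearMap.pi T

@[simp]
lemma ofComponents_apply {X : Type*} [NormedAddCommGroup X] [NormedSpace ℂ X]
    (T : Option (Option (Fin d)) → X →L[ℂ] L2 Ω) (x : X) (o : Option (Option (Fin d))) :
    ofComponents T x o = T o x := rfl

/-- A component, as a bounded operator. -/
def component (o : Option (Option (Fin d))) : FormAmbient Ω →L[ℂ] L2 Ω :=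
  PiLp.proj 2 (fun _ : Option (Option (Fin d)) => L2 Ω) o

@[simp]
lemma component_apply (o : Option (Option (Fin d))) (z : FormAmbient Ω) : component o z = z o :=
  rfl

lemma inner_formAmbient (z y : FormAmbient Ω) : inner ℂ z y
    = inner ℂ (z none) (y none) + (inner ℂ (z (some none)) (y (some none))
      + ∑ i, inner ℂ (z (some (some i))) (y (some (some i)))) := by
  rw [PiLp.inner_apply, Fintype.sum_option, Fintype.sum_option]

lemma norm_sq_formAmbient (z : FormAmbient Ω) : ‖z‖ ^ 2
    = ‖z none‖ ^ 2 + (‖z (some none)‖ ^ 2 + ∑ i, ‖z (some (some i))‖ ^ 2) := by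
  rw [PiLp.norm_sq_eq_of_L2, Fintype.sum_option, Fintype.sum_option]

/-- The relation `w = |V|^{1/2} u`. -/
def IsSqrtPotential (V : C(Rd d, ℝ)) (u w : L2 Ω) : Prop :=
  w =ᵐ[volume.restrict (Ω : Set (Rd d))] fun x => (√|V x| : ℂ) * u x

lemma HasFinitePotential.exists_isSqrtPotential {V : C(Rd d, ℝ)} {u : L2 Ω}
    (h : HasFinitePotential Ω V u) : ∃ w, IsSqrtPotential V u w :=
  ⟨h.toLp _, h.coeFn_toLp.trans (Eventually.of_forall fun x => by simp)⟩

lemma IsSqrtPotential.hasFinitePotential {V : C(Rd d, ℝ)} {u w : L2 Ω}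
    (h : IsSqrtPotential V u w) : HasFinitePotential Ω V u :=
  (Lp.memLp w).ae_eq (h.trans (Eventually.of_forall fun x => by simp))

section Truncation

variable (V : C(Rd d, ℝ))

lemma measurable_inv_one_add_sqrt : Measurable fun x => (((1 + √|V x|)⁻¹ : ℝ) : ℂ) := by
  have := V.continuous.measurable
  fun_prop

lemma norm_inv_one_add_sqrt_le (x : Rd d) : ‖(((1 + √|V x|)⁻¹ : ℝ) : ℂ)‖ ≤ 1 := by
  have h := Real.sqrt_nonneg |V x|
  rw [Complex.norm_real, Real.norm_eq_abs, abs_of_nonneg (by positivity)]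
  exact inv_le_one_of_one_le₀ (by linarith)

lemma measurable_sqrt_div_one_add_sqrt :
    Measurable fun x => ((√|V x| * (1 + √|V x|)⁻¹ : ℝ) : ℂ) := by
  have := V.continuous.measurable
  fun_prop

lemma norm_sqrt_div_one_add_sqrt_le (x : Rd d) : ‖((√|V x| * (1 + √|V x|)⁻¹ : ℝ) : ℂ)‖ ≤ 1 := by
  have h := Real.sqrt_nonneg |V x|
  rw [Complex.norm_real, Real.norm_eq_abs, abs_of_nonneg (by positivity), ← div_eq_mul_inv,
    div_le_one (by positivity)]
  linarith

/-- Multiplication by `√|V|` may be unbounded. Dividing by `1 + √|V|` turns the relation into an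
equality of bounded operators, so it is visibly linear and closed. -/
lemma isSqrtPotential_iff (u w : L2 Ω) : IsSqrtPotential V u w ↔
    mulL2 (measurable_inv_one_add_sqrt V) (norm_inv_one_add_sqrt_le V) w
      = mulL2 (measurable_sqrt_div_one_add_sqrt V) (norm_sqrt_div_one_add_sqrt_le V) u := by
  have h1 := coeFn_mulL2 (Ω := Ω) (measurable_inv_one_add_sqrt V) (norm_inv_one_add_sqrt_le V) w
  have h2 := coeFn_mulL2 (Ω := Ω) (measurable_sqrt_div_one_add_sqrt V)
    (norm_sqrt_div_one_add_sqrt_le V) u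
  have hne : ∀ x, ((1 + √|V x| : ℝ) : ℂ) ≠ 0 := fun x => by
    have h := Real.sqrt_nonneg |V x|
    exact_mod_cast (by positivity : (1 + √|V x| : ℝ) ≠ 0)
  constructor
  · intro h
    refine Lp.ext ?_
    filter_upwards [h, h1, h2] with x hx h1 h2
    rw [h1, h2, hx]
    push_cast
    ring
  · intro h
    rw [h] at h1
    filter_upwards [h1, h2] with x h1 h2
    rw [h2] at h1
    have h3 := congrArg (fun z => ((1 + √|V x| : ℝ) : ℂ) * z) h1
    have := hne x
    simp only [Complex.ofReal_mul, Complex.ofReal_inv] at h3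
    field_simp at h3
    exact h3.symm

end Truncation

variable (Ω) in
/-- The form domain as a subspace of the ambient Hilbert space. -/
def formSpace (V : C(Rd d, ℝ)) : Submodule ℂ (FormAmbient Ω) where
  carrier := {z | HasWeakGradient Ω (z none) (fun i => z (some (some i))) ∧
    IsSqrtPotential V (z none) (z (some none))}
  add_mem' := fun {y z} hy hz => ⟨hy.1.add hz.1, by
    have h1 := hy.2
    have h2 := hz.2
    rw [isSqrtPotential_iff] at h1 h2 ⊢
    rw [PiLp.add_apply, PiLp.add_apply, map_add, map_add, h1, h2]⟩
  zero_mem' := ⟨fun i φ hφ => by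
      obtain ⟨p, hp⟩ := exists_integral_smul_eq_inner (Ω := Ω) hφ.1.continuous hφ.2.1
      obtain ⟨q, hq⟩ := exists_integral_smul_eq_inner (Ω := Ω) (hφ.partialDeriv_continuous i)
        (hφ.partialDeriv_compact i)
      rw [hp, hq]
      simp, by
    rw [isSqrtPotential_iff]
    simp⟩
  smul_mem' := fun c z hz => ⟨hz.1.smul c, by
    have h1 := hz.2
    rw [isSqrtPotential_iff] at h1 ⊢
    rw [PiLp.smul_apply, PiLp.smul_apply, map_smul, map_smul, h1]⟩

lemma isClosed_formSpace (V : C(Rd d, ℝ)) : IsClosed (formSpace Ω V : Set (FormAmbient Ω)) := by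
  have hc : ∀ o, Continuous fun z : FormAmbient Ω => z o := fun o =>
    (component (Ω := Ω) o).continuous
  have h1 : IsClosed {z : FormAmbient Ω |
      HasWeakGradient Ω (z none) (fun i => z (some (some i)))} := by
    simp only [HasWeakGradient, Set.ofPred_forall]
    refine isClosed_iInter fun i => isClosed_iInter fun φ => isClosed_iInter fun hφ => ?_
    obtain ⟨p, hp⟩ := exists_integral_smul_eq_inner (Ω := Ω) hφ.1.continuous hφ.2.1
    obtain ⟨q, hq⟩ := exists_integral_smul_eq_inner (Ω := Ω) (hφ.partialDeriv_continuous i)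
      (hφ.partialDeriv_compact i)
    simp only [hp, hq]
    exact isClosed_eq (continuous_const.inner (hc _)) (continuous_const.inner (hc _)).neg
  have h2 : IsClosed {z : FormAmbient Ω | IsSqrtPotential V (z none) (z (some none))} := by
    simp only [isSqrtPotential_iff]
    exact isClosed_eq ((ContinuousLinearMap.continuous _).comp (hc _))
      ((ContinuousLinearMap.continuous _).comp (hc _))
  exact h1.inter h2

instance (V : C(Rd d, ℝ)) : CompleteSpace (formSpace Ω V) :=
  (isClosed_formSpace V).completeSpace_coe

/-- The sign of the potential. -/
def potentialSign (V : C(Rd d, ℝ)) (x : Rd d) : ℝ := if 0 ≤ V x then 1 else -1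

lemma potentialSign_mul_abs (V : C(Rd d, ℝ)) (x : Rd d) : potentialSign V x * |V x| = V x := by
  rw [potentialSign]
  split_ifs with h
  · rw [abs_of_nonneg h, one_mul]
  · rw [abs_of_neg (not_le.1 h), neg_one_mul, neg_neg]

lemma measurable_potentialSign (V : C(Rd d, ℝ)) : Measurable fun x => (potentialSign V x : ℂ) :=
  Complex.measurable_ofReal.comp
    (Measurable.ite (measurableSet_le measurable_const V.continuous.measurable)
      measurable_const measurable_const)

lemma norm_potentialSign_le (V : C(Rd d, ℝ)) (x : Rd d) : ‖(potentialSign V x : ℂ)‖ ≤ 1 := by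
  rw [Complex.norm_real, potentialSign]
  split_ifs <;> simp

variable (Ω) in
/-- Multiplication by the sign of the potential. -/
def mulSign (V : C(Rd d, ℝ)) : L2 Ω →L[ℂ] L2 Ω :=
  mulL2 (measurable_potentialSign V) (norm_potentialSign_le V)

/-- Splitting `V = sign V * √|V| * √|V|` makes the potential term a bounded form in the components
`|V|^{1/2} u` and `|V|^{1/2} v`. -/
lemma inner_mulSign (V : C(Rd d, ℝ)) {u v w y : L2 Ω} (hu : IsSqrtPotential V u w)
    (hv : IsSqrtPotential V v y) :
    inner ℂ y (mulSign Ω V w) = ∫ x in (Ω : Set (Rd d)), (V x : ℂ) * u x * conj (v x) := by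
  rw [inner_L2]
  refine integral_congr_ae ?_
  filter_upwards [hu, hv, coeFn_mulL2 (measurable_potentialSign V) (norm_potentialSign_le V) w]
    with x h1 h2 h3
  rw [mulSign, h3, h1, h2, map_mul, Complex.conj_ofReal]
  have h4 : (√|V x| : ℂ) * √|V x| = ((|V x| : ℝ) : ℂ) := by
    exact_mod_cast Real.mul_self_sqrt (abs_nonneg _)
  have h5 : (potentialSign V x : ℂ) * ((|V x| : ℝ) : ℂ) = V x := by
    exact_mod_cast potentialSign_mul_abs V x
  linear_combination (potentialSign V x * u x * conj (v x)) * h4 + (u x * conj (v x)) * h5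

/-- Coercivity of the potential with respect to the multiplier `Φ`. -/
lemma le_re_inner_mul_mulSign {V : C(Rd d, ℝ)} {Φ : Rd d → ℝ} {C : ℝ} (hΦ : IsMultiplier Φ C)
    (hlow : ∀ x, |V x| - 1 ≤ Φ x * V x) {u w : L2 Ω} (hu : IsSqrtPotential V u w) :
    ‖w‖ ^ 2 - ‖u‖ ^ 2 ≤ (inner ℂ (hΦ.mul w) (mulSign Ω V w)).re := by
  rw [inner_L2, norm_sq_L2, norm_sq_L2,
    ← integral_sub (integrable_norm_sq_L2 w) (integrable_norm_sq_L2 u),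
    ← RCLike.re_eq_complex_re, ← integral_re (integrable_mul_conj_L2 _ _)]
  refine integral_mono_ae ((integrable_norm_sq_L2 w).sub (integrable_norm_sq_L2 u))
    (integrable_mul_conj_L2 _ _).re ?_
  -- Pointwise the right integrand is `Φ V |u|²`, and `hlow` bounds it below by `|V| |u|² - |u|² =
  -- |w|² - |u|²`.
  filter_upwards [hu, coeFn_mulL2 (measurable_potentialSign V) (norm_potentialSign_le V) w,
    coeFn_mulL2 hΦ.measurable hΦ.norm_le w] with x h1 h2 h3
  have h4 : mulSign Ω V w x * conj (hΦ.mul w x)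
      = ((potentialSign V x * Φ x * ‖w x‖ ^ 2 : ℝ) : ℂ) := by
    rw [mulSign, IsMultiplier.mul, h2, h3, map_mul, Complex.conj_ofReal, Complex.ofReal_mul,
      ← Complex.normSq_eq_norm_sq, ← Complex.mul_conj]
    push_cast
    ring
  rw [h4, RCLike.re_eq_complex_re, Complex.ofReal_re]
  have h5 : ‖w x‖ ^ 2 = |V x| * ‖u x‖ ^ 2 := by
    rw [h1, norm_mul, mul_pow, Complex.norm_real, Real.norm_eq_abs,
      abs_of_nonneg (Real.sqrt_nonneg _), Real.sq_sqrt (abs_nonneg _)]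
  rw [h5]
  have h6 := mul_le_mul_of_nonneg_right (hlow x) (sq_nonneg ‖u x‖)
  have h7 : potentialSign V x * Φ x * (|V x| * ‖u x‖ ^ 2) = Φ x * V x * ‖u x‖ ^ 2 := by
    linear_combination (Φ x * ‖u x‖ ^ 2) * potentialSign_mul_abs V x
  linarith

variable (Ω) in
/-- The operator representing the form, with the sign `ε` in front of the potential. -/
def formOp (V : C(Rd d, ℝ)) (ε : ℝ) : FormAmbient Ω →L[ℂ] FormAmbient Ω :=
  ofComponents fun o => match o with
    | none => component none
    | some none => (Complex.I * ε) • mulSign Ω V ∘L component (some none)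
    | some (some i) => component (some (some i))

lemma inner_formOp (V : C(Rd d, ℝ)) (ε : ℝ) (z y : FormAmbient Ω) :
    inner ℂ z (formOp Ω V ε y) = inner ℂ (z none) (y none)
      + (Complex.I * ε * inner ℂ (z (some none)) (mulSign Ω V (y (some none)))
      + ∑ i, inner ℂ (z (some (some i))) (y (some (some i)))) := by
  rw [inner_formAmbient]
  simp [formOp, inner_smul_right]

/-- Passing to the adjoint only conjugates the factor `i` of the potential. This is why both signs
`ε` are carried along. -/
lemma inner_formOp_neg (V : C(Rd d, ℝ)) (ε : ℝ) (z y : FormAmbient Ω) :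
    inner ℂ (formOp Ω V (-ε) z) y = inner ℂ z (formOp Ω V ε y) := by
  rw [← inner_conj_symm, inner_formOp, inner_formOp]
  simp only [map_add, map_mul, map_sum, inner_conj_symm, Complex.conj_I, Complex.conj_ofReal]
  rw [mulSign, inner_mulL2_left]
  push_cast
  ring

variable (Ω) in
/-- Multiplication of `(u, |V|^{1/2} u, ∇u)` by a multiplier. -/
def formMul {Φ : Rd d → ℝ} {C : ℝ} (hΦ : IsMultiplier Φ C) : FormAmbient Ω →L[ℂ] FormAmbient Ω :=
  ofComponents fun o => match o with
    | none => hΦ.mul ∘L component none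
    | some none => hΦ.mul ∘L component (some none)
    | some (some i) => hΦ.mul ∘L component (some (some i)) + hΦ.mulDeriv i ∘L component none

lemma IsSqrtPotential.mul {V : C(Rd d, ℝ)} {Φ : Rd d → ℝ} {C : ℝ} (hΦ : IsMultiplier Φ C)
    {u w : L2 Ω} (h : IsSqrtPotential V u w) : IsSqrtPotential V (hΦ.mul u) (hΦ.mul w) := by
  filter_upwards [h, coeFn_mulL2 hΦ.measurable hΦ.norm_le u,
    coeFn_mulL2 hΦ.measurable hΦ.norm_le w] with x h1 h2 h3
  rw [IsMultiplier.mul, h2, h3, h1]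
  ring

lemma formMul_mem {V : C(Rd d, ℝ)} {Φ : Rd d → ℝ} {C : ℝ} (hΦ : IsMultiplier Φ C)
    {z : FormAmbient Ω} (hz : z ∈ formSpace Ω V) : formMul Ω hΦ z ∈ formSpace Ω V :=
  ⟨hz.1.mul hΦ, hz.2.mul hΦ⟩

/-- Coercivity of the form with respect to the multiplier `γ + i ε Φ`. -/
lemma norm_sq_le_re_inner_formOp {V : C(Rd d, ℝ)} {Φ : Rd d → ℝ} {C : ℝ} (hΦ : IsMultiplier Φ C)
    (hlow : ∀ x, |V x| - 1 ≤ Φ x * V x) {ε : ℝ} (hε : ε = 1 ∨ ε = -1) {z : FormAmbient Ω}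
    (hz : z ∈ formSpace Ω V) :
    ‖z‖ ^ 2 ≤ (inner ℂ (((2 + d * C ^ 2 : ℝ) : ℂ) • z + (Complex.I * ε) • formMul Ω hΦ z)
      (formOp Ω V ε z)).re := by
  have hε2 : ε * ε = 1 := by rcases hε with rfl | rfl <;> norm_num
  have hself : ∀ m : L2 Ω, (inner ℂ m m).im = 0 := fun m => inner_self_im (𝕜 := ℂ) m
  have hselfre : ∀ m : L2 Ω, (inner ℂ m m).re = ‖m‖ ^ 2 := fun m =>
    inner_self_eq_norm_sq (𝕜 := ℂ) m
  have hsym : ∀ {m : Rd d → ℝ} (hm : Measurable fun x => (m x : ℂ)) {c : ℝ}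
      (hc : ∀ x, ‖(m x : ℂ)‖ ≤ c) (u : L2 Ω), (inner ℂ u (mulL2 hm hc u)).im = 0 := by
    intro m hm c hc u
    have h := inner_conj_symm (𝕜 := ℂ) u (mulL2 hm hc u)
    rw [inner_mulL2_left] at h
    exact Complex.conj_eq_iff_im.1 h
  have hΦsym : ∀ u : L2 Ω, (inner ℂ (hΦ.mul u) u).im = 0 := fun u => by
    rw [IsMultiplier.mul, inner_mulL2_left]
    exact hsym _ _ u
  have hsign : (inner ℂ (z (some none)) (mulSign Ω V (z (some none)))).im = 0 := hsym _ _ _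
  have e1 : (inner ℂ z (formOp Ω V ε z)).re
      = ‖z none‖ ^ 2 + ∑ i, ‖z (some (some i))‖ ^ 2 := by
    rw [inner_formOp]
    simp [hsign, Complex.add_re, Complex.mul_re, ← Complex.ofReal_pow]
  -- Pairing with `z` itself misses the component `|V|^{1/2} u`. Pairing with `Φ z` produces it in
  -- the imaginary part, at the cost of the cross terms with `∂ᵢΦ`.
  have e2 : (inner ℂ (formMul Ω hΦ z) (formOp Ω V ε z)).im
      = ε * (inner ℂ (hΦ.mul (z (some none))) (mulSign Ω V (z (some none)))).re
        + ∑ i, (inner ℂ (hΦ.mulDeriv i (z none)) (z (some (some i)))).im := by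
    rw [inner_formOp]
    simp [formMul, hΦsym, inner_add_left, Complex.add_im, Complex.mul_im]
  have e3 : (inner ℂ (((2 + d * C ^ 2 : ℝ) : ℂ) • z + (Complex.I * ε) • formMul Ω hΦ z)
      (formOp Ω V ε z)).re = (2 + d * C ^ 2) * (inner ℂ z (formOp Ω V ε z)).re
        + ε * (inner ℂ (formMul Ω hΦ z) (formOp Ω V ε z)).im := by
    rw [inner_add_left, inner_smul_left, inner_smul_left, Complex.add_re, Complex.conj_ofReal,
      Complex.re_ofReal_mul, map_mul, Complex.conj_I, Complex.conj_ofReal]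
    congr 1
    simp [Complex.mul_re]
  have h1 := le_re_inner_mul_mulSign hΦ hlow hz.2
  have h2 : ∀ i, -(C ^ 2 * ‖z none‖ ^ 2 / 2 + ‖z (some (some i))‖ ^ 2 / 2)
      ≤ ε * (inner ℂ (hΦ.mulDeriv i (z none)) (z (some (some i)))).im := by
    intro i
    have h3 : |ε * (inner ℂ (hΦ.mulDeriv i (z none)) (z (some (some i)))).im|
        ≤ C * ‖z none‖ * ‖z (some (some i))‖ := by
      rw [abs_mul, show |ε| = 1 by rcases hε with rfl | rfl <;> simp, one_mul]
      refine (Complex.abs_im_le_norm _).trans ((norm_inner_le_norm _ _).trans ?_)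
      gcongr
      exact norm_mulL2_le _ _ _
    have h4 := neg_le_of_abs_le h3
    nlinarith [sq_nonneg (C * ‖z none‖ - ‖z (some (some i))‖)]
  have h5 := Finset.sum_le_sum fun i (_ : i ∈ Finset.univ) => h2 i
  rw [Finset.sum_neg_distrib, Finset.sum_add_distrib, Finset.sum_const, Finset.card_univ,
    Fintype.card_fin, nsmul_eq_mul, ← Finset.sum_div, ← Finset.mul_sum] at h5
  have h10 : ∀ a b : ℝ, ε * (ε * a + b) = a + ε * b := fun a b => by
    linear_combination a * hε2
  -- The multiplier costs at most `(1 + d C² / 2) ‖u‖² + ∑ ‖∂ᵢu‖² / 2`. The factor `2 + d C²` in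
  -- front of the real part absorbs this and leaves one copy of each term.
  rw [e3, e1, e2, norm_sq_formAmbient, h10]
  have h6 : 0 ≤ ∑ i, ‖z (some (some i))‖ ^ 2 := Finset.sum_nonneg fun i _ => by positivity
  have h7 : 0 ≤ (d : ℝ) * C ^ 2 := by positivity
  have h8 := mul_nonneg h7 h6
  have h9 := mul_nonneg h7 (sq_nonneg ‖z none‖)
  nlinarith

variable (Ω) in
/-- The operator in the form domain representing the form. -/
def formSpaceOp (V : C(Rd d, ℝ)) (ε : ℝ) : formSpace Ω V →L[ℂ] formSpace Ω V :=
  (formSpace Ω V).orthogonalProjectionOnto ∘L formOp Ω V ε ∘L (formSpace Ω V).subtypeL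

lemma inner_formSpaceOp (V : C(Rd d, ℝ)) (ε : ℝ) (z y : formSpace Ω V) :
    inner ℂ z (formSpaceOp Ω V ε y) = inner ℂ (z : FormAmbient Ω) (formOp Ω V ε y) := by
  simp [formSpaceOp]

lemma formSpaceOp_neg (V : C(Rd d, ℝ)) (ε : ℝ) :
    formSpaceOp Ω V (-ε) = ContinuousLinearMap.adjoint (formSpaceOp Ω V ε) := by
  rw [ContinuousLinearMap.eq_adjoint_iff]
  intro z y
  rw [inner_formSpaceOp, ← inner_conj_symm, inner_formSpaceOp, inner_conj_symm, inner_formOp_neg]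

/-- With `W = γ + i ε Φ` acting on the form domain, `W* T` is coercive and therefore invertible by
Lax–Milgram. This yields a left inverse of `T`, but not yet a right one. -/
lemma exists_mul_formSpaceOp_eq_one {V : C(Rd d, ℝ)} {Φ : Rd d → ℝ} {C : ℝ}
    (hΦ : IsMultiplier Φ C) (hlow : ∀ x, |V x| - 1 ≤ Φ x * V x) {ε : ℝ} (hε : ε = 1 ∨ ε = -1) :
    ∃ L : formSpace Ω V →L[ℂ] formSpace Ω V, L * formSpaceOp Ω V ε = 1 := by
  let M : formSpace Ω V →L[ℂ] formSpace Ω V :=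
    (formMul Ω hΦ ∘L (formSpace Ω V).subtypeL).codRestrict (formSpace Ω V)
      fun z => formMul_mem hΦ z.2
  let W : formSpace Ω V →L[ℂ] formSpace Ω V :=
    ((2 + d * C ^ 2 : ℝ) : ℂ) • 1 + (Complex.I * ε) • M
  have hu : IsUnit (ContinuousLinearMap.adjoint W * formSpaceOp Ω V ε) := by
    refine ContinuousLinearMap.isUnit_of_forall_le_norm_inner_map _ (c := 1) one_pos fun z => ?_
    rw [NNReal.coe_one, mul_one]
    have h1 := norm_sq_le_re_inner_formOp hΦ hlow hε z.2
    have h2 : inner ℂ (W z) (formSpaceOp Ω V ε z)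
        = inner ℂ (((2 + d * C ^ 2 : ℝ) : ℂ) • (z : FormAmbient Ω)
          + (Complex.I * ε) • formMul Ω hΦ z) (formOp Ω V ε z) := inner_formSpaceOp V ε (W z) z
    have h3 : ‖inner ℂ ((ContinuousLinearMap.adjoint W * formSpaceOp Ω V ε) z) z‖
        = ‖inner ℂ (W z) (formSpaceOp Ω V ε z)‖ := by
      rw [mul_apply_eq_comp, ContinuousLinearMap.adjoint_inner_left,
        norm_inner_symm (𝕜 := ℂ)]
    rw [h3, h2]
    exact h1.trans (Complex.re_le_norm _)
  obtain ⟨Q, hQ⟩ := hu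
  exact ⟨↑Q⁻¹ * ContinuousLinearMap.adjoint W, by rw [mul_assoc, ← hQ, Units.inv_mul]⟩

lemma isUnit_of_left_inverses {H : Type*} [NormedAddCommGroup H] [InnerProductSpace ℂ H]
    [CompleteSpace H] {T L L' : H →L[ℂ] H} (hL : L * T = 1)
    (hL' : L' * ContinuousLinearMap.adjoint T = 1) : IsUnit T := by
  have hR : T * ContinuousLinearMap.adjoint L' = 1 := by
    have := congrArg ContinuousLinearMap.adjoint hL'
    rwa [ContinuousLinearMap.mul_def, ContinuousLinearMap.adjoint_comp,
      ContinuousLinearMap.adjoint_adjoint, ContinuousLinearMap.one_def,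
      ContinuousLinearMap.adjoint_id] at this
  exact ⟨⟨T, L, by rwa [left_inv_eq_right_inv hL hR], hL⟩, rfl⟩

/-- The adjoint is the operator with `ε = -1`, so coercivity for both signs gives left inverses of
the operator and of its adjoint. -/
lemma isUnit_formSpaceOp {V : C(Rd d, ℝ)} {Φ : Rd d → ℝ} {C : ℝ} (hΦ : IsMultiplier Φ C)
    (hlow : ∀ x, |V x| - 1 ≤ Φ x * V x) : IsUnit (formSpaceOp Ω V 1) := by
  obtain ⟨L, hL⟩ := exists_mul_formSpaceOp_eq_one (Ω := Ω) hΦ hlow (Or.inl rfl)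
  obtain ⟨L', hL'⟩ := exists_mul_formSpaceOp_eq_one (Ω := Ω) hΦ hlow (Or.inr rfl)
  rw [formSpaceOp_neg] at hL'
  exact isUnit_of_left_inverses hL hL'

/-- The operator `𝒜^N_{Ω,V} + 1` has a bounded right inverse. -/
theorem exists_resolvent {V : C(Rd d, ℝ)} {Φ : Rd d → ℝ} {C : ℝ} (hΦ : IsMultiplier Φ C)
    (hlow : ∀ x, |V x| - 1 ≤ Φ x * V x) :
    ∃ R : L2 Ω →L[ℂ] L2 Ω, ∀ f, IsNeumannImage Ω V (R f) (f - R f) := by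
  obtain ⟨T, hT⟩ := isUnit_formSpaceOp (Ω := Ω) hΦ hlow
  -- The projection of `(f, 0, 0)` to the form domain is the Riesz representative of `v ↦ ∫ f conj
  -- v`.
  let J : L2 Ω →L[ℂ] FormAmbient Ω := ofComponents fun o => match o with
    | none => 1
    | some _ => 0
  let S : L2 Ω →L[ℂ] formSpace Ω V :=
    (↑T⁻¹ : formSpace Ω V →L[ℂ] formSpace Ω V) ∘L (formSpace Ω V).orthogonalProjectionOnto ∘L J
  refine ⟨component none ∘L (formSpace Ω V).subtypeL ∘L S, fun f => ?_⟩
  set z : formSpace Ω V := S f with hz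
  have hzeq : formSpaceOp Ω V 1 z = (formSpace Ω V).orthogonalProjectionOnto (J f) := by
    have h : (↑T * ↑T⁻¹ : formSpace Ω V →L[ℂ] formSpace Ω V) = 1 := T.mul_inv
    rw [← hT]
    exact congrArg (fun Q : formSpace Ω V →L[ℂ] formSpace Ω V =>
      Q ((formSpace Ω V).orthogonalProjectionOnto (J f))) h
  change IsNeumannImage Ω V ((z : FormAmbient Ω) none) (f - (z : FormAmbient Ω) none)
  refine ⟨z.2.2.hasFinitePotential, fun i => (z : FormAmbient Ω) (some (some i)), z.2.1,
    fun v H hv hvV => ?_⟩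
  obtain ⟨w, hw⟩ := hvV.exists_isSqrtPotential
  let y : FormAmbient Ω := WithLp.toLp 2 fun o => match o with
    | none => v
    | some none => w
    | some (some i) => H i
  have hy : y ∈ formSpace Ω V := ⟨hv, hw⟩
  have h1 := inner_formSpaceOp V 1 ⟨y, hy⟩ z
  have h2 : inner ℂ (⟨y, hy⟩ : formSpace Ω V) (formSpaceOp Ω V 1 z) = inner ℂ v f := by
    rw [hzeq]
    simp only [Submodule.inner_orthogonalProjectionOnto_eq_of_mem_left]
    rw [inner_formAmbient]
    simp [J, y]
  rw [h2, inner_formOp] at h1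
  have h3 := inner_mulSign V z.2.2 hw
  simp only [integral_mul_conj]
  rw [inner_sub_right, h1, ← h3]
  simp only [y, Complex.ofReal_one, mul_one]
  ring

end FormSpace

end ExteriorSchrodinger

namespace ExteriorSchrodinger

/-! ### Energy identity and basic properties of the resolvent -/

noncomputable section Resolvent

variable {d : ℕ} {Ω : Opens (Rd d)} {V : C(Rd d, ℝ)}

/-- The real part of the form. -/
lemma IsNeumannImage.exists_energy {u g : L2 Ω} (h : IsNeumannImage Ω V u g) :
    ∃ G : Fin d → L2 Ω, HasWeakGradient Ω u G ∧
      ‖u‖ ^ 2 + ∑ i, ‖G i‖ ^ 2 = (inner ℂ u (g + u)).re := by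
  obtain ⟨hu, G, hG, h⟩ := h
  refine ⟨G, hG, ?_⟩
  have h1 := congrArg Complex.re (h u G hG hu)
  have h2 : ∀ x, (V x : ℂ) * u x * conj (u x) = ((V x * ‖u x‖ ^ 2 : ℝ) : ℂ) := fun x => by
    rw [mul_assoc, Complex.mul_conj, Complex.normSq_eq_norm_sq, Complex.ofReal_mul]
  have h3 : ∀ m : L2 Ω, (inner ℂ m m).re = ‖m‖ ^ 2 := fun m =>
    inner_self_eq_norm_sq (𝕜 := ℂ) m
  simp only [h2, integral_complex_ofReal, integral_mul_conj, Complex.add_re, Complex.re_sum,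
    Complex.I_mul_re, Complex.ofReal_im, neg_zero, add_zero, h3] at h1
  rw [inner_add_right, Complex.add_re, h3, h1, add_comm]

lemma IsNeumannImage.eq_zero {u : L2 Ω} (h : IsNeumannImage Ω V u (-u)) : u = 0 := by
  obtain ⟨G, -, hG⟩ := h.exists_energy
  rw [neg_add_cancel, inner_zero_right, Complex.zero_re] at hG
  have h1 : 0 ≤ ∑ i, ‖G i‖ ^ 2 := Finset.sum_nonneg fun i _ => by positivity
  have h2 : ‖u‖ ^ 2 = 0 := le_antisymm (by linarith) (by positivity)
  simpa using h2

lemma IsNeumannImage.sub {u v f g : L2 Ω} (hu : IsNeumannImage Ω V u f)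
    (hv : IsNeumannImage Ω V v g) : IsNeumannImage Ω V (u - v) (f - g) := by
  simpa [sub_eq_add_neg] using hu.add (hv.smul (-1))

/-- `R` is a right inverse of `𝒜^N_{Ω,V} + 1`. -/
def IsResolvent (Ω : Opens (Rd d)) (V : C(Rd d, ℝ)) (R : L2 Ω →L[ℂ] L2 Ω) : Prop :=
  ∀ f, IsNeumannImage Ω V (R f) (f - R f)

/-- The energy identity makes `𝒜 + 1` injective, so its right inverse is also a left inverse. -/
lemma IsResolvent.apply_add {R : L2 Ω →L[ℂ] L2 Ω} (hR : IsResolvent Ω V R) {u g : L2 Ω}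
    (hu : IsNeumannImage Ω V u g) : R (g + u) = u := by
  have h := hu.sub (hR (g + u))
  rw [show g - (g + u - R (g + u)) = -(u - R (g + u)) by abel] at h
  exact (sub_eq_zero.1 h.eq_zero).symm

lemma IsResolvent.isBoundedInverse {R : L2 Ω →L[ℂ] L2 Ω} (hR : IsResolvent Ω V R) :
    IsBoundedInverse (addOne (neumannRealization Ω V)) R := by
  refine ⟨fun u => hR.apply_add u.2.choose_spec, fun f => ⟨⟨R f, _, hR f⟩, rfl, ?_⟩⟩
  have h : ∃ g, IsNeumannImage Ω V (R f) g := ⟨_, hR f⟩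
  change h.choose + R f = f
  rw [h.choose_spec.unique (hR f), sub_add_cancel]

lemma IsResolvent.exists_energy {R : L2 Ω →L[ℂ] L2 Ω} (hR : IsResolvent Ω V R) (f : L2 Ω) :
    ∃ G : Fin d → L2 Ω, HasWeakGradient Ω (R f) G ∧
      ‖R f‖ ^ 2 + ∑ i, ‖G i‖ ^ 2 = (inner ℂ (R f) f).re := by
  simpa using (hR f).exists_energy

/-- The `H¹` bound that feeds the Rellich theorem, read off from the energy identity. -/
lemma IsResolvent.exists_norm_gradient_le {R : L2 Ω →L[ℂ] L2 Ω} (hR : IsResolvent Ω V R)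
    (f : L2 Ω) : ∃ G : Fin d → L2 Ω, HasWeakGradient Ω (R f) G ∧ ∀ i, ‖G i‖ ≤ ‖f‖ := by
  obtain ⟨G, hG, h⟩ := hR.exists_energy f
  refine ⟨G, hG, fun i => ?_⟩
  have h1 : (inner ℂ (R f) f).re ≤ ‖R f‖ * ‖f‖ :=
    (Complex.re_le_norm _).trans (norm_inner_le_norm _ _)
  have h2 : ‖G i‖ ^ 2 ≤ ∑ i, ‖G i‖ ^ 2 :=
    Finset.single_le_sum (f := fun i => ‖G i‖ ^ 2) (fun i _ => by positivity) (Finset.mem_univ i)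
  refine le_of_sq_le_sq ?_ (norm_nonneg _)
  nlinarith [sq_nonneg (‖R f‖ - ‖f‖), sq_nonneg ‖R f‖]

lemma IsResolvent.injective {R : L2 Ω →L[ℂ] L2 Ω} (hR : IsResolvent Ω V R) :
    Function.Injective R := by
  rw [injective_iff_map_eq_zero]
  intro f hf
  have h := hR f
  rw [hf, sub_zero] at h
  exact h.unique IsNeumannImage.zero

lemma IsResolvent.denseRange {R : L2 Ω →L[ℂ] L2 Ω} (hR : IsResolvent Ω V R) : DenseRange R := by
  have h : R.range.topologicalClosure = ⊤ := by
    rw [Submodule.topologicalClosure_eq_top_iff, Submodule.eq_bot_iff]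
    intro g hg
    -- For `g` orthogonal to the range, the energy of `R g` is `Re ⟪R g, g⟫ = 0`.
    have h1 : inner ℂ (R g) g = 0 := (Submodule.mem_orthogonal _ _).1 hg _ ⟨g, rfl⟩
    obtain ⟨G, -, h2⟩ := hR.exists_energy g
    rw [h1, Complex.zero_re] at h2
    have h3 : 0 ≤ ∑ i, ‖G i‖ ^ 2 := Finset.sum_nonneg fun i _ => by positivity
    have h4 : ‖R g‖ ^ 2 = 0 := le_antisymm (by linarith) (by positivity)
    refine hR.injective ?_
    rw [map_zero]
    simpa using h4
  exact Submodule.dense_iff_topologicalClosure_eq_top.2 h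

end Resolvent

/-! ### The multiplier for the linear potential -/

noncomputable section LinearPotential

variable {d : ℕ}

/-- The multiplier `V / (1 + V²)^{1/2}` for the linear potential. -/
def linearMultiplier (hd : 2 ≤ d) (j : ℝ) (x : Rd d) : ℝ :=
  Real.sin (Real.arctan (linearPotential hd j x))

lemma isMultiplier_linearMultiplier (hd : 2 ≤ d) (j : ℝ) :
    IsMultiplier (linearMultiplier hd j) (1 + |j|) := by
  let L : Rd d →L[ℝ] ℝ := j • EuclideanSpace.proj (⟨0, by omega⟩ : Fin d)
  have hL : ∀ x, linearPotential hd j x = L x := fun x => rfl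
  have hdef : linearMultiplier hd j = fun x => Real.sin (Real.arctan (L x)) := rfl
  refine ⟨?_, fun x => ?_, fun i x => ?_⟩
  · rw [hdef]
    exact Real.contDiff_sin.comp (Real.contDiff_arctan.comp L.contDiff)
  · rw [Complex.norm_real]
    exact (Real.abs_sin_le_one _).trans (by linarith [abs_nonneg j])
  · have h1 : HasFDerivAt (linearMultiplier hd j)
        ((Real.cos (Real.arctan (L x)) * (1 / (1 + L x ^ 2))) • L) x := by
      rw [hdef]
      exact ((Real.hasDerivAt_sin _).comp _ (Real.hasDerivAt_arctan (L x))).comp_hasFDerivAt x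
        L.hasFDerivAt
    rw [partialDeriv, h1.fderiv, Complex.norm_real, smul_apply, norm_smul,
      norm_mul]
    have h2 : ‖L (EuclideanSpace.single i 1)‖ ≤ |j| := by
      simp only [L, smul_apply, norm_smul, Real.norm_eq_abs]
      refine mul_le_of_le_one_right (abs_nonneg _) ?_
      change |(EuclideanSpace.single i (1 : ℝ) : Rd d) _| ≤ 1
      rw [PiLp.single_apply]
      split_ifs <;> simp
    have h3 : ‖1 / (1 + L x ^ 2)‖ ≤ 1 := by
      rw [Real.norm_eq_abs, abs_of_nonneg (by positivity), div_le_one (by positivity)]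
      nlinarith [sq_nonneg (L x)]
    have h4 : ‖Real.cos (Real.arctan (L x))‖ ≤ 1 := Real.abs_cos_le_one _
    calc _ ≤ 1 * 1 * |j| := by gcongr
      _ ≤ 1 + |j| := by linarith

/-- The claim is `(|t| - 1) √(1 + t²) ≤ t²` for the value `t` of the potential. It is trivial for
`|t| ≤ 1`, and otherwise follows from `√(1 + t²) ≤ 1 + |t|`. -/
lemma abs_sub_one_le_linearMultiplier_mul (hd : 2 ≤ d) (j : ℝ) (x : Rd d) :
    |linearPotential hd j x| - 1 ≤ linearMultiplier hd j x * linearPotential hd j x := by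
  rw [linearMultiplier, Real.sin_arctan]
  set t := linearPotential hd j x
  have h0 : 0 < √(1 + t ^ 2) := Real.sqrt_pos.2 (by positivity)
  have h1 : √(1 + t ^ 2) ≤ 1 + |t| := by
    rw [Real.sqrt_le_left (by positivity)]
    nlinarith [sq_abs t, abs_nonneg t]
  rw [div_mul_eq_mul_div, le_div_iff₀ h0]
  rcases le_or_gt |t| 1 with h | h
  · nlinarith [sq_nonneg t]
  · nlinarith [sq_abs t]

lemma exists_isResolvent_linearPotential (hd : 2 ≤ d) (j : ℝ) (Ω : Opens (Rd d)) :
    ∃ R, IsResolvent Ω (linearPotential hd j) R :=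
  exists_resolvent (isMultiplier_linearMultiplier hd j) (abs_sub_one_le_linearMultiplier_mul hd j)

end LinearPotential

end ExteriorSchrodinger

namespace ExteriorSchrodinger

/-! ### Difference quotients and weak gradients -/

noncomputable section Translation

variable {d : ℕ} {Ω W : Opens (Rd d)}

/-- A complex test function on `Ω`. -/
def IsComplexTestFunction (Ω : Opens (Rd d)) (ψ : Rd d → ℂ) : Prop :=
  ContDiff ℝ ∞ ψ ∧ HasCompactSupport ψ ∧ tsupport ψ ⊆ (Ω : Set (Rd d))

lemma IsComplexTestFunction.memLp {ψ : Rd d → ℂ} (h : IsComplexTestFunction Ω ψ) :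
    MemLp ψ 2 (volume : Measure (Rd d)) :=
  h.1.continuous.memLp_of_hasCompactSupport h.2.1

lemma IsComplexTestFunction.comp {ψ : Rd d → ℂ} (h : IsComplexTestFunction Ω ψ) (L : ℂ →L[ℝ] ℝ) :
    IsTestFunction Ω fun x => L (ψ x) :=
  ⟨L.contDiff.comp h.1, h.2.1.comp_left (map_zero L),
    (closure_mono (Function.support_comp_subset (map_zero L) ψ)).trans h.2.2⟩

lemma IsTestFunction.complex {φ : Rd d → ℝ} (h : IsTestFunction Ω φ) :
    IsComplexTestFunction Ω fun x => (φ x : ℂ) :=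
  ⟨Complex.ofRealCLM.contDiff.comp h.1, h.2.1.comp_left (g := fun t : ℝ => (t : ℂ)) (by simp),
    (closure_mono (Function.support_comp_subset (g := fun t : ℝ => (t : ℂ)) (by simp) φ)).trans
      h.2.2⟩

lemma coeFn_sum_smul (c : Fin d → ℂ) (G : Fin d → L2 Ω) :
    (∑ i, c i • G i : L2 Ω) =ᵐ[volume.restrict (Ω : Set (Rd d))] fun x => ∑ i, c i * G i x := by
  have h1 := Lp.coeFn_finsetSum (s := Finset.univ) (f := fun i => c i • G i)
  have h2 : ∀ᵐ x ∂(volume.restrict (Ω : Set (Rd d))), ∀ i, (c i • G i : L2 Ω) x = c i * G i x :=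
    ae_all_iff.2 fun i => by
      filter_upwards [Lp.coeFn_smul (c i) (G i)] with x hx
      rw [hx, Pi.smul_apply, smul_eq_mul]
  filter_upwards [h1, h2] with x h1 h2
  rw [h1, Finset.sum_apply]
  exact Finset.sum_congr rfl fun i _ => h2 i

/-- The weak directional derivative. -/
def directional (G : Fin d → L2 Ω) (z : Rd d) : L2 Ω := ∑ i, (z i : ℂ) • G i

lemma integrable_mul_L2 {ψ : Rd d → ℂ} (hc : Continuous ψ) (hs : HasCompactSupport ψ)
    (u : L2 Ω) : Integrable (fun x => ψ x * u x) (volume.restrict (Ω : Set (Rd d))) := by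
  have h1 : MemLp ψ 2 ((volume : Measure (Rd d)).restrict (Ω : Set (Rd d))) :=
    (hc.memLp_of_hasCompactSupport hs).restrict _
  exact memLp_one_iff_integrable.1 ((Lp.memLp u).mul (r := 1) h1)

lemma HasWeakGradient.integral_partial_complex {u : L2 Ω} {G : Fin d → L2 Ω}
    (hu : HasWeakGradient Ω u G) {ψ : Rd d → ℂ} (hψ : IsComplexTestFunction Ω ψ) (i : Fin d) :
    ∫ x in (Ω : Set (Rd d)), fderiv ℝ ψ x (EuclideanSpace.single i 1) * u x
      = - ∫ x in (Ω : Set (Rd d)), ψ x * G i x := by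
  have hre := hψ.comp Complex.reCLM
  have him := hψ.comp Complex.imCLM
  have h1 := hu i _ hre
  have h2 := hu i _ him
  have d1 : ∀ (L : ℂ →L[ℝ] ℝ) x, partialDeriv i (fun x => L (ψ x)) x
      = L (fderiv ℝ ψ x (EuclideanSpace.single i 1)) := fun L x => by
    rw [partialDeriv]
    have h := L.hasFDerivAt.comp x (hψ.1.differentiable (by simp) x).hasFDerivAt
    change fderiv ℝ (L ∘ ψ) x _ = _
    rw [h.fderiv]
    rfl
  have e : ∀ (a : ℂ) (b : ℂ), a * b = Complex.reCLM a • b + Complex.I * (Complex.imCLM a • b) := by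
    intro a b
    simp only [Complex.reCLM_apply, Complex.imCLM_apply, Complex.real_smul]
    conv_lhs => rw [← Complex.re_add_im a]
    ring
  have i1 := integrable_smul_Lp (hre.partialDeriv_continuous i) (hre.partialDeriv_compact i) u
  have i2 := integrable_smul_Lp (him.partialDeriv_continuous i) (him.partialDeriv_compact i) u
  have i3 := integrable_smul_Lp hre.1.continuous hre.2.1 (G i)
  have i4 := integrable_smul_Lp him.1.continuous him.2.1 (G i)
  simp only [d1] at h1 h2 i1 i2
  have e1 : (fun x => fderiv ℝ ψ x (EuclideanSpace.single i 1) * u x) = fun x => _ :=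
    funext fun x => e _ _
  have e2 : (fun x => ψ x * G i x) = fun x => _ := funext fun x => e _ _
  rw [e1, e2, integral_add i1 (i2.const_mul _), integral_add i3 (i4.const_mul _), integral_const_mul,
    integral_const_mul, h1, h2]
  ring

lemma HasWeakGradient.integral_fderiv_complex {u : L2 Ω} {G : Fin d → L2 Ω}
    (hu : HasWeakGradient Ω u G) {ψ : Rd d → ℂ} (hψ : IsComplexTestFunction Ω ψ) (z : Rd d) :
    ∫ x in (Ω : Set (Rd d)), fderiv ℝ ψ x z * u x
      = - ∫ x in (Ω : Set (Rd d)), ψ x * directional G z x := by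
  have hz : z = ∑ i, z i • EuclideanSpace.single i (1 : ℝ) := by
    ext k
    simp [Pi.single_apply]
  have hf : ∀ x, fderiv ℝ ψ x z * u x
      = ∑ i, (z i : ℂ) * (fderiv ℝ ψ x (EuclideanSpace.single i 1) * u x) := fun x => by
    conv_lhs => rw [hz]
    rw [map_sum, Finset.sum_mul]
    refine Finset.sum_congr rfl fun i _ => ?_
    rw [map_smul, Complex.real_smul, mul_assoc]
  have i1 : ∀ i, Integrable (fun x => fderiv ℝ ψ x (EuclideanSpace.single i 1) * u x)
      (volume.restrict (Ω : Set (Rd d))) := fun i =>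
    integrable_mul_L2 ((hψ.1.continuous_fderiv (by simp)).clm_apply continuous_const)
      (hψ.2.1.fderiv_apply (𝕜 := ℝ) _) u
  have hg : ∫ x in (Ω : Set (Rd d)), ψ x * directional G z x
      = ∫ x in (Ω : Set (Rd d)), ∑ i, (z i : ℂ) * (ψ x * G i x) := by
    refine integral_congr_ae ?_
    filter_upwards [coeFn_sum_smul (fun i => (z i : ℂ)) G] with x hx
    rw [directional, hx, Finset.mul_sum]
    exact Finset.sum_congr rfl fun i _ => by ring
  simp only [hf]
  rw [hg, integral_finsetSum _ fun i _ => (i1 i).const_mul _,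
    integral_finsetSum _ fun i _ =>
      (integrable_mul_L2 hψ.1.continuous hψ.2.1 (G i)).const_mul _, ← Finset.sum_neg_distrib]
  refine Finset.sum_congr rfl fun i _ => ?_
  rw [integral_const_mul, integral_const_mul, hu.integral_partial_complex hψ, mul_neg]

/-- The `L²` norm is determined by duality with test functions. -/
lemma norm_le_of_forall_test {D : L2 W} {M : ℝ} (hM : 0 ≤ M)
    (h : ∀ (ψ : Rd d → ℂ) (p : L2 W), IsComplexTestFunction W ψ →
      p =ᵐ[volume.restrict (W : Set (Rd d))] (fun x => conj (ψ x)) →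
      ‖inner ℂ p D‖ ≤ M * ‖p‖) : ‖D‖ ≤ M := by
  let S : Submodule ℂ (L2 W) :=
    { carrier := {p | ∃ ψ, IsComplexTestFunction W ψ ∧
        p =ᵐ[volume.restrict (W : Set (Rd d))] fun x => conj (ψ x)}
      add_mem' := by
        rintro p q ⟨ψ, h1, h2⟩ ⟨χ, h3, h4⟩
        refine ⟨fun x => ψ x + χ x, ⟨h1.1.add h3.1, h1.2.1.add h3.2.1,
          (tsupport_add ψ χ).trans (Set.union_subset h1.2.2 h3.2.2)⟩, ?_⟩
        filter_upwards [h2, h4, Lp.coeFn_add p q] with x h2 h4 h5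
        rw [h5, Pi.add_apply, h2, h4, map_add]
      zero_mem' := by
        refine ⟨0, ⟨contDiff_const, HasCompactSupport.zero, by simp⟩, ?_⟩
        filter_upwards [Lp.coeFn_zero ℂ 2 (volume.restrict (W : Set (Rd d)))] with x hx
        rw [hx]
        simp
      smul_mem' := by
        rintro c p ⟨ψ, h1, h2⟩
        refine ⟨fun x => conj c * ψ x, ⟨contDiff_const.mul h1.1, h1.2.1.mul_left,
          (closure_mono (Function.support_mul_subset_right _ _)).trans h1.2.2⟩, ?_⟩
        filter_upwards [h2, Lp.coeFn_smul c p] with x h2 h5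
        rw [h5, Pi.smul_apply, h2, map_mul, Complex.conj_conj, smul_eq_mul] }
  -- Density of test functions by the fundamental lemma of the calculus of variations. Afterwards
  -- the bound extends to all `p`, in particular to `p = D`.
  have hS : S.topologicalClosure = ⊤ := by
    rw [Submodule.topologicalClosure_eq_top_iff, Submodule.eq_bot_iff]
    intro v hv
    have hloc : LocallyIntegrableOn v (W : Set (Rd d)) volume :=
      locallyIntegrableOn_of_locallyIntegrable_restrict
        ((Lp.memLp v).locallyIntegrable (by norm_num))
    have h0 := W.isOpen.ae_eq_zero_of_integral_contDiff_smul_eq_zero hloc (by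
      intro φ h1 h2 h3
      have hφ : IsTestFunction W φ := ⟨h1, h2, h3⟩
      have hm := (hφ.complex.memLp).restrict (W : Set (Rd d))
      have hp : hm.toLp _ ∈ S := ⟨_, hφ.complex, hm.coeFn_toLp.trans
        (Eventually.of_forall fun x => (Complex.conj_ofReal _).symm)⟩
      have h4 := (Submodule.mem_orthogonal _ _).1 hv _ hp
      have h5 : ∀ x, x ∉ (W : Set (Rd d)) → φ x • v x = 0 := fun x hx => by
        rw [image_eq_zero_of_notMem_tsupport (fun h => hx (h3 h)), zero_smul]
      rw [← setIntegral_eq_integral_of_forall_compl_eq_zero h5, ← h4, inner_L2]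
      refine integral_congr_ae ?_
      filter_upwards [hm.coeFn_toLp] with x hx
      rw [hx, Complex.conj_ofReal, Complex.real_smul, mul_comm])
    apply Lp.ext
    filter_upwards [(ae_restrict_iff' W.isOpen.measurableSet).2 h0,
      Lp.coeFn_zero ℂ 2 (volume.restrict (W : Set (Rd d)))] with x hx h1
    rw [hx, h1, Pi.zero_apply]
  have hD : D ∈ closure (S : Set (L2 W)) := by
    rw [← Submodule.topologicalClosure_coe, hS]
    trivial
  have hcl : IsClosed {p : L2 W | ‖inner ℂ p D‖ ≤ M * ‖p‖} :=
    isClosed_le (continuous_id.inner continuous_const).norm (continuous_const.mul continuous_norm)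
  have h1 : ‖inner ℂ D D‖ ≤ M * ‖D‖ :=
    closure_minimal (fun p (hp : p ∈ S) => h hp.choose p hp.choose_spec.1 hp.choose_spec.2) hcl hD
  rw [inner_self_eq_norm_sq_to_K, norm_pow, RCLike.norm_ofReal, abs_norm] at h1
  by_cases h0 : ‖D‖ = 0
  · rwa [h0]
  · have h2 : 0 < ‖D‖ := lt_of_le_of_ne (norm_nonneg _) (Ne.symm h0)
    nlinarith

lemma IsComplexTestFunction.translate {ψ : Rd d → ℂ} (hψ : IsComplexTestFunction W ψ) {z : Rd d}
    (hz : ∀ x ∈ W, x + z ∈ Ω) : IsComplexTestFunction Ω fun y => ψ (y - z) := by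
  refine ⟨hψ.1.comp (contDiff_id.sub contDiff_const),
    hψ.2.1.comp_homeomorph (Homeomorph.subRight z), ?_⟩
  intro y hy
  have h1 : tsupport (fun y => ψ (y - z)) = (Homeomorph.subRight z) ⁻¹' tsupport ψ :=
    tsupport_comp_eq_preimage ψ (Homeomorph.subRight z)
  rw [h1] at hy
  have h2 := hz _ (hψ.2.2 hy)
  simpa using h2

/-- The derivative of the pairing with translated test functions. -/
lemma HasWeakGradient.hasDerivAt_integral_translate {u : L2 Ω} {G : Fin d → L2 Ω}
    (hu : HasWeakGradient Ω u G) {ψ : Rd d → ℂ} (hψ : IsComplexTestFunction W ψ) (z : Rd d) {t : ℝ}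
    (hz : ∀ x ∈ W, x + t • z ∈ Ω) :
    HasDerivAt (fun t : ℝ => ∫ y in (Ω : Set (Rd d)), ψ (y - t • z) * u y)
      (∫ y in (Ω : Set (Rd d)), ψ (y - t • z) * directional G z y) t := by
  obtain ⟨R, hR⟩ := hψ.2.1.isCompact.isBounded.subset_closedBall (0 : Rd d)
  have hfc := hψ.1.continuous_fderiv (by simp)
  obtain ⟨K, hK⟩ := hfc.bounded_above_of_compact_support (hψ.2.1.fderiv (𝕜 := ℝ))
  have hK0 : 0 ≤ K := (norm_nonneg _).trans (hK 0)
  -- This ball contains the supports of all translates with parameter within `1` of `t`, which gives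
  -- an integrable majorant.
  set B : Set (Rd d) := Metric.closedBall 0 (R + (|t| + 1) * ‖z‖) with hB
  have hval : ∫ y in (Ω : Set (Rd d)), ψ (y - t • z) * directional G z y
      = ∫ y in (Ω : Set (Rd d)), -(fderiv ℝ ψ (y - t • z) z) * u y := by
    have h := hu.integral_fderiv_complex (hψ.translate hz) z
    simp only [fderiv_comp_sub] at h
    simp only [neg_mul, integral_neg, h, neg_neg]
  have hcs : ∀ s : ℝ, HasCompactSupport fun y => ψ (y - s • z) := fun s =>
    hψ.2.1.comp_homeomorph (Homeomorph.subRight (s • z))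
  have hcc : ∀ s : ℝ, Continuous fun y => ψ (y - s • z) := fun s =>
    hψ.1.continuous.comp (continuous_id.sub continuous_const)
  rw [hval]
  refine (hasDerivAt_integral_of_dominated_loc_of_deriv_le
    (F' := fun (s : ℝ) y => -(fderiv ℝ ψ (y - s • z) z) * u y)
    (bound := B.indicator fun y => K * ‖z‖ * ‖u y‖) (Metric.ball_mem_nhds t one_pos)
    (Eventually.of_forall fun s => (integrable_mul_L2 (hcc s) (hcs s) u).aestronglyMeasurable)
    (integrable_mul_L2 (hcc t) (hcs t) u) ?_ ?_ ?_ ?_).2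
  · exact ((hfc.comp (continuous_id.sub continuous_const)).clm_apply
      continuous_const).neg.aestronglyMeasurable.mul (Lp.aestronglyMeasurable u)
  · refine Eventually.of_forall fun y s hs => ?_
    rw [norm_mul, norm_neg]
    by_cases hy : y ∈ B
    · rw [Set.indicator_of_mem hy]
      gcongr
      exact (ContinuousLinearMap.le_opNorm _ _).trans (by gcongr; exact hK _)
    · rw [Set.indicator_of_notMem hy]
      have h0 : fderiv ℝ ψ (y - s • z) = 0 := by
        refine image_eq_zero_of_notMem_tsupport fun h => hy ?_
        have h1 := hR (tsupport_fderiv_subset ℝ h)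
        rw [mem_closedBall_zero_iff] at h1
        rw [hB, mem_closedBall_zero_iff]
        have h2 : |s| ≤ |t| + 1 := by
          have := abs_sub_abs_le_abs_sub s t
          rw [Metric.mem_ball, Real.dist_eq] at hs
          linarith
        calc ‖y‖ = ‖(y - s • z) + s • z‖ := by rw [sub_add_cancel]
          _ ≤ ‖y - s • z‖ + ‖s • z‖ := norm_add_le _ _
          _ ≤ R + (|t| + 1) * ‖z‖ := by
            rw [norm_smul, Real.norm_eq_abs]
            gcongr
      simp [h0]
  · rw [integrable_indicator_iff Metric.isClosed_closedBall.measurableSet, IntegrableOn,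
      Measure.restrict_restrict Metric.isClosed_closedBall.measurableSet]
    have hfin : IsFiniteMeasure ((volume : Measure (Rd d)).restrict (B ∩ (Ω : Set (Rd d)))) :=
      ⟨by
        rw [Measure.restrict_apply_univ]
        exact (measure_mono Set.inter_subset_left).trans_lt measure_closedBall_lt_top⟩
    have h1 : MemLp u 2 ((volume : Measure (Rd d)).restrict (B ∩ (Ω : Set (Rd d)))) :=
      (Lp.memLp u).mono_measure (Measure.restrict_mono Set.inter_subset_right le_rfl)
    exact (h1.integrable (by norm_num)).norm.const_mul _
  · refine Eventually.of_forall fun y s _ => ?_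
    have h1 : HasDerivAt (fun s : ℝ => y - s • z) (-z) s := by
      simpa using ((hasDerivAt_id s).smul_const z).const_sub y
    have h2 := (hψ.1.differentiable (by simp) (y - s • z)).hasFDerivAt.comp_hasDerivAt s h1
    rw [map_neg] at h2
    exact h2.mul_const (u y)

lemma measurePreserving_add_right_restrict (z : Rd d) :
    MeasurePreserving (· + z) ((volume : Measure (Rd d)).restrict ((· + z) ⁻¹' (Ω : Set (Rd d))))
      (volume.restrict (Ω : Set (Rd d))) :=
  (measurePreserving_add_right volume z).restrict_preimage Ω.isOpen.measurableSet

lemma memLp_comp_add (u : L2 Ω) {z : Rd d} (hz : ∀ x ∈ W, x + z ∈ Ω) :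
    MemLp (fun x => u (x + z)) 2 ((volume : Measure (Rd d)).restrict (W : Set (Rd d))) :=
  ((Lp.memLp u).comp_measurePreserving (measurePreserving_add_right_restrict z)).mono_measure
    (Measure.restrict_mono (fun x hx => hz x hx) le_rfl)

lemma memLp_translate_sub (u : L2 Ω) {z : Rd d} (hW : W ≤ Ω) (hz : ∀ x ∈ W, x + z ∈ Ω) :
    MemLp (fun x => u (x + z) - u x) 2 ((volume : Measure (Rd d)).restrict (W : Set (Rd d))) :=
  (memLp_comp_add u hz).sub ((Lp.memLp u).mono_measure (Measure.restrict_mono hW le_rfl))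

lemma setIntegral_translate {ψ : Rd d → ℂ} (hψ : IsComplexTestFunction W ψ) (u : L2 Ω) {z : Rd d}
    (hz : ∀ x ∈ W, x + z ∈ Ω) : ∫ y in (Ω : Set (Rd d)), ψ (y - z) * u y
      = ∫ x in (W : Set (Rd d)), ψ x * u (x + z) := by
  have h1 := (measurePreserving_add_right_restrict (Ω := Ω) z).integral_comp
    (measurableEmbedding_addRight z) fun y => ψ (y - z) * u y
  rw [← h1]
  simp only [add_sub_cancel_right]
  have h0 : ∀ x ∈ (· + z) ⁻¹' (Ω : Set (Rd d)) \ (W : Set (Rd d)), ψ x * u (x + z) = 0 := by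
    intro x hx
    rw [image_eq_zero_of_notMem_tsupport (fun h => hx.2 (hψ.2.2 h)), zero_mul]
  exact setIntegral_eq_of_subset_of_forall_sdiff_eq_zero
    ((measurable_id.add_const z) Ω.isOpen.measurableSet) (fun x hx => hz x hx) h0

/-- Difference quotients are bounded by the weak gradient. -/
theorem HasWeakGradient.norm_translate_sub_le {u : L2 Ω} {G : Fin d → L2 Ω}
    (hu : HasWeakGradient Ω u G) {z : Rd d}
    (hz : ∀ x ∈ W, ∀ s ∈ Set.Icc (0 : ℝ) 1, x + s • z ∈ Ω) {D : L2 W}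
    (hD : D =ᵐ[volume.restrict (W : Set (Rd d))] fun x => u (x + z) - u x) :
    ‖D‖ ≤ ‖directional G z‖ := by
  -- By duality the shift is moved to the smooth `ψ`, and the mean value inequality is applied to `F
  -- t = ∫ ψ(y - t z) u(y) dy`. The segment condition `hz` keeps the translated supports inside `Ω`.
  refine norm_le_of_forall_test (norm_nonneg _) fun ψ p hψ hp => ?_
  have h1z : ∀ x ∈ W, x + z ∈ Ω := fun x hx => by simpa using hz x hx 1 ⟨zero_le_one, le_rfl⟩
  have h0z : ∀ x ∈ W, x + (0 : Rd d) ∈ Ω := fun x hx => by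
    simpa using hz x hx 0 ⟨le_rfl, zero_le_one⟩
  let F : ℝ → ℂ := fun t => ∫ y in (Ω : Set (Rd d)), ψ (y - t • z) * u y
  have hF : ∀ t ∈ Set.Icc (0 : ℝ) 1, HasDerivWithinAt F
      (∫ y in (Ω : Set (Rd d)), ψ (y - t • z) * directional G z y) (Set.Icc 0 1) t :=
    fun t ht => (hu.hasDerivAt_integral_translate hψ z fun x hx => hz x hx t ht).hasDerivWithinAt
  have hb : ∀ t ∈ Set.Ico (0 : ℝ) 1,
      ‖∫ y in (Ω : Set (Rd d)), ψ (y - t • z) * directional G z y‖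
        ≤ ‖directional G z‖ * ‖p‖ := by
    intro t ht
    have hψt := hψ.translate (Ω := Ω) fun x hx => hz x hx t ⟨ht.1, ht.2.le⟩
    have hm : MemLp (fun y => conj (ψ (y - t • z))) 2
        ((volume : Measure (Rd d)).restrict (Ω : Set (Rd d))) := hψt.memLp.star.restrict _
    have hn : ‖hm.toLp _‖ ≤ ‖p‖ := by
      rw [Lp.norm_toLp, Lp.norm_def]
      refine ENNReal.toReal_mono (Lp.eLpNorm_ne_top p) ?_
      rw [eLpNorm_congr_ae hp]
      refine (eLpNorm_mono_measure _ Measure.restrict_le_self).trans ?_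
      have h2 := eLpNorm_comp_measurePreserving (p := 2) (g := fun y => conj (ψ y))
        hψ.memLp.star.aestronglyMeasurable (measurePreserving_sub_right volume (t • z))
      have h3 : eLpNorm (fun y => conj (ψ (y - t • z))) 2 (volume : Measure (Rd d))
          = eLpNorm (fun y => conj (ψ y)) 2 volume := h2
      rw [h3]
      refine (eLpNorm_restrict_eq_of_support_subset (s := (W : Set (Rd d))) ?_).symm.le
      intro x hx
      refine hψ.2.2 (subset_tsupport _ fun h => hx ?_)
      simp [h]
    have he : ∫ y in (Ω : Set (Rd d)), ψ (y - t • z) * directional G z y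
        = inner ℂ (hm.toLp _) (directional G z) := by
      rw [inner_L2]
      refine integral_congr_ae ?_
      filter_upwards [hm.coeFn_toLp] with x hx
      rw [hx, Complex.conj_conj, mul_comm]
    rw [he, mul_comm]
    exact (norm_inner_le_norm _ _).trans (by gcongr)
  have hkey := norm_image_sub_le_of_norm_deriv_le_segment_01' hF hb
  have h5 : inner ℂ p D = F 1 - F 0 := by
    have e0 : F 0 = ∫ x in (W : Set (Rd d)), ψ x * u x := by
      have := setIntegral_translate hψ u h0z
      simpa [F] using this
    have e1 : F 1 = ∫ x in (W : Set (Rd d)), ψ x * u (x + z) := by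
      have := setIntegral_translate hψ u h1z
      simpa [F] using this
    have hW : W ≤ Ω := fun x hx => by simpa using h0z x hx
    have hψm : MemLp ψ 2 ((volume : Measure (Rd d)).restrict (W : Set (Rd d))) :=
      hψ.memLp.restrict _
    have i1 : Integrable (fun x => ψ x * u (x + z)) (volume.restrict (W : Set (Rd d))) :=
      memLp_one_iff_integrable.1 ((memLp_comp_add u h1z).mul (r := 1) hψm)
    have i2 : Integrable (fun x => ψ x * u x) (volume.restrict (W : Set (Rd d))) :=
      memLp_one_iff_integrable.1
        (((Lp.memLp u).mono_measure (Measure.restrict_mono hW le_rfl)).mul (r := 1) hψm)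
    rw [e0, e1, ← integral_sub i1 i2, inner_L2]
    refine integral_congr_ae ?_
    filter_upwards [hp, hD] with x h6 h7
    rw [h6, h7, Complex.conj_conj]
    ring
  rw [h5]
  exact hkey

end Translation

end ExteriorSchrodinger

namespace ExteriorSchrodinger

/-! ### Translations and quasinilpotence of the resolvent -/

noncomputable section TranslationOperator

variable {d : ℕ}

lemma measurePreserving_add_right_top (z : Rd d) :
    MeasurePreserving (· + z) ((volume : Measure (Rd d)).restrict ((⊤ : Opens (Rd d)) : Set (Rd d)))
      (volume.restrict ((⊤ : Opens (Rd d)) : Set (Rd d))) := by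
  rw [Opens.coe_top, Measure.restrict_univ]
  exact measurePreserving_add_right volume z

/-- Translation by `z` in `L²(ℝ^d)`. -/
def translateL2 (z : Rd d) : L2 (⊤ : Opens (Rd d)) →L[ℂ] L2 (⊤ : Opens (Rd d)) :=
  (Lp.compMeasurePreservingₗᵢ ℂ (· + z) (measurePreserving_add_right_top z)).toContinuousLinearMap

lemma norm_translateL2 (z : Rd d) (u : L2 (⊤ : Opens (Rd d))) : ‖translateL2 z u‖ = ‖u‖ :=
  LinearIsometry.norm_map _ u

lemma coeFn_translateL2 (z : Rd d) (u : L2 (⊤ : Opens (Rd d))) :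
    translateL2 z u =ᵐ[volume.restrict ((⊤ : Opens (Rd d)) : Set (Rd d))] fun x => u (x + z) :=
  Lp.coeFn_compMeasurePreserving u (measurePreserving_add_right_top z)

lemma translateL2_neg_apply (z : Rd d) (u : L2 (⊤ : Opens (Rd d))) :
    translateL2 z (translateL2 (-z) u) = u := by
  refine Lp.ext ?_
  filter_upwards [coeFn_translateL2 z (translateL2 (-z) u),
    (measurePreserving_add_right_top z).quasiMeasurePreserving.ae (coeFn_translateL2 (-z) u)]
    with x h1 h2
  rw [h1, h2, add_neg_cancel_right]

lemma translateL2_mul_neg (z : Rd d) : translateL2 z * translateL2 (-z) = 1 :=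
  ContinuousLinearMap.ext fun u => translateL2_neg_apply z u

lemma integral_translate_top (z : Rd d) (f : Rd d → ℂ) :
    ∫ x in ((⊤ : Opens (Rd d)) : Set (Rd d)), f (x + z)
      = ∫ x in ((⊤ : Opens (Rd d)) : Set (Rd d)), f x :=
  (measurePreserving_add_right_top z).integral_comp (measurableEmbedding_addRight z) f

lemma inner_translateL2 (z : Rd d) (u v : L2 (⊤ : Opens (Rd d))) :
    inner ℂ v (translateL2 z u) = inner ℂ (translateL2 (-z) v) u := by
  conv_lhs => rw [← translateL2_neg_apply z v]
  exact LinearIsometry.inner_map_map (𝕜 := ℂ) (E := L2 (⊤ : Opens (Rd d)))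
    (E' := L2 (⊤ : Opens (Rd d))) (Lp.compMeasurePreservingₗᵢ ℂ (· + z) (measurePreserving_add_right_top z)) _ _

lemma HasWeakGradient.translate {u : L2 (⊤ : Opens (Rd d))} {G : Fin d → L2 (⊤ : Opens (Rd d))}
    (hu : HasWeakGradient ⊤ u G) (z : Rd d) :
    HasWeakGradient ⊤ (translateL2 z u) fun i => translateL2 z (G i) := by
  intro i φ hφ
  have hφz : IsTestFunction (⊤ : Opens (Rd d)) fun y => φ (y - z) :=
    ⟨hφ.1.comp (contDiff_id.sub contDiff_const),
      hφ.2.1.comp_homeomorph (Homeomorph.subRight z), fun _ _ => trivial⟩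
  have e : ∀ (ψ : Rd d → ℝ) (v : L2 (⊤ : Opens (Rd d))),
      ∫ x in ((⊤ : Opens (Rd d)) : Set (Rd d)), ψ x • translateL2 z v x
        = ∫ x in ((⊤ : Opens (Rd d)) : Set (Rd d)), ψ (x - z) • v x := by
    intro ψ v
    refine Eq.trans (integral_congr_ae ?_) (integral_translate_top z fun x => ψ (x - z) • v x)
    filter_upwards [coeFn_translateL2 z v] with x hx
    rw [hx, add_sub_cancel_right]
  rw [e, e, ← hu i _ hφz]
  simp only [partialDeriv, fderiv_comp_sub]

lemma HasFinitePotential.translate {V : C(Rd d, ℝ)} {u : L2 (⊤ : Opens (Rd d))}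
    (hu : HasFinitePotential ⊤ V u) {z : Rd d} {c : ℝ} (hV : ∀ x, V (x + z) = V x + c) :
    HasFinitePotential ⊤ V (translateL2 z u) := by
  have h1 := (MemLp.comp_measurePreserving hu (measurePreserving_add_right_top z)).norm
  have h2 := ((Lp.memLp (translateL2 z u)).norm).const_mul √|c|
  refine (h1.add h2).mono ?_ ?_
  · exact (V.continuous.abs.sqrt.aestronglyMeasurable).smul (Lp.aestronglyMeasurable _)
  · filter_upwards [coeFn_translateL2 z u] with x hx
    have h3 : √|V x| ≤ √|V (x + z)| + √|c| := by
      have h4 : |V x| ≤ |V (x + z)| + |c| := by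
        have := abs_sub (V (x + z)) c
        rwa [hV, add_sub_cancel_right, ← hV] at this
      rw [Real.sqrt_le_left (by positivity), add_sq, Real.sq_sqrt (abs_nonneg _),
        Real.sq_sqrt (abs_nonneg _)]
      have : 0 ≤ 2 * √|V (x + z)| * √|c| := by positivity
      linarith
    simp only [Pi.add_apply, Function.comp_apply, norm_smul, Real.norm_eq_abs,
      abs_of_nonneg (Real.sqrt_nonneg _), hx]
    refine le_trans ?_ (le_abs_self _)
    rw [← add_mul]
    gcongr

/-- The Schrödinger operator is covariant with respect to translations. -/
lemma IsNeumannImage.translate {V : C(Rd d, ℝ)} {u g : L2 (⊤ : Opens (Rd d))}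
    (h : IsNeumannImage ⊤ V u g) {z : Rd d} {c : ℝ} (hV : ∀ x, V (x + z) = V x + c) :
    IsNeumannImage ⊤ V (translateL2 z u)
      (translateL2 z g - (Complex.I * c) • translateL2 z u) := by
  obtain ⟨hu, G, hG, h⟩ := h
  refine ⟨hu.translate hV, _, hG.translate z, fun v H hH hv => ?_⟩
  have hV' : ∀ x, V (x + -z) = V x + -c := fun x => by
    have := hV (x + -z)
    rw [neg_add_cancel_right] at this
    linarith
  have h1 := h _ _ (hH.translate (-z)) (hv.translate hV')
  have e : ∫ x in ((⊤ : Opens (Rd d)) : Set (Rd d)), (V x : ℂ) * translateL2 z u x * conj (v x)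
      = (∫ x in ((⊤ : Opens (Rd d)) : Set (Rd d)),
          (V x : ℂ) * u x * conj (translateL2 (-z) v x))
        - c * inner ℂ (translateL2 (-z) v) u := by
    rw [inner_L2, ← integral_const_mul,
      ← integral_sub (integrable_potential hu (hv.translate hV'))
        ((integrable_mul_conj_L2 _ _).const_mul _)]
    refine Eq.trans (integral_congr_ae ?_) (integral_translate_top z fun x =>
      (V x : ℂ) * u x * conj (translateL2 (-z) v x)
        - c * (u x * conj (translateL2 (-z) v x)))
    filter_upwards [coeFn_translateL2 z u,
      (measurePreserving_add_right_top z).quasiMeasurePreserving.ae (coeFn_translateL2 (-z) v)]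
      with x h2 h3
    rw [h2, h3, add_neg_cancel_right, hV]
    push_cast
    ring
  rw [e]
  simp only [integral_mul_conj] at h1 ⊢
  simp only [inner_sub_right, inner_smul_right, inner_translateL2]
  linear_combination h1

/-- The resolvent form of `U 𝒜 U⁻¹ = 𝒜 + i c`, free of unbounded operators. -/
lemma IsResolvent.mul_translate_sub {V : C(Rd d, ℝ)}
    {A : L2 (⊤ : Opens (Rd d)) →L[ℂ] L2 (⊤ : Opens (Rd d))} (hA : IsResolvent ⊤ V A)
    {z : Rd d} {c : ℝ} (hV : ∀ x, V (x + z) = V x + c) :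
    translateL2 z * A - A * translateL2 z
      = -((Complex.I * c) • (A * translateL2 z * A)) := by
  ext1 f
  have h := hA.apply_add ((hA f).translate hV)
  rw [map_sub, sub_right_comm, sub_add_cancel, map_sub, map_smul] at h
  change translateL2 z (A f) - A (translateL2 z f)
    = -((Complex.I * c) • A (translateL2 z (A f)))
  rw [sub_eq_iff_eq_add, ← sub_eq_neg_add]
  exact h.symm

/-- Expand `‖U u - u‖² = 2 ‖u‖² - 2 Re ⟪u, U u⟫` and bound the left side by the directional
derivative. -/
lemma le_re_inner_translateL2 {u : L2 (⊤ : Opens (Rd d))} {G : Fin d → L2 (⊤ : Opens (Rd d))}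
    (hG : HasWeakGradient ⊤ u G) (z : Rd d) :
    ‖u‖ ^ 2 - ‖directional G z‖ ^ 2 / 2 ≤ (inner ℂ u (translateL2 z u)).re := by
  have h1 : ‖translateL2 z u - u‖ ≤ ‖directional G z‖ := by
    refine hG.norm_translate_sub_le (fun _ _ _ _ => trivial) ?_
    filter_upwards [coeFn_translateL2 z u, Lp.coeFn_sub (translateL2 z u) u] with x h1 h2
    rw [h2, Pi.sub_apply, h1]
  have h2 := norm_sub_sq (𝕜 := ℂ) (translateL2 z u) u
  rw [norm_translateL2, inner_re_symm, RCLike.re_eq_complex_re] at h2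
  have h3 := pow_le_pow_left₀ (norm_nonneg _) h1 2
  linarith

/-- The resolvent of the Schrödinger operator with a linear potential is quasinilpotent. -/
theorem IsResolvent.spectrum_subset {hd : 2 ≤ d} {j : ℝ} (hj : j ≠ 0)
    {A : L2 (⊤ : Opens (Rd d)) →L[ℂ] L2 (⊤ : Opens (Rd d))}
    (hA : IsResolvent ⊤ (linearPotential hd j) A) : spectrum ℂ A ⊆ {0} := by
  have hb : ∀ b : ℝ, 0 < b → spectrum ℂ A ⊆ Metric.closedBall 0 (1 / (1 + b)) := by
    intro b hb
    set k : Fin d := ⟨0, by omega⟩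
    -- With `b h² = 1` the error of the two translations is `‖∂ₖu‖² / 2`, which the gradient term of
    -- the energy absorbs.
    set h : ℝ := √(1 / b) with hh
    have hpos : 0 < h := Real.sqrt_pos.2 (by positivity)
    have hsq : b * h ^ 2 = 1 := by
      rw [hh, Real.sq_sqrt (by positivity)]
      field_simp
    set z : Rd d := EuclideanSpace.single k h with hz
    have hV : ∀ x, linearPotential hd j (x + z) = linearPotential hd j x + j * h := fun x => by
      change j * (x k + z k) = j * x k + j * h
      simp [hz, mul_add]
    have hV' : ∀ x, linearPotential hd j (x + -z) = linearPotential hd j x + (-(j * h)) :=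
      fun x => by
        change j * (x k + -z k) = j * x k + -(j * h)
        simp [hz, mul_add]
    have h1 := hA.mul_translate_sub hV
    have h2 := hA.mul_translate_sub hV'
    refine spectrum_subset_closedBall_of_shift (U := translateL2 z) (V := translateL2 (-z))
      (a := Complex.I * ((j * h : ℝ) : ℂ)) ?_ hb (translateL2_mul_neg z) ?_ h1 ?_ fun f => ?_
    · exact mul_ne_zero Complex.I_ne_zero (Complex.ofReal_ne_zero.2 (mul_ne_zero hj hpos.ne'))
    · simpa using translateL2_mul_neg (-z)
    · rw [h2]
      push_cast
      rw [mul_neg, neg_smul, neg_neg]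
    · obtain ⟨G, hG, hE⟩ := hA.exists_energy f
      have hdir : ∀ (y : Rd d) (s : ℝ), |s| = h → (y = EuclideanSpace.single k s) →
          ‖directional G y‖ ^ 2 = h ^ 2 * ‖G k‖ ^ 2 := by
        intro y s hs hy
        have : directional G y = (s : ℂ) • G k := by
          rw [directional, Finset.sum_eq_single k]
          · simp [hy]
          · intro i _ hi
            simp [hy, hi]
          · simp
        rw [this, norm_smul, Complex.norm_real, Real.norm_eq_abs, hs, mul_pow]
      have h3 := le_re_inner_translateL2 hG z
      have h4 := le_re_inner_translateL2 hG (-z)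
      rw [hdir z h (abs_of_pos hpos) rfl] at h3
      rw [hdir (-z) (-h) (by rw [abs_neg, abs_of_pos hpos]) (by
        ext i
        by_cases hi : i = k <;> simp [hz, hi])] at h4
      have h5 : ‖G k‖ ^ 2 ≤ ∑ i, ‖G i‖ ^ 2 :=
        Finset.single_le_sum (f := fun i => ‖G i‖ ^ 2) (fun i _ => by positivity)
          (Finset.mem_univ k)
      rw [inner_add_right, inner_smul_right, inner_add_right, Complex.add_re,
        Complex.re_ofReal_mul, Complex.add_re, ← hE]
      have h6 : 0 ≤ ‖G k‖ ^ 2 := by positivity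
      have h7 : b / 2 * (‖A f‖ ^ 2 - h ^ 2 * ‖G k‖ ^ 2 / 2
          + (‖A f‖ ^ 2 - h ^ 2 * ‖G k‖ ^ 2 / 2)) = b * ‖A f‖ ^ 2 - ‖G k‖ ^ 2 / 2 := by
        linear_combination (-(‖G k‖ ^ 2) / 2) * hsq
      have h8 := mul_le_mul_of_nonneg_left (add_le_add h3 h4) (by positivity : 0 ≤ b / 2)
      rw [h7] at h8
      linarith
  intro μ hμ
  rw [Set.mem_singleton_iff]
  by_contra h0
  have hpos : 0 < ‖μ‖ := norm_pos_iff.2 h0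
  -- For this `b` the radius is `‖μ‖ / (‖μ‖ + 1)`, smaller than `‖μ‖`.
  have h1 := hb (1 / ‖μ‖) (by positivity) hμ
  rw [mem_closedBall_zero_iff, le_div_iff₀ (by positivity), mul_add,
    mul_one_div_cancel hpos.ne'] at h1
  linarith

end TranslationOperator

end ExteriorSchrodinger

namespace ExteriorSchrodinger

/-! ### Local Rellich theorem by averaging over shifts -/

noncomputable section LocalCompactness

variable {d : ℕ} {Ω W : Opens (Rd d)}

lemma lintegral_enorm_sq {α : Type*} [MeasurableSpace α] {μ : Measure α} (f : α → ℂ) :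
    ∫⁻ x, ‖f x‖ₑ ^ 2 ∂μ = eLpNorm f 2 μ ^ 2 := by
  have h := eLpNorm_nnreal_pow_eq_lintegral (f := f) (μ := μ) (p := 2) two_ne_zero
  simpa using h.symm

/-- Jensen's inequality for the square of the norm. -/
lemma enorm_integral_sq_le {α : Type*} [MeasurableSpace α] {μ : Measure α} [IsProbabilityMeasure μ]
    {f : α → ℂ} (hf : AEStronglyMeasurable f μ) :
    ‖∫ x, f x ∂μ‖ₑ ^ 2 ≤ ∫⁻ x, ‖f x‖ₑ ^ 2 ∂μ := by
  rw [lintegral_enorm_sq]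
  gcongr
  calc ‖∫ x, f x ∂μ‖ₑ ≤ ∫⁻ x, ‖f x‖ₑ ∂μ := enorm_integral_le_lintegral_enorm f
    _ = eLpNorm f 1 μ := eLpNorm_one_eq_lintegral_enorm.symm
    _ ≤ eLpNorm f 2 μ := eLpNorm_le_eLpNorm_of_exponent_le (by norm_num) hf

/-- The set `Z` consists of shifts which move `W` within `Ω`. -/
structure IsShiftSet (Ω W : Opens (Rd d)) (Z : Set (Rd d)) : Prop where
  measurableSet : MeasurableSet Z
  ne_zero : volume Z ≠ 0
  ne_top : volume Z ≠ ⊤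
  segment_mem : ∀ x ∈ W, ∀ z ∈ Z, ∀ s ∈ Set.Icc (0 : ℝ) 1, x + s • z ∈ Ω

variable {Z : Set (Rd d)}

lemma IsShiftSet.add_mem (hZ : IsShiftSet Ω W Z) {x z : Rd d} (hx : x ∈ W) (hz : z ∈ Z) :
    x + z ∈ Ω := by
  simpa using hZ.segment_mem x hx z hz 1 ⟨zero_le_one, le_rfl⟩

lemma IsShiftSet.isProbabilityMeasure (hZ : IsShiftSet Ω W Z) :
    IsProbabilityMeasure (ProbabilityTheory.cond (volume : Measure (Rd d)) Z) :=
  ProbabilityTheory.cond_isProbabilityMeasure_of_finite hZ.ne_zero hZ.ne_top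

lemma IsShiftSet.memLp (hZ : IsShiftSet Ω W Z) (u : L2 Ω) {x : Rd d} (hx : x ∈ W) :
    MemLp (fun z => u (x + z)) 2 (ProbabilityTheory.cond (volume : Measure (Rd d)) Z) := by
  have h1 : MemLp (fun z => u (x + z)) 2
      ((volume : Measure (Rd d)).restrict ((x + ·) ⁻¹' (Ω : Set (Rd d)))) :=
    (Lp.memLp u).comp_measurePreserving
      ((measurePreserving_add_left volume x).restrict_preimage Ω.isOpen.measurableSet)
  exact (h1.mono_measure (Measure.restrict_mono (fun z hz => hZ.add_mem hx hz) le_rfl)).smul_measure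
    (ENNReal.inv_ne_top.2 hZ.ne_zero)

/-- Averages over shifts are bounded functionals. -/
lemma IsShiftSet.exists_inner (hZ : IsShiftSet Ω W Z) : ∃ C : ℝ, ∀ x ∈ W, ∃ p : L2 Ω, ‖p‖ ≤ C ∧
    ∀ u : L2 Ω, ∫ z, u (x + z) ∂(ProbabilityTheory.cond volume Z) = inner ℂ p u := by
  set m : ℝ := ((volume Z)⁻¹).toReal with hm
  refine ⟨m * (volume Z).toReal ^ (1 / (2 : ENNReal).toReal), fun x hx => ?_⟩
  -- This is `x + Z`. Its normalized indicator represents the average at `x`, with a norm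
  -- independent of `x`.
  set s : Set (Rd d) := (-x + ·) ⁻¹' Z with hs
  have hsm : MeasurableSet s := (measurable_const_add (-x)) hZ.measurableSet
  have hpre : (x + ·) ⁻¹' s = Z := by
    ext z
    simp [hs]
  have hsΩ : s ⊆ (Ω : Set (Rd d)) := fun y hy => by
    have := hZ.add_mem hx hy
    rwa [add_neg_cancel_left] at this
  have hvol : volume s = volume Z := by
    rw [← hpre, (measurePreserving_add_left volume x).measure_preimage hsm.nullMeasurableSet]
  have hvol' : (volume : Measure (Rd d)).restrict (Ω : Set (Rd d)) s = volume Z := by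
    rw [Measure.restrict_eq_self _ hsΩ, hvol]
  have hne : (volume : Measure (Rd d)).restrict (Ω : Set (Rd d)) s ≠ ⊤ := hvol' ▸ hZ.ne_top
  refine ⟨(m : ℂ) • indicatorConstLp 2 hsm hne 1, ?_, fun u => ?_⟩
  · rw [norm_smul, Complex.norm_real, Real.norm_eq_abs, abs_of_nonneg ENNReal.toReal_nonneg]
    gcongr
    refine norm_indicatorConstLp_le.trans ?_
    rw [norm_one, one_mul, measureReal_def, hvol']
  · rw [inner_smul_left, Complex.conj_ofReal, L2.inner_indicatorConstLp_one,
      Measure.restrict_restrict hsm, Set.inter_eq_self_of_subset_left hsΩ,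
      ProbabilityTheory.cond, integral_smul_measure]
    have h := (measurePreserving_add_left volume x).setIntegral_preimage_emb
      (measurableEmbedding_addLeft x) u s
    rw [hpre] at h
    rw [h, Complex.real_smul]

/-- The deviation from the average is bounded by the gradient. -/
lemma IsShiftSet.lintegral_sub_average_le (hZ : IsShiftSet Ω W Z) (hW : W ≤ Ω) {u : L2 Ω}
    {G : Fin d → L2 Ω} (hu : HasWeakGradient Ω u G) {M : ℝ}
    (hM : ∀ z ∈ Z, ‖directional G z‖ ≤ M) :
    ∫⁻ x in (W : Set (Rd d)), ‖u x - ∫ z, u (x + z) ∂(ProbabilityTheory.cond volume Z)‖ₑ ^ 2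
      ≤ ENNReal.ofReal M ^ 2 := by
  set ν := ProbabilityTheory.cond (volume : Measure (Rd d)) Z with hν
  have : IsProbabilityMeasure ν := hZ.isProbabilityMeasure
  have hum := (Lp.stronglyMeasurable u).measurable
  -- Jensen's inequality moves the average outside the square, and after Tonelli each single shift
  -- is a difference quotient.
  calc ∫⁻ x in (W : Set (Rd d)), ‖u x - ∫ z, u (x + z) ∂ν‖ₑ ^ 2
      ≤ ∫⁻ x in (W : Set (Rd d)), ∫⁻ z, ‖u (x + z) - u x‖ₑ ^ 2 ∂ν := by
        refine setLIntegral_mono_ae' W.isOpen.measurableSet (Eventually.of_forall fun x hx => ?_)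
        have hi : Integrable (fun z => u (x + z)) ν := (hZ.memLp u hx).integrable (by norm_num)
        have h1 : u x - ∫ z, u (x + z) ∂ν = - ∫ z, (u (x + z) - u x) ∂ν := by
          rw [integral_sub hi (integrable_const _)]
          simp
        rw [h1, enorm_neg]
        exact enorm_integral_sq_le (hi.sub (integrable_const _)).aestronglyMeasurable
    _ = ∫⁻ z, (∫⁻ x in (W : Set (Rd d)), ‖u (x + z) - u x‖ₑ ^ 2) ∂ν :=
        lintegral_lintegral_swap (((hum.comp (measurable_fst.add measurable_snd)).sub
          (hum.comp measurable_fst)).enorm.pow_const 2).aemeasurable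
    _ ≤ ∫⁻ _, ENNReal.ofReal M ^ 2 ∂ν := by
        refine lintegral_mono_ae ?_
        filter_upwards [ProbabilityTheory.ae_cond_mem hZ.measurableSet] with z hz
        have hm := memLp_translate_sub u hW fun x hx => hZ.add_mem hx hz
        have h1 := hu.norm_translate_sub_le (fun x hx s hs => hZ.segment_mem x hx z hz s hs)
          hm.coeFn_toLp
        rw [lintegral_enorm_sq]
        gcongr
        rw [Lp.norm_toLp] at h1
        rw [← ENNReal.ofReal_toReal hm.2.ne]
        exact ENNReal.ofReal_le_ofReal (h1.trans (hM z hz))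
    _ = ENNReal.ofReal M ^ 2 := by simp

lemma norm_directional_le {G : Fin d → L2 Ω} {M : ℝ} (hG : ∀ i, ‖G i‖ ≤ M) (z : Rd d) :
    ‖directional G z‖ ≤ d * (‖z‖ * M) := by
  have h : ∀ i ∈ Finset.univ, ‖(z i : ℂ) • G i‖ ≤ ‖z‖ * M := fun i _ => by
    rw [norm_smul, Complex.norm_real]
    exact mul_le_mul (PiLp.norm_apply_le z i) (hG i) (norm_nonneg _) (norm_nonneg _)
  have h2 := norm_sum_le_of_le Finset.univ h
  simpa [directional] using h2

/-- The set `W` can be moved within `Ω` by arbitrarily small shifts. -/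
def IsShiftable (Ω W : Opens (Rd d)) : Prop :=
  ∀ ε > 0, ∃ Z, IsShiftSet Ω W Z ∧ ∀ z ∈ Z, ‖z‖ ≤ ε

/-- Compactness of the embedding of `H¹(Ω)` in `L²(W)`. -/
lemma IsShiftable.tendsto_lintegral (hWΩ : IsShiftable Ω W) (hW : W ≤ Ω)
    (hfin : volume (W : Set (Rd d)) ≠ ⊤) {u : ℕ → L2 Ω} {M : ℝ} (hu : ∀ n, ‖u n‖ ≤ M)
    (hG : ∀ n, ∃ G : Fin d → L2 Ω, HasWeakGradient Ω (u n) G ∧ ∀ i, ‖G i‖ ≤ M)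
    (hw : IsWeaklyNull u) :
    Tendsto (fun n => ∫⁻ x in (W : Set (Rd d)), ‖u n x‖ₑ ^ 2) atTop (𝓝 0) := by
  have hM : 0 ≤ M := (norm_nonneg _).trans (hu 0)
  rw [ENNReal.tendsto_nhds_zero]
  intro η hη
  -- The shift length is fixed before `n`: the deviation from the average is then small uniformly in
  -- `n`. The factor `2` comes from `(a + b)² ≤ 2 a² + 2 b²`.
  obtain ⟨ε, hε, hεη⟩ : ∃ ε > 0, 2 * ENNReal.ofReal (d * (ε * M)) ^ 2 ≤ η / 2 := by
    have hc : Tendsto (fun ε : ℝ => 2 * ENNReal.ofReal (d * (ε * M)) ^ 2) (𝓝[>] 0) (𝓝 0) := by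
      have h1 : Tendsto (fun ε : ℝ => d * (ε * M)) (𝓝[>] 0) (𝓝 0) := by
        have : Continuous fun ε : ℝ => d * (ε * M) := by fun_prop
        simpa using (this.tendsto 0).mono_left nhdsWithin_le_nhds
      have h2 := ENNReal.Tendsto.const_mul (a := 2)
        (ENNReal.Tendsto.pow (n := 2) (ENNReal.tendsto_ofReal h1)) (Or.inr (by norm_num))
      simpa using h2
    have h3 := (hc.eventually (ge_mem_nhds (ENNReal.half_pos hη.ne'))).and self_mem_nhdsWithin
    obtain ⟨ε, h4, h5⟩ := h3.exists
    exact ⟨ε, h5, h4⟩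
  obtain ⟨Z, hZ, hZε⟩ := hWΩ ε hε
  set ν := ProbabilityTheory.cond (volume : Measure (Rd d)) Z with hν
  have : IsProbabilityMeasure ν := hZ.isProbabilityMeasure
  obtain ⟨C, hC⟩ := hZ.exists_inner
  have hTm : ∀ n, Measurable fun x => ∫ z, u n (x + z) ∂ν := fun n => by
    have h1 : StronglyMeasurable fun q : Rd d × Rd d => u n (q.1 + q.2) :=
      (Lp.stronglyMeasurable (u n)).comp_measurable (measurable_fst.add measurable_snd)
    exact h1.integral_prod_right.measurable
  -- At each `x` the average is a continuous functional of `u n`, so it tends to zero. Its bound is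
  -- uniform in `x` and `W` has finite volume, so dominated convergence applies.
  have hT : Tendsto (fun n => ∫⁻ x in (W : Set (Rd d)), ‖∫ z, u n (x + z) ∂ν‖ₑ ^ 2) atTop
      (𝓝 (∫⁻ _ in (W : Set (Rd d)), 0)) := by
    refine tendsto_lintegral_of_dominated_convergence (fun _ => ENNReal.ofReal (C * M) ^ 2)
      (fun n => (hTm n).enorm.pow_const 2) (fun n => ?_) ?_ ?_
    · refine ae_restrict_of_forall_mem W.isOpen.measurableSet fun x hx => ?_
      obtain ⟨p, hp1, hp2⟩ := hC x hx
      dsimp only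
      rw [hp2, ← ofReal_norm]
      gcongr
      exact (norm_inner_le_norm _ _).trans (mul_le_mul hp1 (hu n) (norm_nonneg _)
        ((norm_nonneg _).trans hp1))
    · rw [setLIntegral_const]
      exact ENNReal.mul_ne_top (by finiteness) hfin
    · refine ae_restrict_of_forall_mem W.isOpen.measurableSet fun x hx => ?_
      obtain ⟨p, -, hp2⟩ := hC x hx
      have h1 := (continuous_enorm.tendsto _).comp (hw p)
      have h2 := ENNReal.Tendsto.pow (n := 2) h1
      simpa [← hp2] using h2
  rw [lintegral_zero] at hT
  have hT2 := ENNReal.Tendsto.const_mul (a := 2) hT (Or.inr (by norm_num))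
  rw [mul_zero] at hT2
  filter_upwards [hT2.eventually (ge_mem_nhds (ENNReal.half_pos hη.ne'))] with n hn
  obtain ⟨G, hG1, hG2⟩ := hG n
  have hdev := hZ.lintegral_sub_average_le hW hG1 (M := d * (ε * M)) fun z hz =>
    (norm_directional_le hG2 z).trans (by gcongr; exact hZε z hz)
  calc ∫⁻ x in (W : Set (Rd d)), ‖u n x‖ₑ ^ 2
      ≤ ∫⁻ x in (W : Set (Rd d)), (2 * ‖u n x - ∫ z, u n (x + z) ∂ν‖ₑ ^ 2
          + 2 * ‖∫ z, u n (x + z) ∂ν‖ₑ ^ 2) := by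
        refine lintegral_mono fun x => ?_
        set t := ∫ z, u n (x + z) ∂ν
        have h1 : ‖u n x‖ ^ 2 ≤ 2 * ‖u n x - t‖ ^ 2 + 2 * ‖t‖ ^ 2 := by
          have h2 : ‖u n x‖ ≤ ‖u n x - t‖ + ‖t‖ := by
            simpa using norm_add_le (u n x - t) t
          have h3 := pow_le_pow_left₀ (norm_nonneg _) h2 2
          nlinarith [sq_nonneg (‖u n x - t‖ - ‖t‖)]
        have h4 := ENNReal.ofReal_le_ofReal h1
        rw [ENNReal.ofReal_add (by positivity) (by positivity), ENNReal.ofReal_mul zero_le_two,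
          ENNReal.ofReal_mul zero_le_two, ENNReal.ofReal_pow (norm_nonneg _),
          ENNReal.ofReal_pow (norm_nonneg _), ENNReal.ofReal_pow (norm_nonneg _), ofReal_norm,
          ofReal_norm, ofReal_norm] at h4
        simpa using h4
    _ = 2 * (∫⁻ x in (W : Set (Rd d)), ‖u n x - ∫ z, u n (x + z) ∂ν‖ₑ ^ 2)
          + 2 * ∫⁻ x in (W : Set (Rd d)), ‖∫ z, u n (x + z) ∂ν‖ₑ ^ 2 := by
        rw [lintegral_add_right _ (((hTm n).enorm.pow_const 2).const_mul 2),
          lintegral_const_mul' _ _ (by norm_num), lintegral_const_mul' _ _ (by norm_num)]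
    _ ≤ 2 * ENNReal.ofReal (d * (ε * M)) ^ 2 + η / 2 := by gcongr
    _ ≤ η / 2 + η / 2 := by gcongr
    _ = η := ENNReal.add_halves η

variable (Ω) in
/-- Every point has a neighbourhood whose part in `Ω` can be moved within `Ω`. -/
def IsLocallyShiftable : Prop :=
  ∀ x, ∃ N : Opens (Rd d), x ∈ N ∧ IsShiftable Ω (N ⊓ Ω)

lemma IsShiftable.mono {W' : Opens (Rd d)} (h : IsShiftable Ω W) (hW : W' ≤ W) :
    IsShiftable Ω W' := fun ε hε => by
  obtain ⟨Z, hZ, hZε⟩ := h ε hε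
  exact ⟨Z, ⟨hZ.1, hZ.2, hZ.3, fun x hx => hZ.4 x (hW hx)⟩, hZε⟩

/-- The Rellich theorem: weakly null bounded sequences in `H¹(Ω)` converge to zero in `L²` of
compact sets. -/
theorem IsLocallyShiftable.tendsto_lintegral (hΩ : IsLocallyShiftable Ω) {u : ℕ → L2 Ω} {M : ℝ}
    (hu : ∀ n, ‖u n‖ ≤ M)
    (hG : ∀ n, ∃ G : Fin d → L2 Ω, HasWeakGradient Ω (u n) G ∧ ∀ i, ‖G i‖ ≤ M)
    (hw : IsWeaklyNull u) {S : Set (Rd d)} (hS : IsCompact S) :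
    Tendsto (fun n => ∫⁻ x in S ∩ (Ω : Set (Rd d)), ‖u n x‖ₑ ^ 2) atTop (𝓝 0) := by
  refine hS.induction_on (p := fun S => Tendsto
    (fun n => ∫⁻ x in S ∩ (Ω : Set (Rd d)), ‖u n x‖ₑ ^ 2) atTop (𝓝 0)) (by simp)
    (fun s t hst ht => ?_) (fun s t hs ht => ?_) fun x hx => ?_
  · exact tendsto_of_tendsto_of_tendsto_of_le_of_le tendsto_const_nhds ht (fun _ => zero_le)
      fun n => lintegral_mono_set (Set.inter_subset_inter_left _ hst)
  · have h := hs.add ht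
    rw [add_zero] at h
    refine tendsto_of_tendsto_of_tendsto_of_le_of_le tendsto_const_nhds h (fun _ => zero_le)
      fun n => ?_
    dsimp only
    rw [Set.union_inter_distrib_right]
    exact lintegral_union_le _ _ _
  · obtain ⟨N, hxN, hN⟩ := hΩ x
    set B : Opens (Rd d) := ⟨Metric.ball x 1, Metric.isOpen_ball⟩
    refine ⟨(N ⊓ B : Opens (Rd d)), mem_nhdsWithin_of_mem_nhds
      ((N ⊓ B).isOpen.mem_nhds ⟨hxN, Metric.mem_ball_self one_pos⟩), ?_⟩
    exact (hN.mono (W' := N ⊓ B ⊓ Ω) (inf_le_inf_right _ inf_le_left)).tendsto_lintegral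
      inf_le_right (ne_top_of_le_ne_top (measure_ball_lt_top (x := x) (r := 1)).ne
        (measure_mono fun y hy => hy.1.2)) hu hG hw

end LocalCompactness

end ExteriorSchrodinger

namespace ExteriorSchrodinger

/-! ### Shifting the exterior domain into itself -/

noncomputable section Geometry

variable {d : ℕ} {Ω W : Opens (Rd d)}

lemma isShiftSet_ball {z : Rd d} {r : ℝ} (hr : 0 < r)
    (h : ∀ x ∈ W, ∀ y ∈ Metric.ball z r, ∀ s ∈ Set.Icc (0 : ℝ) 1, x + s • y ∈ Ω) :
    IsShiftSet Ω W (Metric.ball z r) :=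
  ⟨measurableSet_ball, (Metric.measure_ball_pos _ _ hr).ne', measure_ball_lt_top.ne, h⟩

lemma norm_smul_le_of_mem_Icc {s : ℝ} (hs : s ∈ Set.Icc (0 : ℝ) 1) (z : Rd d) :
    ‖s • z‖ ≤ ‖z‖ := by
  rw [norm_smul, Real.norm_eq_abs, abs_of_nonneg hs.1]
  exact mul_le_of_le_one_left (norm_nonneg z) hs.2

/-- Small balls around points of `Ω` can be moved within `Ω`. -/
lemma exists_isShiftable_of_mem {x : Rd d} (hx : x ∈ Ω) :
    ∃ N : Opens (Rd d), x ∈ N ∧ IsShiftable Ω (N ⊓ Ω) := by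
  obtain ⟨r, hr, hrΩ⟩ := Metric.isOpen_iff.1 Ω.isOpen x hx
  refine ⟨⟨Metric.ball x (r / 2), Metric.isOpen_ball⟩, Metric.mem_ball_self (half_pos hr),
    fun ε hε => ⟨Metric.ball 0 (min ε (r / 2)), isShiftSet_ball (by positivity) ?_, ?_⟩⟩
  · rintro y ⟨hy, -⟩ z hz s hs
    refine hrΩ ?_
    have hz' := lt_min_iff.1 (mem_ball_zero_iff.1 hz)
    have hy' : dist y x < r / 2 := hy
    rw [dist_eq_norm] at hy'
    rw [Metric.mem_ball, dist_eq_norm]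
    calc ‖y + s • z - x‖ = ‖(y - x) + s • z‖ := by congr 1; abel
      _ ≤ ‖y - x‖ + ‖s • z‖ := norm_add_le _ _
      _ < r / 2 + r / 2 := add_lt_add hy' ((norm_smul_le_of_mem_Icc hs z).trans_lt hz'.2)
      _ = r := add_halves r
  · exact fun z hz => (lt_min_iff.1 (mem_ball_zero_iff.1 hz)).1.le

lemma isLocallyShiftable_top : IsLocallyShiftable (⊤ : Opens (Rd d)) :=
  fun _ => exists_isShiftable_of_mem (Opens.mem_top _)

lemma isShiftable_of_eq_bot (h : W = ⊥) : IsShiftable Ω W := fun ε hε =>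
  ⟨Metric.ball 0 ε, isShiftSet_ball hε (by simp [h]), fun _ hz => (mem_ball_zero_iff.1 hz).le⟩

/-- A function with positive derivative in the direction `z` is increasing in that direction. -/
lemma le_apply_add_smul {ρ : Rd d → ℝ} {y z : Rd d} (hd : ∀ s ∈ Set.Icc (0 : ℝ) 1,
    DifferentiableAt ℝ ρ (y + s • z)) (hp : ∀ s ∈ Set.Icc (0 : ℝ) 1, 0 ≤ fderiv ℝ ρ (y + s • z) z)
    {s : ℝ} (hs : s ∈ Set.Icc (0 : ℝ) 1) : ρ y ≤ ρ (y + s • z) := by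
  have hder : ∀ t ∈ Set.Icc (0 : ℝ) 1,
      HasDerivAt (fun t : ℝ => ρ (y + t • z)) (fderiv ℝ ρ (y + t • z) z) t := fun t ht => by
    have h1 : HasDerivAt (fun t : ℝ => y + t • z) z t := by
      simpa using ((hasDerivAt_id t).smul_const z).const_add y
    exact (hd t ht).hasFDerivAt.comp_hasDerivAt t h1
  have hmono : MonotoneOn (fun t : ℝ => ρ (y + t • z)) (Set.Icc 0 1) := by
    refine monotoneOn_of_deriv_nonneg (convex_Icc 0 1)
      (fun t ht => (hder t ht).continuousAt.continuousWithinAt)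
      (fun t ht => (hder t (interior_subset ht)).differentiableAt.differentiableWithinAt)
      fun t ht => ?_
    rw [(hder t (interior_subset ht)).deriv]
    exact hp t (interior_subset ht)
  simpa using hmono ⟨le_rfl, zero_le_one⟩ hs hs.1

/-- Near a smooth boundary point, the exterior can be moved into itself. -/
lemma HasSmoothBoundary.exists_isShiftable {K : Compacts (Rd d)}
    (hK : HasSmoothBoundary (K : Set (Rd d))) {x : Rd d} (hx : x ∈ frontier (K : Set (Rd d))) :
    ∃ N : Opens (Rd d), x ∈ N ∧ IsShiftable (exteriorDomain K) (N ⊓ exteriorDomain K) := by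
  obtain ⟨U, hU, hxU, ρ, hρ, hne, hKU⟩ := hK x hx
  obtain ⟨e, he⟩ : ∃ e, 0 < fderiv ℝ ρ x e := by
    obtain ⟨e, he⟩ : ∃ e, fderiv ℝ ρ x e ≠ 0 := by
      by_contra! h
      exact hne (ContinuousLinearMap.ext h)
    rcases he.lt_or_gt with h | h
    · exact ⟨-e, by simpa using h⟩
    · exact ⟨e, h⟩
  have hdiff : ∀ y ∈ U, DifferentiableAt ℝ ρ y := fun y hy =>
    (hρ.contDiffAt (hU.mem_nhds hy)).differentiableAt (by simp)
  -- Joint continuity keeps the derivative positive for points near `x` and a whole ball of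
  -- directions near `e`. The shift set must have positive volume, so one direction is not enough.
  have hcont : ContinuousAt (fun q : Rd d × Rd d => fderiv ℝ ρ q.1 q.2) (x, e) := by
    have h1 : ContinuousAt (fderiv ℝ ρ) x :=
      (hρ.continuousOn_fderiv_of_isOpen hU (by simp)).continuousAt (hU.mem_nhds hxU)
    exact (ContinuousAt.comp (x := (x, e)) (f := Prod.fst) h1 continuousAt_fst).clm_apply
      continuousAt_snd
  obtain ⟨δ, hδ, hpos⟩ := Metric.eventually_nhds_iff_ball.1
    ((hcont.eventually (lt_mem_nhds he)).and
      ((continuousAt_fst (p := (x, e))).eventually (hU.mem_nhds hxU)))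
  refine ⟨⟨Metric.ball x (δ / 2), Metric.isOpen_ball⟩, Metric.mem_ball_self (half_pos hδ),
    fun ε hε => ?_⟩
  -- The shift set is `τ` times the ball of directions around `e`. The bound `ε` is the demanded
  -- shift length, and `δ / 2` keeps the shifted points in the ball of radius `δ`.
  obtain ⟨τ, hτ, hτε⟩ : ∃ τ > 0, τ * (‖e‖ + δ) ≤ min ε (δ / 2) :=
    ⟨min ε (δ / 2) / (‖e‖ + δ), by positivity, (div_mul_cancel₀ _ (by positivity)).le⟩
  have hnorm : ∀ z ∈ Metric.ball (τ • e) (τ * δ), ‖z‖ ≤ min ε (δ / 2) := fun z hz => by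
    rw [Metric.mem_ball, dist_eq_norm] at hz
    calc ‖z‖ = ‖τ • e + (z - τ • e)‖ := by congr 1; abel
      _ ≤ ‖τ • e‖ + ‖z - τ • e‖ := norm_add_le _ _
      _ ≤ τ * ‖e‖ + τ * δ := by
        rw [norm_smul, Real.norm_of_nonneg hτ.le]
        gcongr
      _ ≤ min ε (δ / 2) := by rwa [← mul_add]
  refine ⟨Metric.ball (τ • e) (τ * δ), isShiftSet_ball (by positivity) ?_,
    fun z hz => (hnorm z hz).trans (min_le_left _ _)⟩
  rintro y ⟨hy, hyK⟩ z hz s hs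
  have hmem : ∀ t ∈ Set.Icc (0 : ℝ) 1, y + t • z ∈ Metric.ball x δ := fun t ht => by
    have hy' : dist y x < δ / 2 := hy
    rw [dist_eq_norm] at hy'
    rw [Metric.mem_ball, dist_eq_norm]
    calc ‖y + t • z - x‖ = ‖(y - x) + t • z‖ := by congr 1; abel
      _ ≤ ‖y - x‖ + ‖t • z‖ := norm_add_le _ _
      _ < δ / 2 + δ / 2 := add_lt_add_of_lt_of_le hy'
        ((norm_smul_le_of_mem_Icc ht z).trans ((hnorm z hz).trans (min_le_right _ _)))
      _ = δ := add_halves δ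
  have hz' : τ⁻¹ • z ∈ Metric.ball e δ := by
    rw [Metric.mem_ball, dist_eq_norm] at hz ⊢
    have h1 : τ⁻¹ • z - e = τ⁻¹ • (z - τ • e) := by
      rw [smul_sub, inv_smul_smul₀ hτ.ne']
    rw [h1, norm_smul, norm_inv, Real.norm_of_nonneg hτ.le, inv_mul_lt_iff₀ hτ]
    exact hz
  have hball : ∀ t ∈ Set.Icc (0 : ℝ) 1,
      0 < fderiv ℝ ρ (y + t • z) (τ⁻¹ • z) ∧ y + t • z ∈ U := fun t ht =>
    hpos (y + t • z, τ⁻¹ • z) (by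
      rw [← ball_prod_same]
      exact ⟨hmem t ht, hz'⟩)
  have h0 := hball 0 ⟨le_rfl, zero_le_one⟩
  rw [zero_smul, add_zero] at h0
  -- A point outside `K` has `ρ > 0`, and `ρ` does not decrease along the shift, so the point stays
  -- outside `K`.
  have hρy : 0 < ρ y := by
    by_contra! h
    have : y ∈ (K : Set (Rd d)) ∩ U := hKU ▸ ⟨h0.2, h⟩
    exact hyK this.1
  have hle := le_apply_add_smul (fun t ht => hdiff _ (hball t ht).2) (fun t ht => by
    have h1 := (hball t ht).1
    rw [map_smul, smul_eq_mul] at h1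
    exact (pos_of_mul_pos_right h1 (inv_nonneg.2 hτ.le)).le) hs
  intro hmK
  have : y + s • z ∈ {y ∈ U | ρ y ≤ 0} := hKU ▸ ⟨hmK, (hball s hs).2⟩
  exact absurd this.2 (not_le.2 (hρy.trans_le hle))

lemma HasSmoothBoundary.isLocallyShiftable {K : Compacts (Rd d)}
    (hK : HasSmoothBoundary (K : Set (Rd d))) : IsLocallyShiftable (exteriorDomain K) := by
  intro x
  by_cases hx : x ∈ exteriorDomain K
  · exact exists_isShiftable_of_mem hx
  have hxK : x ∈ (K : Set (Rd d)) := not_not.1 hx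
  by_cases hxi : x ∈ interior (K : Set (Rd d))
  -- Inside `K` there is nothing to move: the neighbourhood misses the exterior.
  · refine ⟨⟨interior K, isOpen_interior⟩, hxi, isShiftable_of_eq_bot ?_⟩
    ext y
    simp only [Opens.coe_inf, Opens.coe_mk, Opens.coe_bot, Set.mem_inter_iff,
      Set.mem_empty_iff_false, iff_false, not_and]
    exact fun h1 h2 => h2 (interior_subset h1)
  · exact hK.exists_isShiftable ⟨subset_closure hxK, hxi⟩

end Geometry

end ExteriorSchrodinger

namespace ExteriorSchrodinger

/-! ### Comparison of the two resolvents away from the obstacle -/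

noncomputable section Comparison

variable {d : ℕ} {Ω : Opens (Rd d)} {V : C(Rd d, ℝ)}

lemma inner_extendByZero_left (v : L2 Ω) (f : L2 (⊤ : Opens (Rd d))) :
    inner ℂ (extendByZero Ω v) f = inner ℂ v (restrictL2 Ω f) := by
  rw [inner_L2, inner_L2, setIntegral_top, ← integral_indicator Ω.isOpen.measurableSet]
  refine integral_congr_ae ?_
  have h := (ae_restrict_iff' Ω.isOpen.measurableSet).1 (coeFn_restrictL2 (Ω := Ω) f)
  filter_upwards [coeFn_extendByZero v, h] with x h1 h2
  rw [h1]
  by_cases hx : x ∈ (Ω : Set (Rd d))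
  · simp [hx, h2 hx]
  · simp [hx]

lemma HasFinitePotential.restrict {u : L2 (⊤ : Opens (Rd d))}
    (hu : HasFinitePotential ⊤ V u) : HasFinitePotential Ω V (restrictL2 Ω u) := by
  refine (hu.mono_measure (Measure.restrict_mono (Set.subset_univ _) le_rfl)).ae_eq ?_
  filter_upwards [coeFn_restrictL2 (Ω := Ω) u] with x hx
  rw [hx]

lemma HasFinitePotential.extendByZero {v : L2 Ω} (hv : HasFinitePotential Ω V v) :
    HasFinitePotential ⊤ V (extendByZero Ω v) := by
  refine MemLp.ae_eq (f := (Ω : Set (Rd d)).indicator fun x => √|V x| • v x)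
    (ae_restrict_top.2 ?_) ?_
  swap
  · rw [Opens.coe_top, Measure.restrict_univ]
    exact (memLp_indicator_iff_restrict Ω.isOpen.measurableSet).2 hv
  filter_upwards [coeFn_extendByZero v] with x hx
  rw [hx]
  by_cases hxΩ : x ∈ (Ω : Set (Rd d)) <;> simp [hxΩ]

lemma HasFinitePotential.mul {u : L2 Ω} (hu : HasFinitePotential Ω V u) {ζ : Rd d → ℝ} {C : ℝ}
    (h : IsMultiplier ζ C) : HasFinitePotential Ω V (h.mul u) := by
  obtain ⟨w, hw⟩ := hu.exists_isSqrtPotential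
  exact (hw.mul h).hasFinitePotential

lemma integral_potential_extendByZero (u : L2 (⊤ : Opens (Rd d))) (v : L2 Ω) :
    ∫ x in ((⊤ : Opens (Rd d)) : Set (Rd d)), (V x : ℂ) * u x * conj (extendByZero Ω v x)
      = ∫ x in (Ω : Set (Rd d)), (V x : ℂ) * restrictL2 Ω u x * conj (v x) := by
  rw [setIntegral_top, ← integral_indicator Ω.isOpen.measurableSet]
  refine integral_congr_ae ?_
  have h := (ae_restrict_iff' Ω.isOpen.measurableSet).1 (coeFn_restrictL2 (Ω := Ω) u)
  filter_upwards [coeFn_extendByZero v, h] with x h1 h2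
  rw [h1]
  by_cases hx : x ∈ (Ω : Set (Rd d))
  · simp [hx, h2 hx]
  · simp [hx]

/-- The restriction to `Ω` of a function in the domain of the realization in the whole space
satisfies the equation in `Ω`, tested with functions that vanish near the complement of `Ω`. -/
lemma IsNeumannImage.exists_gradient_restrict {u g : L2 (⊤ : Opens (Rd d))}
    (hu : IsNeumannImage ⊤ V u g) {ζ : Rd d → ℝ} {C : ℝ} (h : IsMultiplier ζ C)
    (hs : tsupport ζ ⊆ (Ω : Set (Rd d))) :
    ∃ G : Fin d → L2 Ω, HasWeakGradient Ω (restrictL2 Ω u) G ∧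
      ∀ (v : L2 Ω) (H : Fin d → L2 Ω), HasWeakGradient Ω v H → HasFinitePotential Ω V v →
        (∑ i, inner ℂ (h.mul (H i) + h.mulDeriv i v) (G i))
          + Complex.I * (∫ x in (Ω : Set (Rd d)),
              (V x : ℂ) * restrictL2 Ω u x * conj (h.mul v x))
        = inner ℂ (h.mul v) (restrictL2 Ω g) := by
  obtain ⟨-, G, hG, hu⟩ := hu
  refine ⟨fun i => restrictL2 Ω (G i), hG.restrict, fun v H hH hv => ?_⟩
  -- Since `ζ` vanishes near the complement of `Ω`, `ζ v` extended by zero is admissible in the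
  -- whole space.
  have key := hu _ _ (hH.extendByZero_mul h hs) (hv.mul h).extendByZero
  simpa only [← inner_L2, inner_extendByZero_left, integral_potential_extendByZero] using key

lemma IsMultiplier.mulDeriv_mul_comm {ζ : Rd d → ℝ} {C : ℝ} (h : IsMultiplier ζ C) (i : Fin d)
    (u : L2 Ω) : h.mulDeriv i (h.mul u) = h.mul (h.mulDeriv i u) := by
  refine Lp.ext ?_
  filter_upwards [coeFn_mulL2 h.measurable h.norm_le u,
    coeFn_mulL2 h.measurable h.norm_le (h.mulDeriv i u),
    coeFn_mulL2 (h.measurable_partialDeriv i) (h.norm_partialDeriv_le i) u,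
    coeFn_mulL2 (h.measurable_partialDeriv i) (h.norm_partialDeriv_le i) (h.mul u)]
    with x h1 h2 h3 h4
  refine h4.trans ?_
  rw [show h.mul u x = _ from h1, show h.mul (h.mulDeriv i u) x = _ from h2,
    show h.mulDeriv i u x = _ from h3]
  ring

/-- The Caccioppoli inequality for the difference of two resolvents. -/
lemma IsNeumannImage.norm_mul_sub_sq_le {u f : L2 (⊤ : Opens (Rd d))} {w : L2 Ω}
    (hu : IsNeumannImage ⊤ V u (f - u))
    (hw : IsNeumannImage Ω V w (restrictL2 Ω f - w)) {ζ : Rd d → ℝ} {C : ℝ}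
    (h : IsMultiplier ζ C) (hs : tsupport ζ ⊆ (Ω : Set (Rd d))) :
    ‖h.mul (restrictL2 Ω u - w)‖ ^ 2 ≤ ∑ i, ‖h.mulDeriv i (restrictL2 Ω u - w)‖ ^ 2 := by
  obtain ⟨G₁, hG₁, h₁⟩ := hu.exists_gradient_restrict h hs
  have hu0 : HasFinitePotential Ω V (restrictL2 Ω u) := hu.1.restrict
  obtain ⟨hw0, G₂, hG₂, h₂⟩ := hw
  set y := restrictL2 Ω u - w with hy
  set G : Fin d → L2 Ω := fun i => G₁ i - G₂ i with hG
  have hyG : HasWeakGradient Ω y G := by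
    simpa [hy, hG, sub_eq_add_neg, Pi.add_def] using hG₁.add (hG₂.smul (-1))
  have hy0 : HasFinitePotential Ω V y := by
    simpa [hy, sub_eq_add_neg] using hu0.add (hw0.smul (-1))
  have hv := hyG.mul h
  -- Both equations are tested with `ζ² y`. The first already contains one factor `ζ`, so it is
  -- applied to `ζ y`.
  have e₁ := h₁ _ _ hv (hy0.mul h)
  have e₂ := h₂ _ _ (hv.mul h) ((hy0.mul h).mul h)
  simp only [← inner_L2] at e₂
  set v := h.mul (h.mul y) with hvdef
  have hv0 : HasFinitePotential Ω V v := (hy0.mul h).mul h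
  have epot : (∫ x in (Ω : Set (Rd d)), (V x : ℂ) * restrictL2 Ω u x * conj (v x))
      - (∫ x in (Ω : Set (Rd d)), (V x : ℂ) * w x * conj (v x))
      = ((∫ x in (Ω : Set (Rd d)), V x * ‖h.mul y x‖ ^ 2 : ℝ) : ℂ) := by
    rw [← integral_sub (integrable_potential hu0 hv0) (integrable_potential hw0 hv0),
      ← integral_complex_ofReal]
    refine integral_congr_ae ?_
    filter_upwards [coeFn_mulL2 h.measurable h.norm_le (h.mul y),
      coeFn_mulL2 h.measurable h.norm_le y, Lp.coeFn_sub (restrictL2 Ω u) w] with x h1 h2 h3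
    have h4 : v x = (ζ x : ℂ) * h.mul y x := h1
    have h5 : h.mul y x = (ζ x : ℂ) * (restrictL2 Ω u x - w x) := by
      rw [IsMultiplier.mul, h2, hy, h3, Pi.sub_apply]
    have h6 : ((‖h.mul y x‖ ^ 2 : ℝ) : ℂ) = h.mul y x * conj (h.mul y x) := by
      rw [Complex.mul_conj, Complex.normSq_eq_norm_sq]
    rw [Complex.ofReal_mul, h6, h4, map_mul, Complex.conj_ofReal]
    linear_combination (-(V x : ℂ) * conj (h.mul y x)) * h5
  have key : (∑ i, inner ℂ (h.mul (h.mul (G i) + h.mulDeriv i y) + h.mulDeriv i (h.mul y)) (G i))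
      + Complex.I * ((∫ x in (Ω : Set (Rd d)), V x * ‖h.mul y x‖ ^ 2 : ℝ) : ℂ)
      = - inner ℂ v y := by
    rw [← epot]
    have c1 : ∀ H : Fin d → L2 Ω, ∑ i, inner ℂ (H i) (G i)
        = ∑ i, inner ℂ (H i) (G₁ i) - ∑ i, inner ℂ (H i) (G₂ i) := fun H => by
      simp only [hG, inner_sub_right, Finset.sum_sub_distrib]
    have c2 : inner ℂ v y = inner ℂ v (restrictL2 Ω u) - inner ℂ v w := inner_sub_right _ _ _
    have c3 : inner ℂ v (restrictL2 Ω (f - u))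
        = inner ℂ v (restrictL2 Ω f) - inner ℂ v (restrictL2 Ω u) := by
      rw [map_sub, inner_sub_right]
    have c4 : inner ℂ v (restrictL2 Ω f - w)
        = inner ℂ v (restrictL2 Ω f) - inner ℂ v w := inner_sub_right _ _ _
    rw [c1, c2]
    rw [c3] at e₁
    rw [c4] at e₂
    linear_combination e₁ - e₂
  -- The identity behind it is `Re ⟪∂ᵢ(ζ² y), ∂ᵢy⟫ = ‖∂ᵢ(ζ y)‖² - ‖(∂ᵢζ) y‖²`; the first term is
  -- dropped. Below, `a = ζ ∂ᵢy`, `b = (∂ᵢζ) y` and `a + b = ∂ᵢ(ζ y)`.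
  have hterm : ∀ i, (inner ℂ (h.mul (h.mul (G i) + h.mulDeriv i y) + h.mulDeriv i (h.mul y))
      (G i)).re ≥ - ‖h.mulDeriv i y‖ ^ 2 := fun i => by
    have c1 : inner ℂ (h.mulDeriv i (h.mul y)) (G i) = inner ℂ (h.mulDeriv i y) (h.mul (G i)) := by
      rw [h.mulDeriv_mul_comm]
      exact inner_mulL2_left _ _ _ _
    have c2 : inner ℂ (h.mul (h.mul (G i) + h.mulDeriv i y)) (G i)
        = inner ℂ (h.mul (G i) + h.mulDeriv i y) (h.mul (G i)) :=
      inner_mulL2_left _ _ _ _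
    rw [inner_add_left, c1, c2, ← inner_add_left]
    set a := h.mul (G i)
    set b := h.mulDeriv i y
    have c3 : inner ℂ (a + b + b) a = inner ℂ (a + b) (a + b) - inner ℂ b b
        + (inner ℂ b a - inner ℂ a b) := by
      simp only [inner_add_left, inner_add_right]
      ring
    have c4 : ∀ m : L2 Ω, (inner ℂ m m).re = ‖m‖ ^ 2 := fun m =>
      inner_self_eq_norm_sq (𝕜 := ℂ) m
    have c5 : (inner ℂ b a).re = (inner ℂ a b).re := inner_re_symm (𝕜 := ℂ) b a
    rw [c3, Complex.add_re, Complex.sub_re, Complex.sub_re, c4, c4, c5]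
    nlinarith [sq_nonneg ‖a + b‖]
  have hnorm : (inner ℂ v y).re = ‖h.mul y‖ ^ 2 := by
    have c1 : inner ℂ v y = inner ℂ (h.mul y) (h.mul y) := inner_mulL2_left _ _ _ _
    rw [c1]
    exact inner_self_eq_norm_sq (𝕜 := ℂ) _
  -- The potential term is `i` times a real number, so it disappears here.
  have kre := congrArg Complex.re key
  rw [Complex.add_re, Complex.re_sum, Complex.neg_re, hnorm, Complex.I_mul_re, Complex.ofReal_im,
    neg_zero, add_zero] at kre
  have hsum := Finset.sum_le_sum fun i (_ : i ∈ Finset.univ) => hterm i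
  rw [Finset.sum_neg_distrib] at hsum
  linarith

/-- The indicator of a measurable set as a function bounded by one. -/
lemma norm_indicator_one_le (S : Set (Rd d)) (x : Rd d) :
    ‖S.indicator (fun _ => (1 : ℂ)) x‖ ≤ 1 := by
  by_cases hx : x ∈ S <;> simp [hx]

/-- The restriction to a measurable set, as a projection in `L²(Ω)`. -/
def cutoffL2 {S : Set (Rd d)} (hS : MeasurableSet S) : L2 Ω →L[ℂ] L2 Ω :=
  mulL2 (measurable_const.indicator hS) (norm_indicator_one_le S)

lemma coeFn_cutoffL2 {S : Set (Rd d)} (hS : MeasurableSet S) (u : L2 Ω) :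
    cutoffL2 hS u =ᵐ[volume.restrict (Ω : Set (Rd d))] S.indicator u := by
  filter_upwards [coeFn_mulL2 (measurable_const.indicator hS) (norm_indicator_one_le S) u]
    with x hx
  rw [cutoffL2, hx]
  by_cases hxS : x ∈ S <;> simp [hxS]

lemma enorm_cutoffL2_sq {S : Set (Rd d)} (hS : MeasurableSet S) (u : L2 Ω) :
    ‖cutoffL2 hS u‖ₑ ^ 2 = ∫⁻ x in S ∩ (Ω : Set (Rd d)), ‖u x‖ₑ ^ 2 := by
  rw [Lp.enorm_def, ← lintegral_enorm_sq, ← Measure.restrict_restrict hS,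
    ← lintegral_indicator hS]
  refine lintegral_congr_ae ?_
  filter_upwards [coeFn_cutoffL2 hS u] with x hx
  rw [hx]
  by_cases hxS : x ∈ S <;> simp [hxS]

/-- The Rellich theorem in terms of cutoffs. -/
lemma IsLocallyShiftable.tendsto_cutoffL2 (hΩ : IsLocallyShiftable Ω) {u : ℕ → L2 Ω} {M : ℝ}
    (hu : ∀ n, ‖u n‖ ≤ M)
    (hG : ∀ n, ∃ G : Fin d → L2 Ω, HasWeakGradient Ω (u n) G ∧ ∀ i, ‖G i‖ ≤ M)
    (hw : IsWeaklyNull u) {S : Set (Rd d)} (hS : IsCompact S) :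
    Tendsto (fun n => ‖cutoffL2 hS.measurableSet (u n)‖) atTop (𝓝 0) := by
  have h := hΩ.tendsto_lintegral hu hG hw hS
  simp only [← enorm_cutoffL2_sq hS.measurableSet] at h
  have h2 := (ENNReal.tendsto_toReal ENNReal.zero_ne_top).comp h
  have h3 := (Real.continuous_sqrt.tendsto _).comp h2
  refine (h3.congr fun n => ?_).trans_eq ?_
  · simp [Real.sqrt_sq]
  · simp

end Comparison

end ExteriorSchrodinger

namespace ExteriorSchrodinger

/-! ### Compactness of the difference of the resolvents -/

noncomputable section Compactness

variable {d : ℕ} {Ω : Opens (Rd d)} {V : C(Rd d, ℝ)}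

instance separableSpace_L2 : SeparableSpace (L2 Ω) := by
  have : Fact ((2 : ENNReal) ≠ ⊤) := ⟨ENNReal.ofNat_ne_top⟩
  have : SecondCountableTopology (L2 Ω) := Lp.SecondCountableTopology
  infer_instance

lemma norm_restrictL2_le (f : L2 (⊤ : Opens (Rd d))) : ‖restrictL2 Ω f‖ ≤ ‖f‖ :=
  ((restrictL2 Ω).le_of_opNorm_le (LinearMap.mkContinuous_norm_le _ zero_le_one _) f).trans_eq
    (one_mul _)

lemma norm_extendByZero_le (f : L2 Ω) : ‖extendByZero Ω f‖ ≤ ‖f‖ :=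
  ((extendByZero Ω).le_of_opNorm_le (LinearMap.mkContinuous_norm_le _ zero_le_one _) f).trans_eq
    (one_mul _)

lemma cutoffL2_restrictL2 {S : Set (Rd d)} (hS : MeasurableSet S) (u : L2 (⊤ : Opens (Rd d))) :
    cutoffL2 hS (restrictL2 Ω u) = restrictL2 Ω (cutoffL2 hS u) := by
  refine Lp.ext ?_
  filter_upwards [coeFn_cutoffL2 hS (restrictL2 Ω u), coeFn_restrictL2 (Ω := Ω) u,
    coeFn_restrictL2 (Ω := Ω) (cutoffL2 hS u),
    ae_restrict_of_ae (ae_restrict_top.1 (coeFn_cutoffL2 hS u))] with x h1 h2 h3 h4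
  rw [h1, h3, h4]
  by_cases hx : x ∈ S <;> simp [hx, h2]

/-- The left side lives on the complement of `Ω`, which is part of `S`. -/
lemma sub_extendByZero_restrictL2 {S : Set (Rd d)} (hS : MeasurableSet S)
    (hSΩ : ((Ω : Set (Rd d))ᶜ) ⊆ S) (u : L2 (⊤ : Opens (Rd d))) :
    u - extendByZero Ω (restrictL2 Ω u)
      = cutoffL2 hS u - extendByZero Ω (restrictL2 Ω (cutoffL2 hS u)) := by
  refine Lp.ext (ae_restrict_top.2 ?_)
  filter_upwards [ae_restrict_top.1 (Lp.coeFn_sub u (extendByZero Ω (restrictL2 Ω u))),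
    ae_restrict_top.1 (Lp.coeFn_sub (cutoffL2 hS u)
      (extendByZero Ω (restrictL2 Ω (cutoffL2 hS u)))),
    coeFn_extendByZero (restrictL2 Ω u), coeFn_extendByZero (restrictL2 Ω (cutoffL2 hS u)),
    (ae_restrict_iff' Ω.isOpen.measurableSet).1 (coeFn_restrictL2 (Ω := Ω) u),
    (ae_restrict_iff' Ω.isOpen.measurableSet).1 (coeFn_restrictL2 (Ω := Ω) (cutoffL2 hS u)),
    ae_restrict_top.1 (coeFn_cutoffL2 hS u)] with x h1 h2 h3 h4 h5 h6 h7
  rw [h1, h2, Pi.sub_apply, Pi.sub_apply, h3, h4]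
  by_cases hx : x ∈ (Ω : Set (Rd d))
  · simp [hx, h5 hx, h6 hx]
  · have hxS : x ∈ S := hSΩ hx
    simp [hx, h7, hxS]

/-- A multiplier which vanishes near the complement of `Ω` and equals one outside `S`. -/
structure IsCutoff (Ω : Opens (Rd d)) (S : Set (Rd d)) (ζ : Rd d → ℝ) (C : ℝ) : Prop
    extends IsMultiplier ζ C where
  tsupport_subset : tsupport ζ ⊆ (Ω : Set (Rd d))
  compl_subset : ((Ω : Set (Rd d))ᶜ) ⊆ S
  eq_one : ∀ x ∉ S, ζ x = 1
  partialDeriv_eq_zero : ∀ x ∉ S, ∀ i, partialDeriv i ζ x = 0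

lemma exists_isCutoff (K : Compacts (Rd d)) :
    ∃ (S : Set (Rd d)) (ζ : Rd d → ℝ) (C : ℝ), IsCompact S ∧ IsCutoff (exteriorDomain K) S ζ C := by
  obtain ⟨r, hr, hKr⟩ : ∃ r > 0, (K : Set (Rd d)) ⊆ Metric.ball 0 r :=
    K.isCompact.isBounded.subset_ball_lt 0 0
  -- The cutoff is `1 - f`: it vanishes on a ball that contains `K` in its interior, and equals one
  -- outside the ball `S` of radius `r + 1`.
  let f : ContDiffBump (0 : Rd d) := ⟨r, r + 1, hr, by linarith⟩
  have hf : ContDiff ℝ ∞ f := f.contDiff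
  have hpd : ∀ i x, partialDeriv i (fun x => 1 - f x) x = - partialDeriv i f x := fun i x => by
    rw [partialDeriv, fderiv_const_sub]
    rfl
  obtain ⟨C, hC⟩ := (hf.continuous_fderiv (by simp)).bounded_above_of_compact_support
    (f.hasCompactSupport.fderiv ℝ)
  refine ⟨Metric.closedBall 0 (r + 1), fun x => 1 - f x, max 1 C, isCompact_closedBall _ _,
    ⟨contDiff_const.sub hf, fun x => ?_, fun i x => ?_⟩, ?_, ?_, fun x hx => ?_, fun x hx i => ?_⟩
  · rw [Complex.norm_real, Real.norm_of_nonneg (sub_nonneg.2 f.le_one)]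
    exact (sub_le_self _ f.nonneg).trans (le_max_left _ _)
  · rw [hpd, Complex.norm_real, norm_neg]
    refine ((fderiv ℝ f x).le_opNorm _).trans ?_
    rw [PiLp.norm_single, norm_one, mul_one]
    exact (hC x).trans (le_max_right _ _)
  · have h1 : Function.support (fun x => 1 - f x) ⊆ (Metric.ball 0 r)ᶜ := fun x hx hxr =>
      hx (sub_eq_zero.2 (f.one_of_mem_closedBall (Metric.ball_subset_closedBall hxr)).symm)
    exact (closure_minimal h1 Metric.isOpen_ball.isClosed_compl).trans
      (Set.compl_subset_compl.2 hKr)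
  · intro x hx
    have hxK : x ∈ (K : Set (Rd d)) := not_not.1 hx
    exact Metric.ball_subset_closedBall (Metric.ball_subset_ball (by linarith) (hKr hxK))
  · have h1 : f x = 0 := f.zero_of_le_dist (by
      rw [Metric.mem_closedBall, not_le] at hx
      exact hx.le)
    simp [h1]
  · have h1 : x ∉ tsupport f := by
      rw [f.tsupport_eq]
      exact hx
    rw [hpd, partialDeriv, image_eq_zero_of_notMem_tsupport
      (fun h => h1 (tsupport_fderiv_subset ℝ h))]
    simp

lemma IsCutoff.mulDeriv_cutoffL2 {S : Set (Rd d)} {ζ : Rd d → ℝ} {C : ℝ} (h : IsCutoff Ω S ζ C)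
    (hS : MeasurableSet S) (i : Fin d) (y : L2 Ω) :
    h.mulDeriv i (cutoffL2 hS y) = h.mulDeriv i y := by
  refine Lp.ext ?_
  filter_upwards [coeFn_mulL2 (h.measurable_partialDeriv i) (h.norm_partialDeriv_le i) y,
    coeFn_mulL2 (h.measurable_partialDeriv i) (h.norm_partialDeriv_le i) (cutoffL2 hS y),
    coeFn_cutoffL2 hS y] with x h1 h2 h3
  refine h2.trans (Eq.trans ?_ h1.symm)
  rw [h3]
  by_cases hx : x ∈ S
  · simp [hx]
  · simp [hx, h.partialDeriv_eq_zero x hx i]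

/-- `(1 - ζ) y` only sees `y` on `S`. So `y` is controlled by `ζ y` and its part in `S`. -/
lemma IsCutoff.mul_add_sub {S : Set (Rd d)} {ζ : Rd d → ℝ} {C : ℝ} (h : IsCutoff Ω S ζ C)
    (hS : MeasurableSet S) (y : L2 Ω) :
    h.mul y + (cutoffL2 hS y - h.mul (cutoffL2 hS y)) = y := by
  refine Lp.ext ?_
  filter_upwards [coeFn_mulL2 h.measurable h.norm_le y,
    coeFn_mulL2 h.measurable h.norm_le (cutoffL2 hS y), coeFn_cutoffL2 hS y,
    Lp.coeFn_add (h.mul y) (cutoffL2 hS y - h.mul (cutoffL2 hS y)),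
    Lp.coeFn_sub (cutoffL2 hS y) (h.mul (cutoffL2 hS y))] with x h1 h2 h3 h4 h5
  rw [h4, Pi.add_apply, h5, Pi.sub_apply, show h.mul y x = _ from h1,
    show h.mul (cutoffL2 hS y) x = _ from h2, h3]
  by_cases hx : x ∈ S
  · simp [hx]
  · simp [hx, h.eq_one x hx]

/-- The difference of two resolvents is controlled on a compact set. -/
lemma IsNeumannImage.norm_sub_extendByZero_le {u f : L2 (⊤ : Opens (Rd d))} {w : L2 Ω}
    (hu : IsNeumannImage ⊤ V u (f - u))
    (hw : IsNeumannImage Ω V w (restrictL2 Ω f - w)) {S : Set (Rd d)} {ζ : Rd d → ℝ} {C : ℝ}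
    (h : IsCutoff Ω S ζ C) (hS : MeasurableSet S) :
    ‖u - extendByZero Ω w‖
      ≤ (d * C + 1 + C) * (‖cutoffL2 hS u‖ + ‖cutoffL2 hS w‖) + 2 * ‖cutoffL2 hS u‖ := by
  have hC : 0 ≤ C := (norm_nonneg _).trans (h.norm_le 0)
  set y := restrictL2 Ω u - w with hy
  set t := ‖cutoffL2 hS y‖ with ht
  have ht0 : 0 ≤ t := norm_nonneg _
  have h1 : ‖h.mul y‖ ≤ d * C * t := by
    have h2 := hu.norm_mul_sub_sq_le hw h.toIsMultiplier h.tsupport_subset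
    have h3 : ∀ i ∈ Finset.univ, ‖h.mulDeriv i y‖ ^ 2 ≤ (C * t) ^ 2 := fun i _ => by
      rw [← h.mulDeriv_cutoffL2 hS]
      gcongr
      exact norm_mulL2_le _ _ _
    have h4 := h2.trans (Finset.sum_le_card_nsmul _ _ _ h3)
    rw [Finset.card_univ, Fintype.card_fin, nsmul_eq_mul] at h4
    refine le_of_sq_le_sq (h4.trans ?_) (by positivity)
    -- Gives up `√d` for `d`, to avoid a square root in the constant.
    have h5 : (d : ℝ) ≤ (d : ℝ) ^ 2 := by exact_mod_cast Nat.le_self_pow two_ne_zero d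
    calc (d : ℝ) * (C * t) ^ 2 ≤ (d : ℝ) ^ 2 * (C * t) ^ 2 := by gcongr
      _ = (d * C * t) ^ 2 := by ring
  have h2 : ‖y‖ ≤ (d * C + 1 + C) * t := by
    calc ‖y‖ = ‖h.mul y + (cutoffL2 hS y - h.mul (cutoffL2 hS y))‖ := by rw [h.mul_add_sub hS]
      _ ≤ ‖h.mul y‖ + (‖cutoffL2 hS y‖ + ‖h.mul (cutoffL2 hS y)‖) :=
        (norm_add_le _ _).trans (by gcongr; exact norm_sub_le _ _)
      _ ≤ d * C * t + (t + C * t) := by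
        gcongr
        exact norm_mulL2_le _ _ _
      _ = (d * C + 1 + C) * t := by ring
  have h3 : t ≤ ‖cutoffL2 hS u‖ + ‖cutoffL2 hS w‖ := by
    rw [ht, hy, map_sub, cutoffL2_restrictL2]
    exact (norm_sub_le _ _).trans (by gcongr; exact norm_restrictL2_le _)
  have h4 : u - extendByZero Ω w = extendByZero Ω y
      + (cutoffL2 hS u - extendByZero Ω (restrictL2 Ω (cutoffL2 hS u))) := by
    rw [← sub_extendByZero_restrictL2 hS h.compl_subset, hy, map_sub]
    abel
  rw [h4]
  calc _ ≤ ‖y‖ + (‖cutoffL2 hS u‖ + ‖cutoffL2 hS u‖) := by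
        refine (norm_add_le _ _).trans (add_le_add (norm_extendByZero_le _)
          ((norm_sub_le _ _).trans ?_))
        gcongr
        exact (norm_extendByZero_le _).trans (norm_restrictL2_le _)
    _ ≤ _ := by
        rw [← two_mul]
        gcongr
        exact h2.trans (by gcongr)

lemma IsResolvent.tendsto_cutoffL2 {R : L2 Ω →L[ℂ] L2 Ω} (hR : IsResolvent Ω V R)
    (hΩ : IsLocallyShiftable Ω) {f : ℕ → L2 Ω} {M : ℝ} (hf : ∀ n, ‖f n‖ ≤ M)
    (hw : IsWeaklyNull f) {S : Set (Rd d)} (hS : IsCompact S) :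
    Tendsto (fun n => ‖cutoffL2 hS.measurableSet (R (f n))‖) atTop (𝓝 0) := by
  refine hΩ.tendsto_cutoffL2 (u := fun n => R (f n)) (M := max (‖R‖ * M) M)
    (fun n => ?_) (fun n => ?_) (hw.map R) hS
  · exact (R.le_opNorm_of_le (hf n)).trans (le_max_left _ _)
  · obtain ⟨G, hG, hG'⟩ := hR.exists_norm_gradient_le (f n)
    exact ⟨G, hG, fun i => ((hG' i).trans (hf n)).trans (le_max_right _ _)⟩

/-- The resolvents in the whole space and in an exterior domain differ by a compact operator. -/
theorem isCompactOperator_sub_zeroDirectSum {K : Compacts (Rd d)}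
    (hK : HasSmoothBoundary (K : Set (Rd d)))
    {A : L2 (⊤ : Opens (Rd d)) →L[ℂ] L2 (⊤ : Opens (Rd d))} (hA : IsResolvent ⊤ V A)
    {R : L2 (exteriorDomain K) →L[ℂ] L2 (exteriorDomain K)}
    (hR : IsResolvent (exteriorDomain K) V R) :
    IsCompactOperator (A - zeroDirectSum (exteriorDomain K) R) := by
  obtain ⟨S, ζ, C, hS, hζ⟩ := exists_isCutoff K
  refine isCompactOperator_of_tendsto_zero fun f M hf hw => ?_
  have h1 := hA.tendsto_cutoffL2 isLocallyShiftable_top hf hw hS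
  have h2 := hR.tendsto_cutoffL2 hK.isLocallyShiftable
    (fun n => (norm_restrictL2_le (f n)).trans (hf n)) (hw.map (restrictL2 _)) hS
  have h3 := ((h1.add h2).const_mul (d * C + 1 + C)).add (h1.const_mul 2)
  simp only [add_zero, mul_zero] at h3
  exact squeeze_zero_norm
    (fun n => (hA (f n)).norm_sub_extendByZero_le (hR _) hζ hS.measurableSet) h3

end Compactness

/-! ### The two essential spectra -/

noncomputable section EssentialSpectrum

variable {d : ℕ}

/-- Functions supported in `K` restrict to zero on the exterior. The indicators of infinitely many
disjoint nonempty open subsets of the interior form an orthogonal family of such functions. -/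
lemma not_finiteDimensional_ker_zeroDirectSum (hd : 2 ≤ d) {K : Compacts (Rd d)}
    (hK : (interior (K : Set (Rd d))).Nonempty)
    (R : L2 (exteriorDomain K) →L[ℂ] L2 (exteriorDomain K)) :
    ¬ FiniteDimensional ℂ (zeroDirectSum (exteriorDomain K) R).ker := by
  intro hfin
  have : Nonempty (Fin d) := ⟨⟨0, by omega⟩⟩
  have : Nontrivial (Rd d) := inferInstance
  obtain ⟨x, hx⟩ := hK
  have := Module.punctured_nhds_neBot ℝ (Rd d) x
  have : Infinite (interior (K : Set (Rd d))) :=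
    (infinite_of_mem_nhds x (isOpen_interior.mem_nhds hx)).to_subtype
  obtain ⟨U, hUinf, hUo, hUd⟩ :=
    exists_seq_infinite_isOpen_pairwise_disjoint (interior (K : Set (Rd d)))
  set s : ℕ → Set (Rd d) := fun n => Subtype.val '' U n with hs
  have hso : ∀ n, IsOpen (s n) := fun n =>
    isOpen_interior.isOpenEmbedding_subtypeVal.isOpenMap _ (hUo n)
  have hsK : ∀ n, s n ⊆ (K : Set (Rd d)) := fun n => by
    rintro _ ⟨y, -, rfl⟩
    exact interior_subset y.2
  have hfinite : ∀ n, (volume.restrict ((⊤ : Opens (Rd d)) : Set (Rd d))) (s n) ≠ ⊤ := fun n => by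
    rw [Opens.coe_top, Measure.restrict_univ]
    exact ne_top_of_le_ne_top K.isCompact.measure_lt_top.ne (measure_mono (hsK n))
  set e : ℕ → L2 (⊤ : Opens (Rd d)) := fun n =>
    indicatorConstLp 2 (hso n).measurableSet (hfinite n) 1 with he
  have hcoe : ∀ n, e n =ᵐ[volume] (s n).indicator fun _ => 1 := fun n =>
    ae_restrict_top.1 indicatorConstLp_coeFn
  have hne : ∀ n, e n ≠ 0 := fun n h0 => by
    have h1 : ‖e n‖ ≠ 0 := by
      rw [he, norm_indicatorConstLp two_ne_zero ENNReal.ofNat_ne_top, norm_one, one_mul]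
      refine (Real.rpow_pos_of_pos ?_ _).ne'
      rw [measureReal_def]
      refine ENNReal.toReal_pos ?_ (hfinite n)
      rw [Opens.coe_top, Measure.restrict_univ]
      exact ((hso n).measure_pos _ ((hUinf n).nonempty.image _)).ne'
    exact h1 (by rw [h0, norm_zero])
  have horth : Pairwise fun m n => inner ℂ (e m) (e n) = 0 := fun m n hmn => by
    dsimp only
    rw [inner_L2, setIntegral_top]
    refine integral_eq_zero_of_ae ?_
    filter_upwards [hcoe m, hcoe n] with y h1 h2
    rw [h1, h2]
    by_cases hy : y ∈ s m
    · have hd' : Disjoint (s m) (s n) :=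
        (Set.disjoint_image_iff Subtype.val_injective).2 (hUd hmn)
      simp [Set.disjoint_left.1 hd' hy]
    · simp [hy]
  have hker : ∀ n, e n ∈ (zeroDirectSum (exteriorDomain K) R).ker := fun n => by
    have h0 : restrictL2 (exteriorDomain K) (e n) = 0 := by
      refine Lp.ext ?_
      filter_upwards [coeFn_restrictL2 (Ω := exteriorDomain K) (e n),
        ae_restrict_of_ae (hcoe n), ae_restrict_mem (exteriorDomain K).isOpen.measurableSet,
        Lp.coeFn_zero ℂ 2 (volume.restrict (exteriorDomain K : Set (Rd d)))] with y h1 h2 h3 h4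
      rw [h1, h2, h4, Set.indicator_of_notMem fun hy => h3 (hsK n hy)]
      rfl
    change extendByZero _ (R (restrictL2 _ (e n))) = 0
    rw [h0, map_zero, map_zero]
  have hli : LinearIndependent ℂ fun n => (⟨e n, hker n⟩ : (zeroDirectSum _ R).ker) :=
    LinearIndependent.of_comp (Submodule.subtype _)
      (linearIndependent_of_ne_zero_of_inner_eq_zero hne horth)
  exact not_finite_iff_infinite.2 inferInstance hli.finite

/-- The essential spectra of the resolvents in the whole space and in an exterior domain
coincide. -/
theorem essentialSpectrum_eq_zeroDirectSum (hd : 2 ≤ d) {j : ℝ} (hj : j ≠ 0) {K : Compacts (Rd d)}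
    (hKint : (interior (K : Set (Rd d))).Nonempty)
    {A : L2 (⊤ : Opens (Rd d)) →L[ℂ] L2 (⊤ : Opens (Rd d))}
    (hA : IsResolvent ⊤ (linearPotential hd j) A)
    {R : L2 (exteriorDomain K) →L[ℂ] L2 (exteriorDomain K)}
    (hAB : IsCompactOperator (A - zeroDirectSum (exteriorDomain K) R)) :
    essentialSpectrum A = essentialSpectrum (zeroDirectSum (exteriorDomain K) R) := by
  have hspec := hA.spectrum_subset hj
  have hker := not_finiteDimensional_ker_zeroDirectSum hd hKint R
  have : Nontrivial (L2 (⊤ : Opens (Rd d))) := by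
    by_contra h
    have := not_nontrivial_iff_subsingleton.1 h
    exact hker inferInstance
  -- Treats `A` as a compact perturbation of itself, so that one lemma handles both operators.
  have hAA : IsCompactOperator (A - A) := by
    rw [sub_self]
    exact isCompactOperator_zero
  rw [Set.Subset.antisymm (essentialSpectrum_subset_singleton hspec hAA)
      (Set.singleton_subset_iff.2
        (zero_mem_essentialSpectrum hspec hA.injective hA.denseRange)),
    Set.Subset.antisymm (essentialSpectrum_subset_singleton hspec hAB)
      (Set.singleton_subset_iff.2 (zero_mem_essentialSpectrum_of_ker hker))]

end EssentialSpectrum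

end ExteriorSchrodinger

open ExteriorSchrodinger in
theorem mainTheorem4 (d : ℕ) (hd : 2 ≤ d) (j : ℝ) (hj : j ≠ 0)
    (K : TopologicalSpace.Compacts (Rd d)) (hK : HasSmoothBoundary (K : Set (Rd d)))
    (hKint : (interior (K : Set (Rd d))).Nonempty) :
    ∃ (A : L2 (⊤ : TopologicalSpace.Opens (Rd d)) →L[ℂ] L2 (⊤ : TopologicalSpace.Opens (Rd d)))
      (R : L2 (exteriorDomain K) →L[ℂ] L2 (exteriorDomain K)),
      IsBoundedInverse (addOne (neumannRealization ⊤ (linearPotential hd j))) A ∧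
      IsBoundedInverse (addOne (neumannRealization (exteriorDomain K) (linearPotential hd j))) R ∧
      IsCompactOperator (A - zeroDirectSum (exteriorDomain K) R) ∧
      essentialSpectrum A = essentialSpectrum (zeroDirectSum (exteriorDomain K) R) := by
  obtain ⟨A, hA⟩ := exists_isResolvent_linearPotential hd j ⊤
  obtain ⟨R, hR⟩ := exists_isResolvent_linearPotential hd j (exteriorDomain K)
  have hAB := isCompactOperator_sub_zeroDirectSum hK hA hR
  exact ⟨A, R, hA.isBoundedInverse, hR.isBoundedInverse, hAB,
    essentialSpectrum_eq_zeroDirectSum hd hj hKint hA hAB⟩
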